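/- Let $M$ be a smooth manifold (finite-dimensional, Hausdorff, $\sigma$-compact) and $n=\dim M$. An NQ manifold over $M$ is a non-negatively graded manifold with body $M$ together with a degree $1$ homological vector field, i.e. an $\mathbb R$-linear operator $Q$ on its graded commutative algebra of functions that raises the degree by one and satisfies $Q(fg)=Q(f)g+(-1)^{|f|}fQ(g)$ and $Q^2=0$. An isomorphism of NQ manifolds is (on functions) an isomorphism of graded algebras that intertwines the operators $Q$. *The standard Courant algebroid.* $T^*[2]T[1]M$ is the graded manifold with local coordinates $(q^i,\xi^i,p_i,\theta_i)$ of degrees $0,1,2,1$, where $q^i$ are coordinates on $M$, $\xi^i=dq^i$, $p_i=\partial/\partial q^i$ and $\theta_i=\partial/\partial\xi^i$ (coordinate vector fields on $T[1]M$); thus under a change of coordinates $$\xi'^a=\tfrac{\partial q'^a}{\partial q^i}\xi^i,\qquad \theta'_a=\tfrac{\partial q^i}{\partial q'^a}\theta_i,\qquad p'_a=\tfrac{\partial q^i}{\partial q'^a}p_i+\tfrac{\partial^2 q^i}{\partial q'^a\partial q'^b}\xi'^b\theta_i .$$ It carries the vector field $Q=\xi^i\frac{\partial}{\partial q^i}+p_i\frac{\partial}{\partial\theta_i}$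 (in every such coordinate system). *The semidirect product.* A representation up to homotopy of $TM$ on the complex $T^*M\xrightarrow{\mathrm{Id}}T^*M$ is a pair $(\nabla,\omega)$ of a smooth connection $\nabla$ on $T^*M$ and the $2$-form $\omega\in\Omega^2(M,\mathrm{End}(T^*M))$ with $[\nabla_X,\nabla_Y]-\nabla_{[X,Y]}=\omega(X,Y)$. Its semidirect product $TM\ltimes(T^*M\xrightarrow{\mathrm{Id}}T^*M)$ is the split graded manifold with algebra of functions $\Gamma\big(\Lambda(T^*M\oplus TM)\otimes S(TM)\big)$, where the factors $T^*M=(TM)^*$ and $TM=(T^*M)^*$ in $\Lambda$ have degree $1$ and the factor $TM=(T^*M)^*$ in $S$ has degree $2$, with the derivation $\widetilde D$ that is the de Rham differential on $\Omega(M)=\Gamma(\Lambda T^*M)$ and that, for a vector field $V$, viewed as $\theta_V$ in degree $1$ and as $p_V$ in degree $2$, is given in local coordinates by $$\widetilde D\theta_V=p_V+\xi^i\,\theta_{\nabla^*_{\partial_i}V},\qquad \widetilde D p_V=\xi^i\,p_{\nabla^*_{\partial_i}V}+\tfrac12\,\langle V,\omega(\partial_i,\partial_l)\,dq^k\rangle\,\xi^i\xi^l\theta_k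 ,$$ where $\xi^i=dq^i$, $\partial_i=\partial/\partial q^i$, $\theta_k=\theta_{\partial_k}$ and $\nabla^*$ is the connection on $TM$ dual to $\nabla$. **Theorem.** $Q$ is a homological vector field on $T^*[2]T[1]M$. Representations up to homotopy of $TM$ on $T^*M\xrightarrow{\mathrm{Id}}T^*M$ exist, and for each of them $\widetilde D$ is a homological vector field and the standard Courant algebroid $(T^*[2]T[1]M,Q)$ is isomorphic, as an NQ manifold and over the identity of $M$, to the semidirect product $TM\ltimes(T^*M\xrightarrow{\mathrm{Id}}T^*M)$. -/

import Mathlib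

open scoped Manifold ContDiff TensorProduct

noncomputable section

namespace CourantNQ

/-! ### The local model

Local functions on both graded manifolds are polynomials, with smooth coefficients in the base
coordinates `q`, in odd generators `ξ i`, `θ i` of degree 1 and even generators `p i` of
degree 2. -/

/-- The base model `ℝⁿ`. -/
abbrev E (n : ℕ) : Type := EuclideanSpace ℝ (Fin n)

/-- The free graded commutative algebra on `ξ i`, `θ i` (degree 1) and `p i` (degree 2). -/
abbrev F (n : ℕ) : Type :=
  ExteriorAlgebra ℝ ((Fin n → ℝ) × (Fin n → ℝ)) ⊗[ℝ] MvPolynomial (Fin n) ℝ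

/-- The element `∑ i, v i • ξ i`. -/
def xiOf {n : ℕ} (v : Fin n → ℝ) : F n := ExteriorAlgebra.ι ℝ (v, 0) ⊗ₜ 1

/-- The element `∑ i, v i • θ i`. -/
def thetaOf {n : ℕ} (v : Fin n → ℝ) : F n := ExteriorAlgebra.ι ℝ (0, v) ⊗ₜ 1

/-- The degree 1 generator `ξ i`. -/
def xi {n : ℕ} (i : Fin n) : F n := xiOf (Pi.single i 1)

/-- The degree 1 generator `θ i`. -/
def theta {n : ℕ} (i : Fin n) : F n := thetaOf (Pi.single i 1)

/-- The degree 2 generator `p i`. -/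
def p {n : ℕ} (i : Fin n) : F n := 1 ⊗ₜ MvPolynomial.X i

/-- The elements of degree `k`: sums of products of an exterior form of degree `a` in `ξ, θ` and
a homogeneous polynomial of degree `b` in `p`, where `a + 2 * b = k`. -/
def degree (n k : ℕ) : Submodule ℝ (F n) :=
  Submodule.span ℝ {w | ∃ a b : ℕ, a + 2 * b = k ∧
    ∃ u ∈ ⋀[ℝ]^a ((Fin n → ℝ) × (Fin n → ℝ)),
      ∃ v ∈ MvPolynomial.homogeneousSubmodule (Fin n) ℝ b, w = u ⊗ₜ v}

/-- The odd left derivation `∂/∂θ i` (contraction with the dual basis covector). -/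
def dTheta {n : ℕ} (i : Fin n) : F n →ₗ[ℝ] F n :=
  LinearMap.rTensor (MvPolynomial (Fin n) ℝ)
    (CliffordAlgebra.contractLeft (Q := (0 : QuadraticForm ℝ ((Fin n → ℝ) × (Fin n → ℝ))))
      (LinearMap.proj i ∘ₗ LinearMap.snd ℝ (Fin n → ℝ) (Fin n → ℝ)))

/-- The even derivation `∂/∂p i`. -/
def dP {n : ℕ} (i : Fin n) : F n →ₗ[ℝ] F n :=
  LinearMap.lTensor (ExteriorAlgebra ℝ ((Fin n → ℝ) × (Fin n → ℝ)))
    (MvPolynomial.pderiv i).toLinearMap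

/-- `w` is the partial derivative `∂g/∂q i` at `y` of a function with values in `F n`. -/
def HasPartial {n : ℕ} (i : Fin n) (g : E n → F n) (w : F n) (y : E n) : Prop :=
  ∀ l : Module.Dual ℝ (F n),
    HasLineDerivAt ℝ (fun z ↦ l (g z)) (l w) y (EuclideanSpace.single i (1 : ℝ))

open Classical in
/-- The partial derivative `∂g/∂q i` at `y ∈ U` of a function on the open set `U`
(`0` if it does not exist). -/
def dq {n : ℕ} {U : Set (E n)} (i : Fin n) (g : U → F n) (y : U) : F n :=
  if h : ∃ w, HasPartial i (Function.extend Subtype.val g 0) w y then h.choose else 0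

/-- Elements of `C^∞(U) ⊗ F n`: finite sums of smooth functions times constant elements. -/
def IsSmooth {n : ℕ} {U : Set (E n)} (g : U → F n) : Prop :=
  ∃ (m : ℕ) (c : Fin m → E n → ℝ) (v : Fin m → F n),
    (∀ a, ContDiffOn ℝ ∞ (c a) U) ∧ ∀ y : U, g y = ∑ a, c a y • v a

/-! ### Changes of the graded coordinates over a point -/

theorem mem_center_of_even {n : ℕ} (u v : (Fin n → ℝ) × (Fin n → ℝ))
    (r : MvPolynomial (Fin n) ℝ) :
    ((ExteriorAlgebra.ι ℝ u * ExteriorAlgebra.ι ℝ v) ⊗ₜ r : F n) ∈ Subalgebra.center ℝ (F n) := by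
  have anti : ∀ x y : (Fin n → ℝ) × (Fin n → ℝ),
      ExteriorAlgebra.ι ℝ x * ExteriorAlgebra.ι ℝ y
        = -(ExteriorAlgebra.ι ℝ y * ExteriorAlgebra.ι ℝ x) := fun x y ↦
    eq_neg_of_add_eq_zero_left (ExteriorAlgebra.ι_add_mul_swap x y)
  have key : ∀ a : ExteriorAlgebra ℝ ((Fin n → ℝ) × (Fin n → ℝ)),
      a * (ExteriorAlgebra.ι ℝ u * ExteriorAlgebra.ι ℝ v)
        = (ExteriorAlgebra.ι ℝ u * ExteriorAlgebra.ι ℝ v) * a := by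
    intro a
    induction a using ExteriorAlgebra.induction with
    | algebraMap s => exact Algebra.commutes s _
    | ι x =>
      rw [← mul_assoc, anti x u, neg_mul, mul_assoc, anti x v, mul_neg, neg_neg, mul_assoc]
    | mul a b ha hb => rw [mul_assoc, hb, ← mul_assoc, ha, mul_assoc]
    | add a b ha hb => rw [add_mul, mul_add, ha, hb]
  rw [Subalgebra.mem_center_iff]
  intro w
  induction w using TensorProduct.induction_on with
  | zero => simp
  | tmul a b => simp only [Algebra.TensorProduct.tmul_mul_tmul, key a, mul_comm b r]
  | add a b ha hb => rw [add_mul, mul_add, ha, hb]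

theorem xiOf_mul_thetaOf_mem_center {n : ℕ} (u v : Fin n → ℝ) :
    xiOf u * thetaOf v ∈ Subalgebra.center ℝ (F n) := by
  have h := mem_center_of_even (u, (0 : Fin n → ℝ)) ((0 : Fin n → ℝ), v) 1
  simpa [xiOf, thetaOf] using h

theorem p_mem_center {n : ℕ} (i : Fin n) : p i ∈ Subalgebra.center ℝ (F n) := by
  rw [Subalgebra.mem_center_iff]
  intro w
  induction w using TensorProduct.induction_on with
  | zero => simp
  | tmul a b => simp [p, Algebra.TensorProduct.tmul_mul_tmul, mul_comm]
  | add a b ha hb => rw [add_mul, mul_add, ha, hb]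

/-- The value of the substitution `glue J K H` on `p a`. -/
def glueP {n : ℕ} (J K : Matrix (Fin n) (Fin n) ℝ) (H : Fin n → Fin n → Fin n → ℝ) (a : Fin n) :
    F n :=
  ∑ i, K a i • p i + ∑ b, ∑ i, H a b i • (xiOf (J b) * theta i)

theorem glueP_mem_center {n : ℕ} (J K : Matrix (Fin n) (Fin n) ℝ)
    (H : Fin n → Fin n → Fin n → ℝ) (a : Fin n) :
    glueP J K H a ∈ Subalgebra.center ℝ (F n) :=
  add_mem (sum_mem fun i _ ↦ Subalgebra.smul_mem _ (p_mem_center i) _)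
    (sum_mem fun _ _ ↦ sum_mem fun _ _ ↦
      Subalgebra.smul_mem _ (xiOf_mul_thetaOf_mem_center _ _) _)

/-- The algebra endomorphism of `F n` with
`ξ a ↦ ∑ i, J a i • ξ i`, `θ a ↦ ∑ i, K a i • θ i` and
`p a ↦ ∑ i, K a i • p i + ∑ b i, H a b i • (∑ j, J b j • ξ j) * θ i`. -/
def glue {n : ℕ} (J K : Matrix (Fin n) (Fin n) ℝ) (H : Fin n → Fin n → Fin n → ℝ) :
    F n →ₐ[ℝ] F n :=
  Algebra.TensorProduct.lift
    (Algebra.TensorProduct.includeLeft.comp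
      (ExteriorAlgebra.map (LinearMap.prodMap (Matrix.vecMulLinear J) (Matrix.vecMulLinear K))))
    ((Subalgebra.center ℝ (F n)).val.comp
      (MvPolynomial.aeval fun a ↦
        (⟨glueP J K H a, glueP_mem_center J K H a⟩ : Subalgebra.center ℝ (F n))))
    (fun _ b ↦ Subalgebra.mem_center_iff.1
      (MvPolynomial.aeval (fun a ↦
        (⟨glueP J K H a, glueP_mem_center J K H a⟩ : Subalgebra.center ℝ (F n))) b).2 _)

theorem glue_xi {n : ℕ} (J K : Matrix (Fin n) (Fin n) ℝ) (H : Fin n → Fin n → Fin n → ℝ)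
    (a : Fin n) : glue J K H (xi a) = xiOf (J a) := by
  refine (Algebra.TensorProduct.lift_tmul _ _ _ _ _).trans ?_
  simp [xiOf]
  rfl

theorem glue_theta {n : ℕ} (J K : Matrix (Fin n) (Fin n) ℝ) (H : Fin n → Fin n → Fin n → ℝ)
    (a : Fin n) : glue J K H (theta a) = thetaOf (K a) := by
  refine (Algebra.TensorProduct.lift_tmul _ _ _ _ _).trans ?_
  simp [thetaOf]
  rfl

theorem glue_p {n : ℕ} (J K : Matrix (Fin n) (Fin n) ℝ) (H : Fin n → Fin n → Fin n → ℝ)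
    (a : Fin n) : glue J K H (p a) = glueP J K H a := by
  refine (Algebra.TensorProduct.lift_tmul _ _ _ _ _).trans ?_
  simp only [map_one, one_mul, AlgHom.comp_apply, MvPolynomial.aeval_X, Subalgebra.coe_val]

/-! ### Graded manifolds glued from the local model -/

section Manifold

variable (n : ℕ) (M : Type*) [TopologicalSpace M] [ChartedSpace (E n) M]

/-- The smooth charts of `M`, that is, its local coordinate systems `(q i)`. -/
abbrev Chart : Type _ :=
  {φ : OpenPartialHomeomorph M (E n) // φ ∈ IsManifold.maximalAtlas (𝓡 n) ∞ M}

/-- Families of local functions, one for each coordinate system, on the range of the chart. -/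
abbrev Family : Type _ := (φ : Chart n M) → φ.1.target → F n

/-- A rule for changing the graded coordinates: `T φ ψ y z` expresses the generators
`ξ, θ, p` belonging to `ψ` through those belonging to `φ` at the point of `M` which has
coordinates `y` in `φ` and `z` in `ψ`. -/
abbrev Transition : Type _ := Chart n M → Chart n M → E n → E n → (F n →ₐ[ℝ] F n)

variable {n M}

/-- The functions of degree `k` on the graded manifold over `M` with the rule `T` for changing
the graded coordinates. -/
def functions (T : Transition n M) (k : ℕ) : Submodule ℝ (Family n M) where
  carrier := {f | (∀ φ y, f φ y ∈ degree n k) ∧ (∀ φ, IsSmooth (f φ)) ∧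
    ∀ (φ ψ : Chart n M) (y : φ.1.target) (z : ψ.1.target),
      φ.1.symm y = ψ.1.symm z → f φ y = T φ ψ y z (f ψ z)}
  zero_mem' := ⟨fun _ _ ↦ zero_mem _, fun _ ↦ ⟨0, 0, 0, by simp, by simp⟩, by simp⟩
  add_mem' := by
    rintro f g ⟨hf, hf', hf''⟩ ⟨hg, hg', hg''⟩
    refine ⟨fun φ y ↦ add_mem (hf φ y) (hg φ y), fun φ ↦ ?_, fun φ ψ y z h ↦ ?_⟩
    · obtain ⟨m, c, v, hc, hv⟩ := hf' φ
      obtain ⟨m', c', v', hc', hv'⟩ := hg' φ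
      refine ⟨m + m', Fin.append c c', Fin.append v v', fun a ↦ ?_, fun y ↦ ?_⟩
      · refine Fin.addCases (fun i ↦ ?_) (fun i ↦ ?_) a
        · simpa using hc i
        · simpa using hc' i
      · simp [Fin.sum_univ_add, hv, hv']
    · simp [hf'' φ ψ y z h, hg'' φ ψ y z h]
  smul_mem' := by
    rintro r f ⟨hf, hf', hf''⟩
    refine ⟨fun φ y ↦ Submodule.smul_mem _ _ (hf φ y), fun φ ↦ ?_, fun φ ψ y z h ↦ ?_⟩
    · obtain ⟨m, c, v, hc, hv⟩ := hf' φ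
      refine ⟨m, c, fun a ↦ r • v a, hc, fun y ↦ ?_⟩
      simp [hv, Finset.smul_sum, smul_comm r]
    · simp [hf'' φ ψ y z h]

theorem one_mem_degree (n : ℕ) : (1 : F n) ∈ degree n 0 :=
  Submodule.subset_span ⟨0, 0, rfl, 1, by simp, 1,
    (MvPolynomial.mem_homogeneousSubmodule _ _).2 (MvPolynomial.isHomogeneous_one _ _), rfl⟩

theorem mul_mem_degree {n k l : ℕ} {u v : F n} (hu : u ∈ degree n k) (hv : v ∈ degree n l) :
    u * v ∈ degree n (k + l) := by
  have h : degree n k * degree n l ≤ degree n (k + l) := by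
    unfold degree
    rw [Submodule.span_mul_span]
    apply Submodule.span_mono
    rintro _ ⟨_, ⟨a, b, hab, x, hx, y, hy, rfl⟩, _, ⟨a', b', hab', x', hx', y', hy', rfl⟩, rfl⟩
    refine ⟨a + a', b + b', by omega, x * x', ?_, y * y', ?_, by simp⟩
    · exact SetLike.GradedMul.mul_mem hx hx'
    · exact MvPolynomial.IsHomogeneous.mul hy hy'
  exact h (Submodule.mul_mem_mul hu hv)

theorem one_mem_functions (T : Transition n M) : (1 : Family n M) ∈ functions T 0 :=
  ⟨fun _ _ ↦ one_mem_degree n,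
    fun _ ↦ ⟨1, fun _ _ ↦ 1, fun _ ↦ 1, fun _ ↦ contDiffOn_const, by simp⟩, by simp⟩

theorem mul_mem_functions (T : Transition n M) {k l : ℕ} {f g : Family n M}
    (hf : f ∈ functions T k) (hg : g ∈ functions T l) : f * g ∈ functions T (k + l) := by
  obtain ⟨hf, hf', hf''⟩ := hf
  obtain ⟨hg, hg', hg''⟩ := hg
  refine ⟨fun φ y ↦ mul_mem_degree (hf φ y) (hg φ y), fun φ ↦ ?_, fun φ ψ y z h ↦ ?_⟩
  · obtain ⟨m, c, v, hc, hv⟩ := hf' φ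
    obtain ⟨m', c', v', hc', hv'⟩ := hg' φ
    refine ⟨m * m', fun a x ↦ c (finProdFinEquiv.symm a).1 x * c' (finProdFinEquiv.symm a).2 x,
      fun a ↦ v (finProdFinEquiv.symm a).1 * v' (finProdFinEquiv.symm a).2,
      fun a ↦ (hc _).mul (hc' _), fun y ↦ ?_⟩
    rw [Pi.mul_apply, Pi.mul_apply, hv, hv', Finset.sum_mul_sum, ← Fintype.sum_prod_type',
      ← finProdFinEquiv.symm.sum_comp]
    simp [smul_mul_smul_comm]
  · simp [hf'' φ ψ y z h, hg'' φ ψ y z h]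

instance functions_gradedMonoid (T : Transition n M) : SetLike.GradedMonoid (functions T) where
  one_mem := one_mem_functions T
  mul_mem _ _ _ _ hf hg := mul_mem_functions T hf hg

/-- The algebra of functions `⨁ k, functions T k` of the graded manifold. -/
def functionRing (T : Transition n M) : Subalgebra ℝ (Family n M) :=
  (⨆ k, functions T k).toSubalgebra
    (Submodule.mem_iSup_of_mem 0 (one_mem_functions T))
    (by
      intro x y hx hy
      have h : (⨆ k, functions T k) * (⨆ k, functions T k) ≤ ⨆ k, functions T k := by
        rw [Submodule.iSup_mul]
        refine iSup_le fun k ↦ ?_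
        rw [Submodule.mul_iSup]
        refine iSup_le fun l ↦ Submodule.mul_le.2 fun f hf g hg ↦ ?_
        exact Submodule.mem_iSup_of_mem (k + l) (mul_mem_functions T hf hg)
      exact h (Submodule.mul_mem_mul hx hy))

/-- `Q` is a degree 1 vector field with `Q² = 0` on the graded manifold given by `T`, so that the
latter becomes an NQ manifold. -/
structure IsHomologicalVectorField (T : Transition n M) (Q : Family n M → Family n M) : Prop where
  map_mem : ∀ k, ∀ f ∈ functions T k, Q f ∈ functions T (k + 1)
  map_add : ∀ f ∈ functionRing T, ∀ g ∈ functionRing T, Q (f + g) = Q f + Q g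
  map_smul : ∀ (r : ℝ), ∀ f ∈ functionRing T, Q (r • f) = r • Q f
  leibniz : ∀ k, ∀ f ∈ functions T k, ∀ g ∈ functionRing T,
    Q (f * g) = Q f * g + (-1 : ℝ) ^ k • (f * Q g)
  sq_eq_zero : ∀ f ∈ functionRing T, Q (Q f) = 0

/-- `Φ` is an isomorphism of NQ manifolds over the identity of `M` (on algebras of functions). -/
structure IsNQIso {T T' : Transition n M} (Q Q' : Family n M → Family n M)
    (Φ : functionRing T ≃ₐ[ℝ] functionRing T') : Prop where
  degree : ∀ k (f : functionRing T),
    (f : Family n M) ∈ functions T k ↔ (Φ f : Family n M) ∈ functions T' k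
  base : ∀ f : functionRing T, (f : Family n M) ∈ functions T 0 → (Φ f : Family n M) = f
  intertwine : ∀ f g : functionRing T, (g : Family n M) = Q f → (Φ g : Family n M) = Q' (Φ f)

/-! ### The standard Courant algebroid `T*[2]T[1]M` -/

/-- The change of coordinates `ψ ∘ φ⁻¹`. -/
def coordChange (φ ψ : Chart n M) (y : E n) : E n := ψ.1 (φ.1.symm y)

/-- `jacobian φ ψ y a i` is `∂ q'ᵃ / ∂ qⁱ` at `y`, where `q` and `q'` are the coordinates of
`φ` and `ψ`. -/
def jacobian (φ ψ : Chart n M) (y : E n) : Matrix (Fin n) (Fin n) ℝ :=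
  Matrix.of fun a i ↦ fderiv ℝ (coordChange φ ψ) y (EuclideanSpace.single i (1 : ℝ)) a

/-- `hessian ψ φ z a b i` is `∂² qⁱ / ∂ q'ᵃ ∂ q'ᵇ` at `z`, where `q` and `q'` are the
coordinates of `φ` and `ψ`. -/
def hessian (ψ φ : Chart n M) (z : E n) (a b i : Fin n) : ℝ :=
  fderiv ℝ (fun w ↦ fderiv ℝ (coordChange ψ φ) w (EuclideanSpace.single b (1 : ℝ)) i) z
    (EuclideanSpace.single a (1 : ℝ))

/-- The changes of coordinates of `T*[2]T[1]M`. Here `ξⁱ = dqⁱ` are the fibre coordinates of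
`T[1]M`, while the cotangent fibre coordinates `p_i` and `θ_i` are the coordinate vector fields
`∂/∂qⁱ` and `∂/∂ξⁱ` on `T[1]M`. Hence, for a second system `(q', ξ', p', θ')`,
`ξ'ᵃ = (∂q'ᵃ/∂qⁱ) ξⁱ`, and the chain rule for `ξⁱ = (∂qⁱ/∂q'ᵇ) ξ'ᵇ` gives
`θ'_a = (∂qⁱ/∂q'ᵃ) θ_i` and `p'_a = (∂qⁱ/∂q'ᵃ) p_i + (∂²qⁱ/∂q'ᵃ∂q'ᵇ) ξ'ᵇ θ_i`. -/
def courantTransition : Transition n M := fun φ ψ y z ↦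
  glue (jacobian φ ψ y) (jacobian ψ φ z).transpose (hessian ψ φ z)

/-- The vector field `Q = ξⁱ ∂/∂qⁱ + p_i ∂/∂θ_i`, in each coordinate system. -/
def courantQ (f : Family n M) : Family n M := fun φ y ↦
  ∑ i, xi i * dq i (f φ) y + ∑ i, p i * dTheta i (f φ y)

/-! ### The semidirect product `TM ⋉ (T*M → T*M)` -/

/-- The fibre of the cotangent bundle. -/
abbrev Cotangent (n : ℕ) (M : Type*) [TopologicalSpace M] [ChartedSpace (E n) M] (x : M) : Type :=
  TangentSpace (𝓡 n) x →L[ℝ] Bundle.Trivial M ℝ x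

/-- A representation up to homotopy of `TM` on the complex `Id : T*M → T*M`: a smooth connection
`∇` on `T*M` (the same on both copies of `T*M`, by compatibility with `Id`) and a 2-form `ω` with
values in `End (T*M)` such that `[∇_X, ∇_Y] - ∇_[X, Y] = ω (X, Y)`. (This equation forces `ω` to be
alternating and smooth, and `d_∇ ω = 0` is then the Bianchi identity.) -/
structure CoadjointRep (n : ℕ) (M : Type*) [TopologicalSpace M] [ChartedSpace (E n) M]
    [IsManifold (𝓡 n) ∞ M] where
  nabla : CovariantDerivative (𝓡 n) (E n →L[ℝ] ℝ) (Cotangent n M)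
  smooth : nabla.ContMDiffCovariantDerivative ∞
  omega : ∀ x : M, TangentSpace (𝓡 n) x →ₗ[ℝ] TangentSpace (𝓡 n) x →ₗ[ℝ]
    Cotangent n M x →ₗ[ℝ] Cotangent n M x
  curvature : ∀ (X Y : ∀ x : M, TangentSpace (𝓡 n) x) (s : ∀ x : M, Cotangent n M x),
    ContMDiff (𝓡 n) ((𝓡 n).prod 𝓘(ℝ, E n)) ∞
      (fun x ↦ (⟨x, X x⟩ : Bundle.TotalSpace (E n) (TangentSpace (𝓡 n) : M → Type _))) →
    ContMDiff (𝓡 n) ((𝓡 n).prod 𝓘(ℝ, E n)) ∞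
      (fun x ↦ (⟨x, Y x⟩ : Bundle.TotalSpace (E n) (TangentSpace (𝓡 n) : M → Type _))) →
    ContMDiff (𝓡 n) ((𝓡 n).prod 𝓘(ℝ, E n →L[ℝ] ℝ)) ∞
      (fun x ↦ (⟨x, s x⟩ : Bundle.TotalSpace (E n →L[ℝ] ℝ) (Cotangent n M))) →
    ∀ x, nabla (fun x ↦ nabla s x (Y x)) x (X x) - nabla (fun x ↦ nabla s x (X x)) x (Y x)
        - nabla s x (VectorField.mlieBracket (𝓡 n) X Y x) = omega x (X x) (Y x) (s x)

variable [IsManifold (𝓡 n) ∞ M]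

/-- The coordinate 1-form `dqᵏ` of the chart `φ` (to be used on the domain of `φ` only). -/
def coordForm (φ : Chart n M) (k : Fin n) (x : M) : Cotangent n M x :=
  mvfderiv (𝓡 n) (fun m ↦ φ.1 m k) x

/-- The coordinate vector field `∂/∂qⁱ` of `φ` at the point with coordinates `y`. -/
def coordVec (φ : Chart n M) (y : E n) (i : Fin n) : TangentSpace (𝓡 n) (φ.1.symm y) :=
  mfderiv 𝓘(ℝ, E n) (𝓡 n) φ.1.symm y (EuclideanSpace.single i (1 : ℝ))

/-- `⟨∇_{∂_i} dqᵏ, ∂_j⟩` at the point with coordinates `y`. -/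
def connectionCoeff (R : CoadjointRep n M) (φ : Chart n M) (y : E n) (i k j : Fin n) : ℝ :=
  R.nabla (coordForm φ k) (φ.1.symm y) (coordVec φ y i) (coordVec φ y j)

/-- `⟨ω (∂_i, ∂_l) dqᵏ, ∂_j⟩` at the point with coordinates `y`. -/
def omegaCoeff (R : CoadjointRep n M) (φ : Chart n M) (y : E n) (i l k j : Fin n) : ℝ :=
  R.omega (φ.1.symm y) (coordVec φ y i) (coordVec φ y l) (coordForm φ k (φ.1.symm y))
    (coordVec φ y j)

/-- The changes of coordinates of the split graded manifold of the graded vector bundle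
`(TM ⊕ T*M) ⊕ T*M` with algebra of functions
`Γ(Λ (TM ⊕ T*M)* ⊗ S (T*M)*) = Γ(Λ (T*M ⊕ TM) ⊗ S (TM))`, in which `ξⁱ = dqⁱ` is the local frame
of `(TM)* = T*M` in degree 1, and `θ_i = ∂/∂qⁱ` and `p_i = ∂/∂qⁱ` are the local frames of
`(T*M)* = TM` in degree 1 and in degree 2, respectively. -/
def splitTransition : Transition n M := fun φ ψ y z ↦
  glue (jacobian φ ψ y) (jacobian ψ φ z).transpose 0

/-- The vector field of the semidirect product: the derivation `D̃` that extends the de Rham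
differential on `Ω(M)` and the dual representation up to homotopy. With `∇*` the dual connection
on `TM`, `∇*_{∂_i} ∂_j = - ∑ k, ⟨∇_{∂_i} dqᵏ, ∂_j⟩ ∂_k`, its values on the generators are
`qⁱ ↦ ξⁱ`, `ξⁱ ↦ 0`, `θ_j ↦ p_j + ∑ i, ξⁱ θ(∇*_{∂_i} ∂_j)` and
`p_j ↦ ∑ i, ξⁱ p(∇*_{∂_i} ∂_j) + 1/2 ∑ i l k, ⟨ω(∂_i, ∂_l) dqᵏ, ∂_j⟩ ξⁱ ξˡ θ_k`. -/
def semidirectQ (R : CoadjointRep n M) (f : Family n M) : Family n M := fun φ y ↦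
  ∑ i, xi i * dq i (f φ) y
    + ∑ j, (p j - ∑ i, ∑ k, connectionCoeff R φ y i k j • (xi i * theta k)) * dTheta j (f φ y)
    + ∑ j, (-(∑ i, ∑ k, connectionCoeff R φ y i k j • (xi i * p k))
        + (1 / 2 : ℝ) • ∑ i, ∑ l, ∑ k, omegaCoeff R φ y i l k j • (xi i * xi l * theta k))
      * dP j (f φ y)

end Manifold

end CourantNQ

end

noncomputable section

namespace CourantNQ

/-! ### The local algebra of functions -/

section LocalAlgebra

variable {n : ℕ}

/-! A connection on `T*M` straightens the degree 2 coordinates. Write `Γ i k j` for `⟨∇_{∂_i} dqᵏ,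
∂_j⟩`. The isomorphism fixes `q`, `ξ`, `θ` and sends `p_j` to `p_j - ∑ Γ i k j ξⁱ θ_k`. This is `D̃
θ_j`, so it is forced by `Q θ_j = p_j` once `θ` is fixed.

The local formulas glue because the Hessian term in the transformation law of `p` is cancelled by
the inhomogeneous term in the law of the `Γ` (`sum_jacobian_mul_christoffel`,
`shift_courantTransition`). They intertwine `Q` and `D̃` because, on the only delicate generator
`p_j`, the identity `Q p_j = 0` asks `D̃` to kill `p_j - ∑ Γ ξ θ`. There the `ξ p` terms cancel, and
the `ξ ξ θ` terms match since `ω` is the antisymmetrization of `∂Γ + ΓΓ` (`semidirectField_shift`,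
`omegaCoeff_eq`).

`Q` squares to zero because second derivatives are symmetric. It is independent of coordinates
because the law of `p` is `Q` applied to the law of `θ` (`courantField_glue`). `D̃` is then
homological by conjugation with the isomorphism, and no Bianchi identity has to be expanded.
Representations exist because partitions of unity give connections and `ω` may be read off from the
curvature.

Two devices keep the algebra short. Odd derivations are compared on generators only
(`IsSmooth.induction`, `IsOddDerivation.intertwine`). Degrees and signs are encoded in the
automorphisms `scale t`: degree `k` is the eigenspace of `scale 2` for `2 ^ k` (`mem_degree_iff`),
and `scale (-1)` is the parity involution. -/

@[simp] theorem F.smul_mul (r : ℝ) (u v : F n) : (r • u) * v = r • (u * v) :=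
  smul_mul_assoc r u v

@[simp] theorem F.mul_smul (r : ℝ) (u v : F n) : u * (r • v) = r • (u * v) :=
  mul_smul_comm r u v

@[simp] theorem F.neg_mul (u v : F n) : -u * v = -(u * v) := _root_.neg_mul u v

@[simp] theorem F.mul_neg (u v : F n) : u * -v = -(u * v) := _root_.mul_neg u v

theorem F.neg_one_smul (u : F n) : (-1 : ℝ) • u = -u := by module

theorem xiOf_eq_sum (v : Fin n → ℝ) : xiOf v = ∑ i, v i • xi i := by
  let L : (Fin n → ℝ) →ₗ[ℝ] F n :=
    ((TensorProduct.mk ℝ _ (MvPolynomial (Fin n) ℝ)).flip 1).comp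
      ((ExteriorAlgebra.ι ℝ).comp (LinearMap.inl ℝ (Fin n → ℝ) (Fin n → ℝ)))
  have h : ∀ v, xiOf v = L v := fun _ ↦ rfl
  simp only [xi, h]
  conv_lhs => rw [pi_eq_sum_univ' v]
  simp only [map_sum, map_smul]

theorem thetaOf_eq_sum (v : Fin n → ℝ) : thetaOf v = ∑ i, v i • theta i := by
  let L : (Fin n → ℝ) →ₗ[ℝ] F n :=
    ((TensorProduct.mk ℝ _ (MvPolynomial (Fin n) ℝ)).flip 1).comp
      ((ExteriorAlgebra.ι ℝ).comp (LinearMap.inr ℝ (Fin n → ℝ) (Fin n → ℝ)))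
  have h : ∀ v, thetaOf v = L v := fun _ ↦ rfl
  simp only [theta, h]
  conv_lhs => rw [pi_eq_sum_univ' v]
  simp only [map_sum, map_smul]

theorem ι_tmul_one (v : (Fin n → ℝ) × (Fin n → ℝ)) :
    (ExteriorAlgebra.ι ℝ v ⊗ₜ 1 : F n) = ∑ i, v.1 i • xi i + ∑ i, v.2 i • theta i := by
  rw [← xiOf_eq_sum, ← thetaOf_eq_sum, xiOf, thetaOf, ← TensorProduct.add_tmul, ← map_add]
  simp

/-- Induction on the generators `ξ i`, `θ i`, `p i` of the local algebra. -/
@[elab_as_elim]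
theorem F.induction {C : F n → Prop} (one : C 1) (xi : ∀ i, C (xi i))
    (theta : ∀ i, C (theta i)) (p : ∀ i, C (p i)) (smul : ∀ (r : ℝ) u, C u → C (r • u))
    (mul : ∀ u v, C u → C v → C (u * v)) (add : ∀ u v, C u → C v → C (u + v)) (w : F n) : C w := by
  have zero : C 0 := by simpa using smul 0 1 one
  have sum : ∀ (f : Fin n → F n), (∀ i, C (f i)) → C (∑ i, f i) := fun f hf ↦
    Finset.sum_induction f C (fun a b ↦ add a b) zero fun i _ ↦ hf i
  have alg : ∀ r : ℝ, C (algebraMap ℝ (F n) r) := fun r ↦ by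
    rw [Algebra.algebraMap_eq_smul_one]
    exact smul r 1 one
  -- A pure tensor is `(a ⊗ 1) * (1 ⊗ b)`, so each tensor factor can be treated by its own
  -- induction.
  have left : ∀ a : ExteriorAlgebra ℝ ((Fin n → ℝ) × (Fin n → ℝ)), C (a ⊗ₜ 1) := by
    intro a
    induction a using ExteriorAlgebra.induction with
    | algebraMap r => exact alg r
    | ι v =>
      rw [ι_tmul_one]
      exact add _ _ (sum _ fun i ↦ smul _ _ (xi i)) (sum _ fun i ↦ smul _ _ (theta i))
    | mul a b ha hb => simpa using mul _ _ ha hb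
    | add a b ha hb => simpa [TensorProduct.add_tmul] using add _ _ ha hb
  have right : ∀ b : MvPolynomial (Fin n) ℝ, C (1 ⊗ₜ b) := by
    intro b
    induction b using MvPolynomial.induction_on with
    | C r =>
      have := alg r
      rwa [← Algebra.TensorProduct.includeRight.commutes r] at this
    | add a b ha hb => simpa [TensorProduct.tmul_add] using add _ _ ha hb
    | mul_X a i ha => simpa [CourantNQ.p] using mul _ _ ha (p i)
  induction w using TensorProduct.induction_on with
  | zero => exact zero
  | tmul a b => simpa using mul _ _ (left a) (right b)
  | add a b ha hb => exact add _ _ ha hb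

theorem algHom_eq_of_generators {B : Type*} [Semiring B] [Algebra ℝ B] {f g : F n →ₐ[ℝ] B}
    (hx : ∀ i, f (xi i) = g (xi i)) (ht : ∀ i, f (theta i) = g (theta i))
    (hp : ∀ i, f (p i) = g (p i)) : f = g := by
  refine AlgHom.ext fun w ↦ ?_
  induction w using F.induction with
  | one => simp
  | xi i => exact hx i
  | theta i => exact ht i
  | p i => exact hp i
  | smul r u hu => simp [hu]
  | mul u v hu hv => simp [hu, hv]
  | add u v hu hv => simp [hu, hv]

/-! ### The grading through scaling automorphisms -/

/-- The automorphism that multiplies elements of degree `k` by `t ^ k`. -/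
def scale (t : ℝ) : F n →ₐ[ℝ] F n :=
  Algebra.TensorProduct.map (ExteriorAlgebra.map (t • LinearMap.id))
    (MvPolynomial.aeval fun i ↦ t ^ 2 • MvPolynomial.X i)

@[simp] theorem scale_xi (t : ℝ) (i : Fin n) : scale t (xi i) = t • xi i := by
  simp [scale, xi, xiOf, TensorProduct.smul_tmul', -Prod.smul_mk]

@[simp] theorem scale_theta (t : ℝ) (i : Fin n) : scale t (theta i) = t • theta i := by
  simp [scale, theta, thetaOf, TensorProduct.smul_tmul', -Prod.smul_mk]

@[simp] theorem scale_p (t : ℝ) (i : Fin n) : scale t (p i) = t ^ 2 • p i := by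
  simp [scale, p]

theorem xi_mem_degree (i : Fin n) : xi i ∈ degree n 1 :=
  Submodule.subset_span ⟨1, 0, rfl, _, by simp, 1,
    (MvPolynomial.mem_homogeneousSubmodule _ _).2 (MvPolynomial.isHomogeneous_one _ _), rfl⟩

theorem theta_mem_degree (i : Fin n) : theta i ∈ degree n 1 :=
  Submodule.subset_span ⟨1, 0, rfl, _, by simp, 1,
    (MvPolynomial.mem_homogeneousSubmodule _ _).2 (MvPolynomial.isHomogeneous_one _ _), rfl⟩

theorem p_mem_degree (i : Fin n) : p i ∈ degree n 2 :=
  Submodule.subset_span ⟨0, 1, rfl, 1, by simp, _,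
    (MvPolynomial.mem_homogeneousSubmodule _ _).2 (MvPolynomial.isHomogeneous_X _ _), rfl⟩

/-- The sum of the graded pieces contains the generators and is closed under products. -/
theorem iSup_degree : ⨆ k, degree n k = ⊤ := by
  refine eq_top_iff.2 fun w _ ↦ ?_
  induction w using F.induction with
  | one => exact Submodule.mem_iSup_of_mem 0 (one_mem_degree n)
  | xi i => exact Submodule.mem_iSup_of_mem 1 (xi_mem_degree i)
  | theta i => exact Submodule.mem_iSup_of_mem 1 (theta_mem_degree i)
  | p i => exact Submodule.mem_iSup_of_mem 2 (p_mem_degree i)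
  | smul r u hu => exact Submodule.smul_mem _ _ (hu trivial)
  | add u v hu hv => exact add_mem (hu trivial) (hv trivial)
  | mul u v hu hv =>
    have h : (⨆ k, degree n k) * (⨆ k, degree n k) ≤ ⨆ k, degree n k := by
      rw [Submodule.iSup_mul]
      refine iSup_le fun k ↦ ?_
      rw [Submodule.mul_iSup]
      exact iSup_le fun l ↦ Submodule.mul_le.2 fun f hf g hg ↦
        Submodule.mem_iSup_of_mem (k + l) (mul_mem_degree hf hg)
    exact h (Submodule.mul_mem_mul (hu trivial) (hv trivial))

theorem scale_of_mem_degree (t : ℝ) {k : ℕ} {w : F n} (hw : w ∈ degree n k) :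
    scale t w = t ^ k • w := by
  induction hw using Submodule.span_induction with
  | zero => simp
  | add u v _ _ hu hv => simp [hu, hv]
  | smul r u _ hu => simp [hu, smul_comm r]
  | mem w hw =>
    obtain ⟨a, b, rfl, u, hu, v, hv, rfl⟩ := hw
    have h1 : ∀ (a : ℕ) (u : ExteriorAlgebra ℝ ((Fin n → ℝ) × (Fin n → ℝ))), u ∈ ⋀[ℝ]^a _ →
        ExteriorAlgebra.map (t • LinearMap.id) u = t ^ a • u := by
      intro a u hu
      induction hu using Submodule.pow_induction_on_left' with
      | algebraMap r => simp
      | add x y i _ _ hx hy => rw [map_add, hx, hy, smul_add]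
      | mem_mul x hx i y _ hy =>
        obtain ⟨x, rfl⟩ := hx
        simp [hy, pow_succ, smul_smul]
    have h2 : MvPolynomial.aeval (fun i ↦ t ^ 2 • (MvPolynomial.X i : MvPolynomial (Fin n) ℝ)) v
        = t ^ (2 * b) • v := by
      rw [MvPolynomial.mem_homogeneousSubmodule] at hv
      conv_rhs => rw [v.as_sum]
      rw [MvPolynomial.aeval_def, MvPolynomial.eval₂_eq', Finset.smul_sum]
      refine Finset.sum_congr rfl fun d hd ↦ ?_
      have hb := hv (MvPolynomial.mem_support_iff.1 hd)
      -- Every monomial of `v` has total exponent `b`, so each contributes the same factor `t ^ (2 *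
      -- b)`.
      have hb' : ∑ i, d i = b := by
        rw [← hb, Finsupp.weight_apply, Finsupp.sum_fintype _ _ (by simp)]
        simp
      rw [MvPolynomial.monomial_eq, Finsupp.prod_fintype _ _ (by simp)]
      simp only [Algebra.smul_def, mul_pow, Finset.prod_mul_distrib, ← map_pow, ← map_prod]
      rw [← hb', Finset.prod_pow_eq_pow_sum, ← pow_mul]
      simp only [MvPolynomial.algebraMap_eq]
      ring
    rw [scale, Algebra.TensorProduct.map_tmul, h1 a u hu, h2, TensorProduct.tmul_smul,
      ← TensorProduct.smul_tmul', smul_smul, pow_add, mul_comm]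

/-- The graded pieces span, and `scale 2` acts on them by the pairwise distinct numbers `2 ^ j`, so
an eigenvector has a single component. This turns degree statements into commutation with `scale 2`.
-/
theorem mem_degree_iff {k : ℕ} {w : F n} : w ∈ degree n k ↔ scale 2 w = (2 : ℝ) ^ k • w := by
  refine ⟨scale_of_mem_degree 2, fun h ↦ ?_⟩
  have hw : w ∈ ⨆ k, degree n k := by simp [iSup_degree]
  obtain ⟨f, hf, rfl⟩ := (Submodule.mem_iSup_iff_exists_finsupp _ _).1 hw
  have hle : ∀ j, degree n j ≤ Module.End.eigenspace (scale (n := n) 2).toLinearMap ((2 : ℝ) ^ j) :=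
    fun j w hw ↦ Module.End.mem_eigenspace_iff.2 (scale_of_mem_degree 2 hw)
  have hind : iSupIndep (degree n) :=
    ((Module.End.eigenspaces_iSupIndep (scale (n := n) 2).toLinearMap).comp
      (f := fun j : ℕ ↦ (2 : ℝ) ^ j)
      (pow_right_injective₀ (by norm_num) (by norm_num))).mono hle
  rw [iSupIndep_iff_finsetSum_eq_zero_imp_eq_zero] at hind
  -- Subtracting `2 ^ k • w` from `scale 2 w` gives a vanishing sum of homogeneous terms.
  -- Independence kills each one, and the factor is nonzero for `j ≠ k`.
  have key := hind f.support (fun j ↦ ((2 : ℝ) ^ j - 2 ^ k) • f j)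
    (fun j _ ↦ Submodule.smul_mem _ _ (hf j)) (by
      rw [Finset.sum_congr rfl fun j _ ↦ sub_smul _ _ (f j), Finset.sum_sub_distrib]
      rw [← Finset.smul_sum, sub_eq_zero]
      refine Eq.trans ?_ h
      rw [Finsupp.sum, map_sum]
      exact Finset.sum_congr rfl fun j _ ↦ (scale_of_mem_degree 2 (hf j)).symm)
  refine sum_mem fun j hj ↦ ?_
  by_cases hjk : j = k
  · exact hjk ▸ hf j
  · have h2 : (2 : ℝ) ^ j - 2 ^ k ≠ 0 := fun h ↦ hjk
      (pow_right_injective₀ (a := (2 : ℝ)) (by norm_num) (by norm_num) (sub_eq_zero.1 h))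
    have h3 : f j = 0 := (smul_eq_zero.1 (key j hj)).resolve_left h2
    simp [h3]

-- `scale (-1)` is the parity involution `w ↦ (-1)^|w| w`; it expresses Koszul signs for elements of
-- mixed degree.
@[simp] theorem scale_neg_one_scale_neg_one (w : F n) : scale (-1) (scale (-1) w) = w := by
  have h : (scale (-1)).comp (scale (-1)) = AlgHom.id ℝ (F n) :=
    algHom_eq_of_generators (by simp [F.neg_one_smul]) (by simp [F.neg_one_smul]) (by simp)
  exact congrArg (fun f : F n →ₐ[ℝ] F n ↦ f w) h

/-! ### Sign rules and derivations -/

theorem ι_mul_ι_swap (u v : (Fin n → ℝ) × (Fin n → ℝ)) :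
    (ExteriorAlgebra.ι ℝ u * ExteriorAlgebra.ι ℝ v) =
      -(ExteriorAlgebra.ι ℝ v * ExteriorAlgebra.ι ℝ u) :=
  eq_neg_of_add_eq_zero_left (ExteriorAlgebra.ι_add_mul_swap u v)

theorem xi_mul_xi (i j : Fin n) : xi i * xi j = -(xi j * xi i) := by
  simp only [xi, xiOf, Algebra.TensorProduct.tmul_mul_tmul, ← TensorProduct.neg_tmul]
  rw [ι_mul_ι_swap]

theorem xi_mul_theta (i j : Fin n) : xi i * theta j = -(theta j * xi i) := by
  simp only [xi, xiOf, theta, thetaOf, Algebra.TensorProduct.tmul_mul_tmul,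
    ← TensorProduct.neg_tmul]
  rw [ι_mul_ι_swap]

theorem p_mul_comm (i : Fin n) (w : F n) : p i * w = w * p i :=
  (Subalgebra.mem_center_iff.1 (p_mem_center i) w).symm

/-- The Koszul sign is multiplicative in `w`, so it suffices to know it on generators. -/
theorem xi_mul (i : Fin n) (w : F n) : xi i * w = scale (-1) w * xi i := by
  induction w using F.induction with
  | one => simp
  | xi j => simp [xi_mul_xi i j, F.neg_one_smul]
  | theta j => simp [xi_mul_theta i j, F.neg_one_smul]
  | p j => simp [p_mul_comm]
  | smul r u hu => simp [hu]
  | mul u v hu hv => rw [← mul_assoc, hu, mul_assoc, hv, map_mul, mul_assoc]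
  | add u v hu hv => simp [mul_add, add_mul, hu, hv]

/-- The exterior algebra is the Clifford algebra of the zero form, and this is the recursion for
contraction there. -/
theorem dTheta_mul_aux (i : Fin n) (v : (Fin n → ℝ) × (Fin n → ℝ)) (w : F n) :
    dTheta i ((ExteriorAlgebra.ι ℝ v ⊗ₜ 1) * w)
      = v.2 i • w - (ExteriorAlgebra.ι ℝ v ⊗ₜ 1) * dTheta i w := by
  induction w using TensorProduct.induction_on with
  | zero => simp
  | tmul a b =>
    have h := CliffordAlgebra.contractLeft_ι_mul
      (Q := (0 : QuadraticForm ℝ ((Fin n → ℝ) × (Fin n → ℝ))))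
      (d := LinearMap.proj i ∘ₗ LinearMap.snd ℝ (Fin n → ℝ) (Fin n → ℝ)) v a
    rw [Algebra.TensorProduct.tmul_mul_tmul, one_mul, dTheta, LinearMap.rTensor_tmul]
    refine (congrArg (· ⊗ₜ[ℝ] b) h).trans ?_
    rw [TensorProduct.sub_tmul, LinearMap.rTensor_tmul, Algebra.TensorProduct.tmul_mul_tmul,
      one_mul]
    rfl
  | add a b ha hb => rw [mul_add, map_add, ha, hb, map_add, smul_add, mul_add]; abel

@[simp] theorem dTheta_one (i : Fin n) : dTheta i (1 : F n) = 0 := by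
  rw [dTheta, Algebra.TensorProduct.one_def, LinearMap.rTensor_tmul,
    CliffordAlgebra.contractLeft_one, TensorProduct.zero_tmul]

theorem dTheta_xi_mul (i j : Fin n) (w : F n) : dTheta i (xi j * w) = -(xi j * dTheta i w) := by
  simpa [xi, xiOf] using dTheta_mul_aux i (Pi.single j 1, 0) w

theorem dTheta_theta_mul (i j : Fin n) (w : F n) :
    dTheta i (theta j * w) = (if i = j then w else 0) - theta j * dTheta i w := by
  simpa [theta, thetaOf, Pi.single_apply, ite_smul] using dTheta_mul_aux i (0, Pi.single j 1) w

theorem dTheta_p_mul (i j : Fin n) (w : F n) : dTheta i (p j * w) = p j * dTheta i w := by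
  induction w using TensorProduct.induction_on with
  | zero => simp
  | tmul a b => simp [dTheta, p]
  | add a b ha hb => rw [mul_add, map_add, ha, hb, map_add, mul_add]

@[simp] theorem dTheta_xi (i j : Fin n) : dTheta i (xi j) = 0 := by
  simpa using dTheta_xi_mul i j 1

@[simp] theorem dTheta_theta (i j : Fin n) : dTheta i (theta j) = if i = j then 1 else 0 := by
  simpa using dTheta_theta_mul i j 1

@[simp] theorem dTheta_p (i j : Fin n) : dTheta i (p j) = 0 := by
  simpa using dTheta_p_mul i j 1

/-- The rules for one generator on the left propagate by reassociating the product, which is why `w`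
has to vary in the induction. -/
theorem dTheta_mul (i : Fin n) (u w : F n) :
    dTheta i (u * w) = dTheta i u * w + scale (-1) u * dTheta i w := by
  induction u using F.induction generalizing w with
  | one => simp
  | xi j => simp [dTheta_xi_mul, F.neg_one_smul]
  | theta j => simp [dTheta_theta_mul, sub_eq_add_neg, F.neg_one_smul]
  | p j => simp [dTheta_p_mul]
  | smul r u hu => simp [hu, smul_add]
  | mul u v hu hv => rw [mul_assoc, hu, hv, hu, map_mul]; noncomm_ring
  | add u v hu hv => simp only [add_mul, map_add, hu, hv]; abel

theorem dP_mul (i : Fin n) (u w : F n) : dP i (u * w) = dP i u * w + u * dP i w := by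
  induction u using TensorProduct.induction_on with
  | zero => simp
  | add u v hu hv => simp only [add_mul, map_add, hu, hv]; abel
  | tmul a b =>
    induction w using TensorProduct.induction_on with
    | zero => simp
    | add u v hu hv => simp only [mul_add, map_add, hu, hv]; abel
    | tmul c d =>
      simp [dP, Derivation.leibniz, TensorProduct.tmul_add, mul_comm, add_comm]

@[simp] theorem dP_one (i : Fin n) : dP i (1 : F n) = 0 := by
  simpa using dP_mul i (1 : F n) 1

@[simp] theorem dP_xi (i j : Fin n) : dP i (xi j) = 0 := by simp [dP, xi, xiOf]

@[simp] theorem dP_theta (i j : Fin n) : dP i (theta j) = 0 := by simp [dP, theta, thetaOf]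

@[simp] theorem dP_p (i j : Fin n) : dP i (p j) = if i = j then 1 else 0 := by
  by_cases h : i = j
  · simp [dP, p, h, Algebra.TensorProduct.one_def]
  · simp [dP, p, h, Ne.symm h]

/-- This is the statement that `∂/∂θ` lowers the degree by one. -/
theorem dTheta_scale (t : ℝ) (i : Fin n) (w : F n) :
    dTheta i (scale t w) = t • scale t (dTheta i w) := by
  have hs : ∀ u : F n, scale t (scale (-1) u) = scale (-1) (scale t u) := fun u ↦ by
    have h : (scale t).comp (scale (-1)) = (scale (-1)).comp (scale (n := n) t) :=
      algHom_eq_of_generators (by simp [F.neg_one_smul]) (by simp [F.neg_one_smul]) (by simp)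
    exact congrArg (fun f : F n →ₐ[ℝ] F n ↦ f u) h
  induction w using F.induction with
  | one => simp
  | xi j => simp
  | theta j => by_cases h : i = j <;> simp [h]
  | p j => simp
  | smul r u hu => simp [hu, smul_comm r]
  | mul u v hu hv => simp [dTheta_mul, hu, hv, hs, smul_add]
  | add u v hu hv => simp [hu, hv]

/-- This is the statement that `∂/∂p` lowers the degree by two. -/
theorem dP_scale (t : ℝ) (i : Fin n) (w : F n) :
    dP i (scale t w) = t ^ 2 • scale t (dP i w) := by
  induction w using F.induction with
  | one => simp
  | xi j => simp
  | theta j => simp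
  | p j => by_cases h : i = j <;> simp [h]
  | smul r u hu => simp [hu, smul_comm r]
  | mul u v hu hv => simp [dP_mul, hu, hv, smul_add]
  | add u v hu hv => simp [hu, hv]

/-! ### Substitutions -/

/-- Each generator is replaced by an element of its own degree; in particular `ξ θ` has degree 2,
like `p`. A general `t` yields preservation of degree, and `t = -1` preservation of parity. -/
theorem glue_scale (J K : Matrix (Fin n) (Fin n) ℝ) (H : Fin n → Fin n → Fin n → ℝ) (t : ℝ)
    (w : F n) : glue J K H (scale t w) = scale t (glue J K H w) := by
  have h : (glue J K H).comp (scale t) = (scale t).comp (glue J K H) := by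
    refine algHom_eq_of_generators (fun i ↦ ?_) (fun i ↦ ?_) (fun i ↦ ?_)
    · simp [glue_xi, xiOf_eq_sum, Finset.smul_sum, smul_comm t]
    · simp [glue_theta, thetaOf_eq_sum, Finset.smul_sum, smul_comm t]
    · simp only [AlgHom.comp_apply, scale_p, map_smul, glue_p, glueP, map_add, map_sum, map_mul,
        scale_theta, smul_add, Finset.smul_sum, xiOf_eq_sum, scale_xi, Finset.sum_mul,
        smul_mul_assoc, mul_smul_comm]
      congr 1
      · exact Finset.sum_congr rfl fun _ _ ↦ smul_comm _ _ _
      · refine Finset.sum_congr rfl fun _ _ ↦ Finset.sum_congr rfl fun _ _ ↦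
          Finset.sum_congr rfl fun _ _ ↦ ?_
        simp only [smul_smul]
        congr 1
        ring
  exact congrArg (fun f : F n →ₐ[ℝ] F n ↦ f w) h

theorem glue_mem_degree {J K : Matrix (Fin n) (Fin n) ℝ} {H : Fin n → Fin n → Fin n → ℝ} {k : ℕ}
    {w : F n} (hw : w ∈ degree n k) : glue J K H w ∈ degree n k := by
  rw [mem_degree_iff] at hw ⊢
  rw [← glue_scale, hw, map_smul]

/-- Only scalars are left in degree 0 and every substitution fixes them, so the isomorphism will
cover the identity of `M`. -/
theorem mem_degree_zero_iff {w : F n} : w ∈ degree n 0 ↔ ∃ r : ℝ, w = r • 1 := by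
  refine ⟨fun h ↦ ?_, ?_⟩
  · induction h using Submodule.span_induction with
    | zero => exact ⟨0, by simp⟩
    | add u v _ _ hu hv =>
      obtain ⟨r, rfl⟩ := hu
      obtain ⟨s, rfl⟩ := hv
      exact ⟨r + s, by rw [add_smul]⟩
    | smul t u _ hu =>
      obtain ⟨r, rfl⟩ := hu
      exact ⟨t * r, by rw [mul_smul]⟩
    | mem w hw =>
      obtain ⟨a, b, hab, u, hu, v, hv, rfl⟩ := hw
      obtain ⟨rfl, rfl⟩ : a = 0 ∧ b = 0 := by omega
      rw [ExteriorAlgebra.exteriorPower, pow_zero, Submodule.mem_one] at hu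
      obtain ⟨r, rfl⟩ := hu
      rw [MvPolynomial.homogeneousSubmodule_zero, Submodule.mem_one] at hv
      obtain ⟨s, rfl⟩ := hv
      refine ⟨r * s, ?_⟩
      rw [Algebra.algebraMap_eq_smul_one, Algebra.algebraMap_eq_smul_one, TensorProduct.tmul_smul,
        ← TensorProduct.smul_tmul', smul_smul, mul_comm, Algebra.TensorProduct.one_def]
  · rintro ⟨r, rfl⟩
    exact Submodule.smul_mem _ _ (one_mem_degree n)

end LocalAlgebra

/-! ### Partial derivatives of local functions -/

section LocalCalculus

variable {n : ℕ} {U : Set (E n)}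

/-- Partial derivatives are tested against all linear functionals, and these separate points. -/
theorem HasPartial.unique {i : Fin n} {g : E n → F n} {w w' : F n} {y : E n}
    (h : HasPartial i g w y) (h' : HasPartial i g w' y) : w = w' := by
  rw [← sub_eq_zero, ← Module.forall_dual_apply_eq_zero_iff ℝ]
  intro l
  rw [map_sub, sub_eq_zero]
  exact (h l).unique (h' l)

theorem HasPartial.dq_eq {i : Fin n} {g : U → F n} {w : F n} {y : U}
    (h : HasPartial i (Function.extend Subtype.val g 0) w y) : dq i g y = w := by
  have h' : ∃ w, HasPartial i (Function.extend Subtype.val g 0) w y := ⟨w, h⟩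
  rw [dq, dif_pos h']
  exact h'.choose_spec.unique h

/-- The extension by zero outside `U` is invisible near a point of the open set `U`. -/
theorem eventually_extend_eq (hU : IsOpen U) (g : U → F n) (y : U) {P : E n → F n → Prop}
    (h : ∀ z : U, P z (g z)) :
    ∀ᶠ z in nhds (y : E n), P z (Function.extend Subtype.val g 0 z) := by
  filter_upwards [hU.mem_nhds y.2] with z hz
  have := Subtype.val_injective.extend_apply g 0 (⟨z, hz⟩ : U)
  rw [this]
  exact h ⟨z, hz⟩

theorem hasPartial_of_eq_sum (hU : IsOpen U) {ι : Type*} [Fintype ι] {g : U → F n}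
    {c : ι → E n → ℝ} {v : ι → F n} (hc : ∀ a, ContDiffOn ℝ ∞ (c a) U)
    (hg : ∀ y : U, g y = ∑ a, c a y • v a) (i : Fin n) (y : U) :
    HasPartial i (Function.extend Subtype.val g 0)
      (∑ a, fderiv ℝ (c a) y (EuclideanSpace.single i 1) • v a) y := by
  intro l
  have hd : ∀ a, HasFDerivAt (c a) (fderiv ℝ (c a) y) (y : E n) := fun a ↦
    (((hc a).contDiffAt (hU.mem_nhds y.2)).differentiableAt (by simp)).hasFDerivAt
  have h : HasFDerivAt (fun z ↦ ∑ a, c a z * l (v a)) (∑ a, l (v a) • fderiv ℝ (c a) y) (y : E n) :=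
    HasFDerivAt.fun_sum fun a _ ↦ (hd a).mul_const (l (v a))
  have h2 := h.hasLineDerivAt (EuclideanSpace.single i (1 : ℝ))
  have h3 : l (∑ a, fderiv ℝ (c a) y (EuclideanSpace.single i 1) • v a) =
      (∑ a, l (v a) • fderiv ℝ (c a) y) (EuclideanSpace.single i (1 : ℝ)) := by
    simp [mul_comm]
  rw [h3]
  refine h2.congr_of_eventuallyEq ?_
  exact eventually_extend_eq hU g y (P := fun z w ↦ l w = ∑ a, c a z * l (v a))
    fun z ↦ by simp [hg]

/-- By uniqueness, any representation as a finite sum may be differentiated coefficientwise. The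
rules of calculus below follow by choosing a convenient representation. -/
theorem dq_of_eq_sum (hU : IsOpen U) {ι : Type*} [Fintype ι] {g : U → F n}
    {c : ι → E n → ℝ} {v : ι → F n} (hc : ∀ a, ContDiffOn ℝ ∞ (c a) U)
    (hg : ∀ y : U, g y = ∑ a, c a y • v a) (i : Fin n) (y : U) :
    dq i g y = ∑ a, fderiv ℝ (c a) y (EuclideanSpace.single i 1) • v a :=
  (hasPartial_of_eq_sum hU hc hg i y).dq_eq

theorem dq_restrict {W : Set (E n)} (hU : IsOpen U) (hW : IsOpen W) (hWU : W ⊆ U) {g : U → F n}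
    (hg : IsSmooth g) {h : W → F n} (hh : ∀ y : W, h y = g ⟨y, hWU y.2⟩) (i : Fin n) (y : W) :
    dq i h y = dq i g ⟨y, hWU y.2⟩ := by
  obtain ⟨m, c, v, hc, hv⟩ := hg
  rw [dq_of_eq_sum hU hc hv,
    dq_of_eq_sum hW (fun a ↦ (hc a).mono hWU) fun y ↦ (hh y).trans (hv _)]

theorem IsSmooth.of_eq_sum {ι : Type*} [Fintype ι] {g : U → F n} {c : ι → E n → ℝ} {v : ι → F n}
    (hc : ∀ a, ContDiffOn ℝ ∞ (c a) U) (hg : ∀ y : U, g y = ∑ a, c a y • v a) : IsSmooth g :=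
  ⟨_, fun a ↦ c ((Fintype.equivFin ι).symm a), fun a ↦ v ((Fintype.equivFin ι).symm a),
    fun _ ↦ hc _, fun y ↦ by
      rw [hg, ← (Fintype.equivFin ι).symm.sum_comp]⟩

theorem isSmooth_coef {c : E n → ℝ} (hc : ContDiffOn ℝ ∞ c U) (w : F n) :
    IsSmooth fun y : U ↦ c y • w :=
  .of_eq_sum (ι := Unit) (c := fun _ ↦ c) (v := fun _ ↦ w) (fun _ ↦ hc) (by simp)

theorem isSmooth_const (w : F n) : IsSmooth fun _ : U ↦ w := by
  simpa using isSmooth_coef (U := U) (c := fun _ ↦ (1 : ℝ)) contDiffOn_const w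

theorem IsSmooth.add {f g : U → F n} (hf : IsSmooth f) (hg : IsSmooth g) : IsSmooth (f + g) := by
  obtain ⟨m, c, v, hc, hv⟩ := hf
  obtain ⟨m', c', v', hc', hv'⟩ := hg
  refine .of_eq_sum (ι := Fin m ⊕ Fin m') (c := Sum.elim c c') (v := Sum.elim v v') ?_ fun y ↦ ?_
  · rintro (a | a)
    exacts [hc a, hc' a]
  · simp [hv, hv']

theorem IsSmooth.mul {f g : U → F n} (hf : IsSmooth f) (hg : IsSmooth g) : IsSmooth (f * g) := by
  obtain ⟨m, c, v, hc, hv⟩ := hf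
  obtain ⟨m', c', v', hc', hv'⟩ := hg
  refine .of_eq_sum (ι := Fin m × Fin m') (c := fun a z ↦ c a.1 z * c' a.2 z)
    (v := fun a ↦ v a.1 * v' a.2) (fun a ↦ (hc a.1).mul (hc' a.2)) fun y ↦ ?_
  rw [Pi.mul_apply, hv, hv', Finset.sum_mul_sum, Fintype.sum_prod_type]
  simp [smul_smul, mul_comm]

theorem IsSmooth.sum {ι : Type*} (s : Finset ι) {f : ι → U → F n} (hf : ∀ a ∈ s, IsSmooth (f a)) :
    IsSmooth fun y ↦ ∑ a ∈ s, f a y := by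
  have h := Finset.sum_induction f IsSmooth (fun _ _ ↦ IsSmooth.add) (isSmooth_const 0) hf
  convert h using 2 with y
  simp

theorem IsSmooth.map {f : U → F n} (hf : IsSmooth f) (L : F n →ₗ[ℝ] F n) :
    IsSmooth fun y ↦ L (f y) := by
  obtain ⟨m, c, v, hc, hv⟩ := hf
  exact ⟨m, c, fun a ↦ L (v a), hc, fun y ↦ by simp [hv]⟩

theorem IsSmooth.smul {f : U → F n} (hf : IsSmooth f) {c : E n → ℝ} (hc : ContDiffOn ℝ ∞ c U) :
    IsSmooth fun y ↦ c y • f y := by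
  have h := (isSmooth_coef hc 1).mul hf
  convert h using 2 with y
  simp

theorem contDiffOn_fderiv_apply {G : Type*} [NormedAddCommGroup G] [NormedSpace ℝ G] (hU : IsOpen U)
    {c : E n → G} (hc : ContDiffOn ℝ ∞ c U) (v : E n) :
    ContDiffOn ℝ ∞ (fun z ↦ fderiv ℝ c z v) U :=
  (hc.fderiv_of_isOpen (m := ∞) hU (by simp)).clm_apply contDiffOn_const

theorem fderiv_fderiv_comm {G : Type*} [NormedAddCommGroup G] [NormedSpace ℝ G] (hU : IsOpen U)
    {c : E n → G} (hc : ContDiffOn ℝ ∞ c U) {y : E n} (hy : y ∈ U) (u v : E n) :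
    fderiv ℝ (fun z ↦ fderiv ℝ c z u) y v = fderiv ℝ (fun z ↦ fderiv ℝ c z v) y u := by
  have hd : DifferentiableAt ℝ (fderiv ℝ c) y :=
    (((hc.fderiv_of_isOpen (m := ∞) hU (by simp)).contDiffAt (hU.mem_nhds hy)).differentiableAt
      (by simp))
  have key : ∀ u v : E n, fderiv ℝ (fun z ↦ fderiv ℝ c z u) y v = fderiv ℝ (fderiv ℝ c) y v u := by
    intro u v
    rw [fderiv_clm_apply hd (differentiableAt_const u)]
    simp
  rw [key, key]
  exact ((hc.contDiffAt (hU.mem_nhds hy)).isSymmSndFDerivAt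
    (by
      rw [minSmoothness_of_isRCLikeNormedField]
      exact WithTop.coe_le_coe.2 le_top)) v u

theorem IsSmooth.dq (hU : IsOpen U) {g : U → F n} (hg : IsSmooth g) (i : Fin n) :
    IsSmooth (dq i g) := by
  obtain ⟨m, c, v, hc, hv⟩ := hg
  exact .of_eq_sum (fun a ↦ contDiffOn_fderiv_apply hU (hc a) _) fun y ↦ dq_of_eq_sum hU hc hv i y

theorem dq_coef (hU : IsOpen U) {c : E n → ℝ} (hc : ContDiffOn ℝ ∞ c U) (w : F n) (i : Fin n)
    (y : U) : CourantNQ.dq i (fun y : U ↦ c y • w) y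
      = fderiv ℝ c y (EuclideanSpace.single i 1) • w := by
  rw [dq_of_eq_sum (ι := Unit) (c := fun _ ↦ c) (v := fun _ ↦ w) hU (fun _ ↦ hc) (by simp)]
  simp

theorem dq_const (hU : IsOpen U) (w : F n) (i : Fin n) (y : U) :
    CourantNQ.dq i (fun _ : U ↦ w) y = 0 := by
  simpa using dq_coef hU (c := fun _ ↦ (1 : ℝ)) contDiffOn_const w i y

theorem dq_add (hU : IsOpen U) {f g : U → F n} (hf : IsSmooth f) (hg : IsSmooth g) (i : Fin n)
    (y : U) : CourantNQ.dq i (f + g) y = CourantNQ.dq i f y + CourantNQ.dq i g y := by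
  obtain ⟨m, c, v, hc, hv⟩ := hf
  obtain ⟨m', c', v', hc', hv'⟩ := hg
  rw [dq_of_eq_sum hU hc hv, dq_of_eq_sum hU hc' hv', dq_of_eq_sum (ι := Fin m ⊕ Fin m')
    (c := Sum.elim c c') (v := Sum.elim v v') hU (by rintro (a | a); exacts [hc a, hc' a])
    fun y ↦ by simp [hv, hv']]
  simp

theorem dq_map (hU : IsOpen U) {f : U → F n} (hf : IsSmooth f) (L : F n →ₗ[ℝ] F n) (i : Fin n)
    (y : U) : CourantNQ.dq i (fun y ↦ L (f y)) y = L (CourantNQ.dq i f y) := by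
  obtain ⟨m, c, v, hc, hv⟩ := hf
  rw [dq_of_eq_sum hU hc hv, dq_of_eq_sum hU hc (v := fun a ↦ L (v a)) fun y ↦ by simp [hv]]
  simp

theorem dq_mul (hU : IsOpen U) {f g : U → F n} (hf : IsSmooth f) (hg : IsSmooth g) (i : Fin n)
    (y : U) :
    CourantNQ.dq i (f * g) y = CourantNQ.dq i f y * g y + f y * CourantNQ.dq i g y := by
  obtain ⟨m, c, v, hc, hv⟩ := hf
  obtain ⟨m', c', v', hc', hv'⟩ := hg
  rw [dq_of_eq_sum hU hc hv, dq_of_eq_sum hU hc' hv', dq_of_eq_sum (ι := Fin m × Fin m')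
    (c := fun a z ↦ c a.1 z * c' a.2 z) (v := fun a ↦ v a.1 * v' a.2) hU
    (fun a ↦ (hc a.1).mul (hc' a.2)), hv, hv', Finset.sum_mul_sum, Finset.sum_mul_sum,
    Fintype.sum_prod_type]
  · rw [← Finset.sum_add_distrib]
    refine Finset.sum_congr rfl fun a _ ↦ ?_
    rw [← Finset.sum_add_distrib]
    refine Finset.sum_congr rfl fun b _ ↦ ?_
    have h1 := (((hc a).contDiffAt (hU.mem_nhds y.2)).differentiableAt (by simp))
    have h2 := (((hc' b).contDiffAt (hU.mem_nhds y.2)).differentiableAt (by simp))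
    rw [fderiv_fun_mul h1 h2]
    simp only [add_apply, smul_apply, smul_eq_mul,
      F.smul_mul, F.mul_smul, smul_smul]
    module
  · intro y
    rw [Pi.mul_apply, hv, hv', Finset.sum_mul_sum, Fintype.sum_prod_type]
    simp [smul_smul, mul_comm]

/-- Induction on the generators of the algebra of smooth local functions. -/
theorem IsSmooth.induction {P : (U → F n) → Prop}
    (coef : ∀ c : E n → ℝ, ContDiffOn ℝ ∞ c U → P fun y ↦ c y • 1)
    (hxi : ∀ i, P fun _ ↦ xi i) (htheta : ∀ i, P fun _ ↦ theta i) (hp : ∀ i, P fun _ ↦ p i)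
    (add : ∀ f g, IsSmooth f → IsSmooth g → P f → P g → P (f + g))
    (mul : ∀ f g, IsSmooth f → IsSmooth g → P f → P g → P (f * g))
    {g : U → F n} (hg : IsSmooth g) : P g := by
  have one : P fun _ ↦ 1 := by simpa using coef (fun _ ↦ 1) contDiffOn_const
  -- Constants come first: they are built from the generators, with real factors entering as
  -- constant coefficients.
  have const : ∀ w : F n, P fun _ ↦ w := by
    intro w
    induction w using F.induction with
    | one => exact one
    | xi i => exact hxi i
    | theta i => exact htheta i
    | p i => exact hp i
    | smul r u hu =>
      have := mul _ _ (isSmooth_coef contDiffOn_const 1) (isSmooth_const u)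
        (coef (fun _ ↦ r) contDiffOn_const) hu
      convert this using 1
      ext1 y
      simp
    | mul u v hu hv => exact mul _ _ (isSmooth_const u) (isSmooth_const v) hu hv
    | add u v hu hv => exact add _ _ (isSmooth_const u) (isSmooth_const v) hu hv
  obtain ⟨m, c, v, hc, hv⟩ := hg
  -- Smoothness is carried along because the hypothesis on sums demands it of both summands.
  have key : IsSmooth g ∧ P g := by
    have h : g = ∑ a, fun y : U ↦ c a y • v a := by
      ext1 y
      simp [hv]
    rw [h]
    refine Finset.sum_induction _ (fun g ↦ IsSmooth g ∧ P g)
      (fun f g hf hg ↦ ⟨hf.1.add hg.1, add f g hf.1 hg.1 hf.2 hg.2⟩) ⟨isSmooth_const 0, const 0⟩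
      fun a _ ↦ ⟨isSmooth_coef (hc a) _, ?_⟩
    have := mul _ _ (isSmooth_coef (hc a) 1) (isSmooth_const (v a)) (coef _ (hc a)) (const (v a))
    convert this using 1
    ext1 y
    simp
  exact key.2

/-! ### Odd vector fields -/

/-- The vector field `ξ i ∂/∂q i + A j ∂/∂θ j + B j ∂/∂p j`. -/
def vectorField (A B : U → Fin n → F n) (g : U → F n) (y : U) : F n :=
  ∑ i, xi i * dq i g y + ∑ j, A y j * dTheta j (g y) + ∑ j, B y j * dP j (g y)

/-- An odd derivation of the algebra of smooth local functions. -/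
structure IsOddDerivation (X : (U → F n) → U → F n) : Prop where
  add : ∀ f g, IsSmooth f → IsSmooth g → X (f + g) = X f + X g
  mul : ∀ f g, IsSmooth f → IsSmooth g → ∀ y,
    X (f * g) y = X f y * g y + scale (-1) (f y) * X g y

/-- Even coefficients `A` leave `∂/∂θ` odd, while odd coefficients `B` make the even `∂/∂p` odd. The
two hypotheses are these parities, stated as commutation rules. -/
theorem isOddDerivation_vectorField (hU : IsOpen U) {A B : U → Fin n → F n}
    (hA : ∀ y j w, A y j * w = w * A y j) (hB : ∀ y j w, B y j * w = scale (-1) w * B y j) :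
    IsOddDerivation (vectorField A B) where
  add f g hf hg := by
    ext1 y
    simp only [vectorField, dq_add hU hf hg, Pi.add_apply, map_add, mul_add,
      Finset.sum_add_distrib]
    abel
  mul f g hf hg y := by
    have e1 : ∀ i, xi i * dq i (f * g) y
        = (xi i * dq i f y) * g y + scale (-1) (f y) * (xi i * dq i g y) := fun i ↦ by
      rw [dq_mul hU hf hg, mul_add, ← mul_assoc, ← mul_assoc, xi_mul i (f y), mul_assoc,
        mul_assoc]
    have e2 : ∀ j, A y j * dTheta j ((f * g) y)
        = (A y j * dTheta j (f y)) * g y + scale (-1) (f y) * (A y j * dTheta j (g y)) := fun j ↦ by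
      rw [Pi.mul_apply, dTheta_mul, mul_add, ← mul_assoc, ← mul_assoc, hA, mul_assoc]
      congr 1
      rw [hA, mul_assoc]
    have e3 : ∀ j, B y j * dP j ((f * g) y)
        = (B y j * dP j (f y)) * g y + scale (-1) (f y) * (B y j * dP j (g y)) := fun j ↦ by
      rw [Pi.mul_apply, dP_mul, mul_add, ← mul_assoc, ← mul_assoc, hB y j (f y), mul_assoc,
        mul_assoc]
    simp only [vectorField, e1, e2, e3, Finset.sum_add_distrib, add_mul, mul_add, Finset.sum_mul,
      Finset.mul_sum]
    abel

/-- Degree count: `A` has degree 2 and `∂/∂θ` degree `-1`, `B` has degree 3 and `∂/∂p` degree `-2`,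
so each term raises the degree by one. -/
theorem scale_vectorField (hU : IsOpen U) {A B : U → Fin n → F n} (t : ℝ)
    (hA : ∀ y j, scale t (A y j) = t ^ 2 • A y j) (hB : ∀ y j, scale t (B y j) = t ^ 3 • B y j)
    {f : U → F n} (hf : IsSmooth f) (y : U) :
    scale t (vectorField A B f y) = t • vectorField A B (fun y ↦ scale t (f y)) y := by
  have e : ∀ i, dq i (fun y ↦ scale t (f y)) y = scale t (dq i f y) := fun i ↦
    dq_map hU hf (scale t).toLinearMap i y
  simp only [vectorField, map_add, map_sum, map_mul, scale_xi, hA, hB, e, dTheta_scale, dP_scale,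
    smul_add, Finset.smul_sum, F.smul_mul, F.mul_smul, smul_smul]
  rw [show t ^ 3 = t * t ^ 2 by ring, sq]

theorem IsSmooth.vectorField (hU : IsOpen U) {A B : U → Fin n → F n}
    (hA : ∀ j, IsSmooth fun y ↦ A y j) (hB : ∀ j, IsSmooth fun y ↦ B y j)
    {f : U → F n} (hf : IsSmooth f) : IsSmooth (vectorField A B f) :=
  ((IsSmooth.sum _ fun i _ ↦ (isSmooth_const (xi i)).mul (hf.dq hU i)).add
    (IsSmooth.sum _ fun j _ ↦ (hA j).mul (hf.map (dTheta j)))).add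
    (IsSmooth.sum _ fun j _ ↦ (hB j).mul (hf.map (dP j)))

section Values

variable (A B : U → Fin n → F n) (y : U) (j : Fin n)

theorem vectorField_coef (hU : IsOpen U) {c : E n → ℝ} (hc : ContDiffOn ℝ ∞ c U) :
    vectorField A B (fun y ↦ c y • 1) y
      = ∑ i, fderiv ℝ c y (EuclideanSpace.single i 1) • xi i := by
  simp [vectorField, dq_coef hU hc]

theorem vectorField_xi (hU : IsOpen U) : vectorField A B (fun _ ↦ xi j) y = 0 := by
  simp [vectorField, dq_const hU]

theorem vectorField_theta (hU : IsOpen U) : vectorField A B (fun _ ↦ theta j) y = A y j := by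
  simp [vectorField, dq_const hU]

theorem vectorField_p (hU : IsOpen U) : vectorField A B (fun _ ↦ p j) y = B y j := by
  simp [vectorField, dq_const hU]

end Values

/-- Two odd derivations that are related by a substitution on generators are related by it. -/
theorem IsOddDerivation.intertwine {V : Set (E n)} {X : (U → F n) → U → F n}
    {Y : (V → F n) → V → F n} (hX : IsOddDerivation X) (hY : IsOddDerivation Y) (τ : U → V)
    (T : U → F n →ₐ[ℝ] F n) (hT : ∀ y w, T y (scale (-1) w) = scale (-1) (T y w))
    (coef : ∀ c : E n → ℝ, ContDiffOn ℝ ∞ c V →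
      IsSmooth (fun y ↦ c (τ y) • (1 : F n)) ∧
        ∀ y, X (fun y ↦ c (τ y) • 1) y = T y (Y (fun z ↦ c z • 1) (τ y)))
    (hxi : ∀ i, IsSmooth (fun y ↦ T y (xi i)) ∧
      ∀ y, X (fun y ↦ T y (xi i)) y = T y (Y (fun _ ↦ xi i) (τ y)))
    (htheta : ∀ i, IsSmooth (fun y ↦ T y (theta i)) ∧
      ∀ y, X (fun y ↦ T y (theta i)) y = T y (Y (fun _ ↦ theta i) (τ y)))
    (hp : ∀ i, IsSmooth (fun y ↦ T y (p i)) ∧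
      ∀ y, X (fun y ↦ T y (p i)) y = T y (Y (fun _ ↦ p i) (τ y)))
    {g : V → F n} (hg : IsSmooth g) :
    IsSmooth (fun y ↦ T y (g (τ y))) ∧ ∀ y, X (fun y ↦ T y (g (τ y))) y = T y (Y g (τ y)) := by
  refine IsSmooth.induction (P := fun g ↦ IsSmooth (fun y ↦ T y (g (τ y))) ∧
    ∀ y, X (fun y ↦ T y (g (τ y))) y = T y (Y g (τ y))) (fun c hc ↦ ?_) hxi htheta hp
    (fun f g hf hg hf' hg' ↦ ?_) (fun f g hf hg hf' hg' ↦ ?_) hg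
  · simpa using coef c hc
  · have e : (fun y ↦ T y ((f + g) (τ y)))
        = (fun y ↦ T y (f (τ y))) + fun y ↦ T y (g (τ y)) := by
      ext1 y
      simp
    rw [e]
    refine ⟨hf'.1.add hg'.1, fun y ↦ ?_⟩
    rw [hX.add _ _ hf'.1 hg'.1, hY.add _ _ hf hg, Pi.add_apply, Pi.add_apply, hf'.2, hg'.2, map_add]
  · have e : (fun y ↦ T y ((f * g) (τ y)))
        = (fun y ↦ T y (f (τ y))) * fun y ↦ T y (g (τ y)) := by
      ext1 y
      simp
    rw [e]
    refine ⟨hf'.1.mul hg'.1, fun y ↦ ?_⟩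
    rw [hX.mul _ _ hf'.1 hg'.1, hY.mul _ _ hf hg, hf'.2, hg'.2, map_add, map_mul, map_mul, hT]

end LocalCalculus

/-! ### The local Courant vector field -/

section LocalCourant

variable {n : ℕ} {U : Set (E n)}

/-- Coefficients have degree 0, so the Leibniz rule carries no sign. Values on functions with
variable coefficients reduce to values on constant elements. -/
theorem vectorField_sum_coef (hU : IsOpen U) {A B : U → Fin n → F n}
    (hX : IsOddDerivation (vectorField A B)) {ι : Type*} [Fintype ι] {c : ι → E n → ℝ}
    (hc : ∀ a, ContDiffOn ℝ ∞ (c a) U) (w : ι → F n) (y : U) :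
    vectorField A B (fun y ↦ ∑ a, c a y • w a) y
      = ∑ a, (∑ i, fderiv ℝ (c a) y (EuclideanSpace.single i 1) • (xi i * w a)
          + c a y • vectorField A B (fun _ ↦ w a) y) := by
  have h1 : ∀ a, vectorField A B (fun y ↦ c a y • w a) y
      = ∑ i, fderiv ℝ (c a) y (EuclideanSpace.single i 1) • (xi i * w a)
          + c a y • vectorField A B (fun _ ↦ w a) y := fun a ↦ by
    have e : (fun y : U ↦ c a y • w a) = (fun y : U ↦ c a y • (1 : F n)) * fun _ ↦ w a := by
      ext1 y
      simp
    rw [e, hX.mul _ _ (isSmooth_coef (hc a) 1) (isSmooth_const _), vectorField_coef A B y hU (hc a)]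
    simp [Finset.sum_mul]
  have h2 : ∀ s : Finset ι, vectorField A B (fun y ↦ ∑ a ∈ s, c a y • w a) y
      = ∑ a ∈ s, vectorField A B (fun y ↦ c a y • w a) y := by
    intro s
    induction s using Finset.cons_induction with
    | empty => simp [vectorField, dq_const hU]
    | cons a s ha ih =>
      have e : (fun y : U ↦ ∑ a ∈ Finset.cons a s ha, c a y • w a)
          = (fun y : U ↦ c a y • w a) + fun y : U ↦ ∑ a ∈ s, c a y • w a := by
        ext1 y
        simp
      rw [e, hX.add _ _ (isSmooth_coef (hc a) _) (IsSmooth.sum _ fun a _ ↦ isSmooth_coef (hc a) _),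
        Pi.add_apply, ih, Finset.sum_cons]
  rw [h2, Finset.sum_congr rfl fun a _ ↦ h1 a]

/-- Exchanging the indices turns the sum into its own negative, since the `ξ` anticommute. Applied
to second derivatives, this is `d² = 0`. -/
theorem sum_symm_xi_mul_xi {s : Fin n → Fin n → ℝ} (hs : ∀ i j, s i j = s j i) :
    ∑ i, ∑ j, s i j • (xi i * xi j) = 0 := by
  have h : ∑ i, ∑ j, s i j • (xi i * xi j) = -∑ i, ∑ j, s i j • (xi i * xi j) := by
    conv_lhs => rw [Finset.sum_comm]
    rw [← Finset.sum_neg_distrib]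
    refine Finset.sum_congr rfl fun i _ ↦ ?_
    rw [← Finset.sum_neg_distrib]
    refine Finset.sum_congr rfl fun j _ ↦ ?_
    rw [xi_mul_xi j i, hs j i, smul_neg]
  have h2 : (2 : ℝ) • ∑ i, ∑ j, s i j • (xi i * xi j) = 0 := by
    rw [two_smul]
    nth_rw 1 [h]
    exact neg_add_cancel _
  exact (smul_eq_zero.1 h2).resolve_left two_ne_zero

/-- The vector field `ξ i ∂/∂q i + p i ∂/∂θ i` on a coordinate domain. -/
def courantField : (U → F n) → U → F n := vectorField (fun _ j ↦ p j) fun _ _ ↦ 0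

theorem isOddDerivation_courantField (hU : IsOpen U) :
    IsOddDerivation (courantField : (U → F n) → U → F n) :=
  isOddDerivation_vectorField hU (fun _ j w ↦ p_mul_comm j w) (by simp)

theorem isSmooth_courantField (hU : IsOpen U) {f : U → F n} (hf : IsSmooth f) :
    IsSmooth (courantField f) :=
  IsSmooth.vectorField hU (A := fun _ j ↦ p j) (B := fun _ _ ↦ 0) (fun j ↦ isSmooth_const (p j))
    (fun _ ↦ isSmooth_const 0) hf

theorem scale_courantField (hU : IsOpen U) (t : ℝ) {f : U → F n} (hf : IsSmooth f) (y : U) :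
    scale t (courantField f y) = t • courantField (fun y ↦ scale t (f y)) y :=
  scale_vectorField hU t (by simp) (by simp) hf y

theorem courantField_const (hU : IsOpen U) (y : U) {w : F n} (h : ∀ i, dTheta i w = 0) :
    courantField (fun _ : U ↦ w) y = 0 := by
  simp [courantField, vectorField, dq_const hU, h]

/-- The square of an odd derivation is an even derivation, so generators suffice: `θ ↦ p ↦ 0`, `ξ ↦
0`, and for coefficients the claim is symmetry of second derivatives. -/
theorem courantField_courantField (hU : IsOpen U) {f : U → F n} (hf : IsSmooth f) :
    courantField (courantField f) = 0 := by
  have hX := isOddDerivation_courantField hU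
  refine IsSmooth.induction (P := fun f ↦ courantField (courantField f) = 0)
    (fun c hc ↦ ?_) (fun i ↦ ?_) (fun i ↦ ?_) (fun i ↦ ?_) (fun f g hf hg hf' hg' ↦ ?_)
    (fun f g hf hg hf' hg' ↦ ?_) hf
  · have e : courantField (fun y : U ↦ c y • (1 : F n))
        = fun y : U ↦ ∑ i, fderiv ℝ c y (EuclideanSpace.single i 1) • xi i := by
      ext1 y
      exact vectorField_coef _ _ y hU hc
    rw [e]
    ext1 y
    refine (vectorField_sum_coef hU hX (fun i ↦ contDiffOn_fderiv_apply hU hc _) xi y).trans ?_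
    simp only [vectorField_xi _ _ _ _ hU, smul_zero, add_zero, Pi.zero_apply]
    rw [Finset.sum_comm]
    exact sum_symm_xi_mul_xi fun i j ↦ fderiv_fderiv_comm hU hc y.2 _ _
  · have e : courantField (fun _ : U ↦ xi i) = fun _ ↦ (0 : F n) := by
      ext1 y
      exact vectorField_xi _ _ y i hU
    rw [e]
    ext1 y
    exact courantField_const hU y (by simp)
  · have e : courantField (fun _ : U ↦ theta i) = fun _ ↦ p i := by
      ext1 y
      exact vectorField_theta _ _ y i hU
    rw [e]
    ext1 y
    exact courantField_const hU y (by simp)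
  · have e : courantField (fun _ : U ↦ p i) = fun _ ↦ (0 : F n) := by
      ext1 y
      exact vectorField_p _ _ y i hU
    rw [e]
    ext1 y
    exact courantField_const hU y (by simp)
  · rw [hX.add f g hf hg, hX.add _ _ (isSmooth_courantField hU hf) (isSmooth_courantField hU hg), hf', hg', add_zero]
  · have hs : IsSmooth fun y ↦ scale (-1) (f y) := hf.map (scale (-1)).toLinearMap
    have e : courantField (f * g) = courantField f * g
        + (fun y ↦ scale (-1) (f y)) * courantField g := by
      ext1 y
      exact hX.mul f g hf hg y
    rw [e, hX.add _ _ ((isSmooth_courantField hU hf).mul hg) (hs.mul (isSmooth_courantField hU hg))]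
    ext1 y
    -- The cross terms cancel because the field, being odd, anticommutes with the parity involution.
    rw [Pi.add_apply, hX.mul _ _ (isSmooth_courantField hU hf) hg, hX.mul _ _ hs (isSmooth_courantField hU hg), hf',
      hg', scale_courantField hU _ hf, F.neg_one_smul]
    simp

/-! ### Invariance of the Courant vector field under changes of coordinates -/

/-- The Jacobian matrix of a map of `ℝⁿ`. -/
def jac (τ : E n → E n) (y : E n) : Matrix (Fin n) (Fin n) ℝ :=
  Matrix.of fun a i ↦ fderiv ℝ τ y (EuclideanSpace.single i (1 : ℝ)) a

/-- The second partial derivatives of a map of `ℝⁿ`. -/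
def hess (σ : E n → E n) (z : E n) (a b i : Fin n) : ℝ :=
  fderiv ℝ (fun w ↦ fderiv ℝ σ w (EuclideanSpace.single b (1 : ℝ)) i) z
    (EuclideanSpace.single a (1 : ℝ))

theorem clm_apply_eq_sum {G : Type*} [NormedAddCommGroup G] [NormedSpace ℝ G] (L : E n →L[ℝ] G)
    (v : E n) : L v = ∑ a, v a • L (EuclideanSpace.single a 1) := by
  conv_lhs => rw [← (EuclideanSpace.basisFun (Fin n) ℝ).sum_repr v]
  simp

theorem contDiffOn_coord {σ : E n → E n} (hσ : ContDiffOn ℝ ∞ σ U) (i : Fin n) :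
    ContDiffOn ℝ ∞ (fun z ↦ σ z i) U :=
  (EuclideanSpace.proj i : E n →L[ℝ] ℝ).contDiff.comp_contDiffOn hσ

theorem fderiv_coord {σ : E n → E n} {z : E n} (hσ : DifferentiableAt ℝ σ z) (i : Fin n) (v : E n) :
    fderiv ℝ (fun z ↦ σ z i) z v = fderiv ℝ σ z v i := by
  have h := ((EuclideanSpace.proj i : E n →L[ℝ] ℝ).hasFDerivAt.comp z hσ.hasFDerivAt)
  rw [show (fun z ↦ σ z i) = (EuclideanSpace.proj i : E n →L[ℝ] ℝ) ∘ σ from rfl,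
    h.fderiv]
  rfl

theorem hess_symm (hU : IsOpen U) {σ : E n → E n} (hσ : ContDiffOn ℝ ∞ σ U) {z : E n} (hz : z ∈ U)
    (a b i : Fin n) : hess σ z a b i = hess σ z b a i := by
  have hd : ∀ v, DifferentiableAt ℝ (fun w ↦ fderiv ℝ σ w v) z := fun v ↦
    ((contDiffOn_fderiv_apply hU hσ v).contDiffAt (hU.mem_nhds hz)).differentiableAt (by simp)
  rw [hess, hess, fderiv_coord (hd _), fderiv_coord (hd _), fderiv_fderiv_comm hU hσ hz]

theorem contDiffOn_jac (hU : IsOpen U) {τ : E n → E n} (hτ : ContDiffOn ℝ ∞ τ U) (a i : Fin n) :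
    ContDiffOn ℝ ∞ (fun y ↦ jac τ y a i) U :=
  contDiffOn_coord (contDiffOn_fderiv_apply hU hτ _) a

theorem contDiffOn_hess (hU : IsOpen U) {σ : E n → E n} (hσ : ContDiffOn ℝ ∞ σ U) (a b i : Fin n) :
    ContDiffOn ℝ ∞ (fun y ↦ hess σ y a b i) U :=
  contDiffOn_fderiv_apply hU (contDiffOn_coord (contDiffOn_fderiv_apply hU hσ _) i) _

theorem fderiv_comp_eq_sum {τ : E n → E n} {c : E n → ℝ} {y : E n} (hτ : DifferentiableAt ℝ τ y)
    (hc : DifferentiableAt ℝ c (τ y)) (i : Fin n) :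
    fderiv ℝ (fun y ↦ c (τ y)) y (EuclideanSpace.single i 1)
      = ∑ a, jac τ y a i * fderiv ℝ c (τ y) (EuclideanSpace.single a 1) := by
  rw [show (fun y ↦ c (τ y)) = c ∘ τ from rfl, fderiv_comp y hc hτ, ContinuousLinearMap.comp_apply,
    clm_apply_eq_sum (fderiv ℝ c (τ y))]
  rfl

/-- Expanding `ξ'` in the `ξ` gives a normal form in which coefficients of `ξ θ` can be compared. -/
theorem glueP_eq_sum (J K : Matrix (Fin n) (Fin n) ℝ) (H : Fin n → Fin n → Fin n → ℝ) (a : Fin n) :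
    glueP J K H a = ∑ i, K a i • p i
      + ∑ l, ∑ i, (∑ b, H a b i * J b l) • (xi l * theta i) := by
  have h : ∀ b i, H a b i • (xiOf (J b) * theta i)
      = ∑ l, (H a b i * J b l) • (xi l * theta i) := fun b i ↦ by
    simp [xiOf_eq_sum, Finset.sum_mul, Finset.smul_sum, smul_smul]
  simp only [glueP, h, Finset.sum_smul]
  congr 1
  rw [Finset.sum_comm, Finset.sum_congr rfl fun i _ ↦ Finset.sum_comm, Finset.sum_comm]

theorem isSmooth_glue_p {J K : E n → Matrix (Fin n) (Fin n) ℝ}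
    {H : E n → Fin n → Fin n → Fin n → ℝ} (hJ : ∀ a i, ContDiffOn ℝ ∞ (fun y ↦ J y a i) U)
    (hK : ∀ a i, ContDiffOn ℝ ∞ (fun y ↦ K y a i) U)
    (hH : ∀ a b i, ContDiffOn ℝ ∞ (fun y ↦ H y a b i) U) (a : Fin n) :
    IsSmooth fun y : U ↦ glue (J y) (K y) (H y) (p a) := by
  simp only [glue_p, glueP_eq_sum]
  exact (IsSmooth.sum _ fun i _ ↦ isSmooth_coef (hK a i) _).add
    (IsSmooth.sum _ fun l _ ↦ IsSmooth.sum _ fun i _ ↦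
      isSmooth_coef (c := fun y ↦ ∑ b, H y a b i * J y b l)
        (ContDiffOn.sum fun b _ ↦ (hH a b i).mul (hJ b l)) _)

/-- On coefficients this is the chain rule, on `ξ` the symmetry of second derivatives. On `θ` it is
the law for `p`, which is obtained by applying the field to the law for `θ`; the case of `p` then
follows because the field squares to zero. It is not required that `σ` invert `τ`. -/
theorem courantField_glue {V V' : Set (E n)} (hU : IsOpen U) (hV : IsOpen V) (hV' : IsOpen V')
    {τ σ : E n → E n} (hτ : ContDiffOn ℝ ∞ τ U) (hσ : ContDiffOn ℝ ∞ σ V')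
    (hUV : Set.MapsTo τ U V) (hUV' : Set.MapsTo τ U V') {g : V → F n} (hg : IsSmooth g) (y : U) :
    courantField (fun y : U ↦ glue (jac τ y) (jac σ (τ y)).transpose (hess σ (τ y))
        (g ⟨τ y, hUV y.2⟩)) y
      = glue (jac τ y) (jac σ (τ y)).transpose (hess σ (τ y)) (courantField g ⟨τ y, hUV y.2⟩) := by
  have hX := isOddDerivation_courantField hU
  have hK : ∀ a i, ContDiffOn ℝ ∞ (fun y ↦ (jac σ (τ y)).transpose a i) U := fun a i ↦
    (contDiffOn_jac hV' hσ i a).comp hτ hUV'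
  have hH : ∀ a b i, ContDiffOn ℝ ∞ (fun y ↦ hess σ (τ y) a b i) U := fun a b i ↦
    (contDiffOn_hess hV' hσ a b i).comp hτ hUV'
  have hdτ : ∀ y : U, DifferentiableAt ℝ τ y := fun y ↦
    (hτ.contDiffAt (hU.mem_nhds y.2)).differentiableAt (by simp)
  have etheta : ∀ j, (fun y : U ↦ glue (jac τ y) (jac σ (τ y)).transpose (hess σ (τ y)) (theta j))
      = fun y : U ↦ ∑ i, (jac σ (τ y)).transpose j i • theta i := fun j ↦ by
    ext1 y
    rw [glue_theta, thetaOf_eq_sum]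
  have stheta : ∀ j, IsSmooth
      (fun y : U ↦ glue (jac τ y) (jac σ (τ y)).transpose (hess σ (τ y)) (theta j)) := fun j ↦ by
    rw [etheta]
    exact IsSmooth.sum _ fun i _ ↦ isSmooth_coef (hK j i) _
  have qtheta : ∀ j,
      courantField (fun y : U ↦ glue (jac τ y) (jac σ (τ y)).transpose (hess σ (τ y)) (theta j))
        = fun y : U ↦ glue (jac τ y) (jac σ (τ y)).transpose (hess σ (τ y)) (p j) := fun j ↦ by
    rw [etheta]
    ext1 y
    refine (vectorField_sum_coef hU hX (hK j) theta y).trans ?_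
    rw [glue_p, glueP_eq_sum, Finset.sum_add_distrib, add_comm, Finset.sum_comm]
    congr 1
    · exact Finset.sum_congr rfl fun i _ ↦ by rw [vectorField_theta _ _ _ _ hU]
    · refine Finset.sum_congr rfl fun l _ ↦ Finset.sum_congr rfl fun i _ ↦ ?_
      congr 1
      have hd : DifferentiableAt ℝ (fun z ↦ jac σ z i j) (τ y) :=
        ((contDiffOn_jac hV' hσ i j).contDiffAt (hV'.mem_nhds (hUV' y.2))).differentiableAt
          (by simp)
      refine (fderiv_comp_eq_sum (c := fun z ↦ jac σ z i j) (hdτ y) hd l).trans ?_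
      refine Finset.sum_congr rfl fun b _ ↦ ?_
      -- The chain rule produces the derivatives in the order opposite to the one in the transition
      -- rule.
      rw [hess_symm hV' hσ (hUV' y.2) j b i, mul_comm]
      rfl
  refine (hX.intertwine (isOddDerivation_courantField hV) (fun y : U ↦ ⟨τ y, hUV y.2⟩)
    (fun y : U ↦ glue (jac τ y) (jac σ (τ y)).transpose (hess σ (τ y)))
    (fun y w ↦ glue_scale _ _ _ _ _) (fun c hc ↦ ?_) (fun j ↦ ?_) (fun j ↦ ⟨stheta j, fun y ↦ ?_⟩)
    (fun j ↦ ⟨?_, fun y ↦ ?_⟩) hg).2 y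
  · have hc' : ContDiffOn ℝ ∞ (fun y ↦ c (τ y)) U := hc.comp hτ hUV
    refine ⟨isSmooth_coef hc' 1, fun y ↦ ?_⟩
    refine (vectorField_coef _ _ y hU hc').trans ?_
    rw [courantField, vectorField_coef _ _ _ hV hc, map_sum]
    simp only [map_smul, glue_xi, xiOf_eq_sum, Finset.smul_sum, smul_smul]
    rw [Finset.sum_comm]
    refine Finset.sum_congr rfl fun i _ ↦ ?_
    rw [fderiv_comp_eq_sum (hdτ y)
      ((hc.contDiffAt (hV.mem_nhds (hUV y.2))).differentiableAt (by simp)), Finset.sum_smul]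
    exact Finset.sum_congr rfl fun a _ ↦ by rw [mul_comm]
  · have e : (fun y : U ↦ glue (jac τ y) (jac σ (τ y)).transpose (hess σ (τ y)) (xi j))
        = fun y : U ↦ ∑ i, jac τ y j i • xi i := by
      ext1 y
      rw [glue_xi, xiOf_eq_sum]
    rw [e]
    refine ⟨IsSmooth.sum _ fun i _ ↦ isSmooth_coef (contDiffOn_jac hU hτ j i) _, fun y ↦ ?_⟩
    refine (vectorField_sum_coef hU hX (contDiffOn_jac hU hτ j) xi y).trans ?_
    rw [courantField_const hV _ (by simp), map_zero]
    simp only [vectorField_xi _ _ _ _ hU, smul_zero, add_zero]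
    rw [Finset.sum_comm]
    exact sum_symm_xi_mul_xi fun i l ↦ hess_symm hU hτ y.2 i l j
  · rw [qtheta, courantField, vectorField_theta _ _ _ _ hV]
  · exact isSmooth_glue_p (contDiffOn_jac hU hτ) hK hH j
  · rw [← qtheta, courantField_courantField hU (stheta j), courantField_const hV _ (by simp),
      map_zero, Pi.zero_apply]

end LocalCourant

/-! ### Coordinate frames -/

section Coordinates

variable {n : ℕ} {M : Type*} [TopologicalSpace M] [ChartedSpace (E n) M]

/-- The part of the range of `φ` that is covered by `ψ`. -/
def overlap (φ ψ : Chart n M) : Set (E n) := φ.1.target ∩ φ.1.symm ⁻¹' ψ.1.source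

theorem isOpen_overlap (φ ψ : Chart n M) : IsOpen (overlap φ ψ) :=
  φ.1.symm.isOpen_inter_preimage ψ.1.open_source

theorem mapsTo_coordChange (φ ψ : Chart n M) :
    Set.MapsTo (coordChange φ ψ) (overlap φ ψ) (overlap ψ φ) := fun y hy ↦ by
  refine ⟨ψ.1.map_source hy.2, ?_⟩
  simpa [coordChange, ψ.1.left_inv hy.2] using φ.1.map_target hy.1

theorem symm_coordChange {φ ψ : Chart n M} {y : E n} (hy : y ∈ overlap φ ψ) :
    ψ.1.symm (coordChange φ ψ y) = φ.1.symm y := ψ.1.left_inv hy.2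

theorem Chart.contMDiffAt (φ : Chart n M) {x : M} (hx : x ∈ φ.1.source) :
    ContMDiffAt (𝓡 n) (𝓡 n) ∞ φ.1 x :=
  contMDiffAt_of_mem_maximalAtlas φ.2 hx

theorem Chart.contMDiffAt_symm (φ : Chart n M) {y : E n} (hy : y ∈ φ.1.target) :
    ContMDiffAt (𝓡 n) (𝓡 n) ∞ φ.1.symm y :=
  contMDiffAt_symm_of_mem_maximalAtlas φ.2 hy

theorem Chart.mdifferentiable (φ : Chart n M) : φ.1.MDifferentiable (𝓡 n) (𝓡 n) :=
  ⟨fun _ hx ↦ ((φ.contMDiffAt hx).mdifferentiableAt (by simp)).mdifferentiableWithinAt,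
    fun _ hy ↦ ((φ.contMDiffAt_symm hy).mdifferentiableAt (by simp)).mdifferentiableWithinAt⟩

theorem contDiffOn_coordChange (φ ψ : Chart n M) :
    ContDiffOn ℝ ∞ (coordChange φ ψ) (overlap φ ψ) := fun y hy ↦
  (contMDiffAt_iff_contDiffAt.1 ((ψ.contMDiffAt hy.2).comp y
    (φ.contMDiffAt_symm hy.1))).contDiffWithinAt

theorem Chart.contMDiffAt_coord (φ : Chart n M) (k : Fin n) {x : M} (hx : x ∈ φ.1.source) :
    ContMDiffAt (𝓡 n) 𝓘(ℝ, ℝ) ∞ (fun m ↦ φ.1 m k) x :=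
  (EuclideanSpace.proj k : E n →L[ℝ] ℝ).contDiff.contMDiff.contMDiffAt.comp x (φ.contMDiffAt hx)

theorem Chart.inverse_mfderiv (φ : Chart n M) {y : E n} (hy : y ∈ φ.1.target) :
    (mfderiv (𝓡 n) (𝓡 n) φ.1 (φ.1.symm y)).inverse = mfderiv (𝓡 n) (𝓡 n) φ.1.symm y := by
  refine ContinuousLinearMap.inverse_eq ?_ ?_
  · exact φ.mdifferentiable.comp_symm_deriv hy
  · have h := φ.mdifferentiable.symm_comp_deriv (φ.1.map_target hy)
    rwa [φ.1.right_inv hy] at h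

theorem Chart.isInvertible_mfderiv (φ : Chart n M) {x : M} (hx : x ∈ φ.1.source) :
    (mfderiv (𝓡 n) (𝓡 n) φ.1 x).IsInvertible :=
  ⟨φ.mdifferentiable.mfderiv hx, rfl⟩

/-- The coordinate vector field `∂/∂qⁱ` of the chart `φ` (to be used on the domain of `φ` only). -/
def coordField (φ : Chart n M) (i : Fin n) (x : M) : TangentSpace (𝓡 n) x :=
  VectorField.mpullback (𝓡 n) (𝓡 n) φ.1 (fun _ ↦ EuclideanSpace.single i (1 : ℝ)) x

/-- `coordVec` lives over points of the coordinate range, whereas connections and brackets act on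
fields over `M`. Defining the field as a pullback makes its smoothness available, and this lemma
identifies the two. -/
theorem coordField_symm (φ : Chart n M) {y : E n} (hy : y ∈ φ.1.target) (i : Fin n) :
    coordField φ i (φ.1.symm y) = coordVec φ y i :=
  DFunLike.congr_fun (φ.inverse_mfderiv hy) (EuclideanSpace.single i (1 : ℝ))

theorem mvfderiv_coordField {G : Type*} [NormedAddCommGroup G] [NormedSpace ℝ G] (φ : Chart n M)
    {f : M → G} {y : E n} (hy : y ∈ φ.1.target)
    (hf : MDifferentiableAt (𝓡 n) 𝓘(ℝ, G) f (φ.1.symm y)) (i : Fin n) :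
    mvfderiv (𝓡 n) f (φ.1.symm y) (coordField φ i (φ.1.symm y))
      = fderiv ℝ (fun z ↦ f (φ.1.symm z)) y (EuclideanSpace.single i 1) := by
  have h := mfderiv_comp y hf (φ.mdifferentiable.mdifferentiableAt_symm hy)
  rw [mfderiv_eq_fderiv] at h
  rw [coordField_symm φ hy, show (fun z ↦ f (φ.1.symm z)) = f ∘ φ.1.symm from rfl]
  exact (DFunLike.congr_fun h (EuclideanSpace.single i (1 : ℝ))).symm

theorem coordForm_coordField (φ : Chart n M) {x : M} (hx : x ∈ φ.1.source) (k i : Fin n) :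
    coordForm φ k x (coordField φ i x) = if k = i then 1 else 0 := by
  obtain ⟨y, hy, rfl⟩ : ∃ y ∈ φ.1.target, φ.1.symm y = x :=
    ⟨φ.1 x, φ.1.map_source hx, φ.1.left_inv hx⟩
  refine (mvfderiv_coordField φ hy ((φ.contMDiffAt_coord k hx).mdifferentiableAt (by simp))
    i).trans ?_
  have h : (fun z ↦ φ.1 (φ.1.symm z) k) =ᶠ[nhds y] fun z ↦ (EuclideanSpace.proj k : E n →L[ℝ] ℝ) z := by
    filter_upwards [φ.1.open_target.mem_nhds hy] with z hz
    simp [φ.1.right_inv hz]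
  rw [h.fderiv_eq, ContinuousLinearMap.fderiv]
  simp

theorem coordForm_coordField_of_overlap (φ ψ : Chart n M) {y : E n} (hy : y ∈ overlap φ ψ)
    (m i : Fin n) :
    coordForm ψ m (φ.1.symm y) (coordField φ i (φ.1.symm y)) = jacobian φ ψ y m i := by
  refine (mvfderiv_coordField φ hy.1 ((ψ.contMDiffAt_coord m hy.2).mdifferentiableAt (by simp))
    i).trans ?_
  exact fderiv_coord (((contDiffOn_coordChange φ ψ).contDiffAt
    ((isOpen_overlap φ ψ).mem_nhds hy)).differentiableAt (by simp)) m _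

theorem eq_sum_coordField (φ : Chart n M) {x : M} (hx : x ∈ φ.1.source)
    (v : TangentSpace (𝓡 n) x) : v = ∑ i, coordForm φ i x v • coordField φ i x := by
  have h := DFunLike.congr_fun (φ.mdifferentiable.symm_comp_deriv hx) v
  have h2 : ∀ i, coordForm φ i x v
      = (EuclideanSpace.proj i : E n →L[ℝ] ℝ) (mfderiv (𝓡 n) (𝓡 n) φ.1 x v) := fun i ↦ by
    have h3 := mfderiv_comp x (I' := 𝓡 n) (I'' := 𝓘(ℝ, ℝ)) (g := (EuclideanSpace.proj i : E n →L[ℝ] ℝ))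
      (EuclideanSpace.proj i : E n →L[ℝ] ℝ).mdifferentiableAt
      ((φ.contMDiffAt hx).mdifferentiableAt (by simp))
    rw [ContinuousLinearMap.mfderiv_eq] at h3
    exact DFunLike.congr_fun h3 v
  obtain ⟨y, hy, rfl⟩ : ∃ y ∈ φ.1.target, φ.1.symm y = x :=
    ⟨φ.1 x, φ.1.map_source hx, φ.1.left_inv hx⟩
  simp only [h2, coordField_symm φ hy]
  rw [φ.1.right_inv hy] at h
  refine h.symm.trans ?_
  let L : E n →L[ℝ] E n := mfderiv (𝓡 n) (𝓡 n) φ.1.symm y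
  exact clm_apply_eq_sum L _

theorem eq_sum_coordForm (φ : Chart n M) {x : M} (hx : x ∈ φ.1.source)
    (α : Cotangent n M x) : α = ∑ k, α (coordField φ k x) • coordForm φ k x := by
  ext v
  conv_lhs => rw [eq_sum_coordField φ hx v]
  simp [mul_comm]

variable [IsManifold (𝓡 n) ∞ M]

theorem contMDiffAt_coordField (φ : Chart n M) (i : Fin n) {x : M} (hx : x ∈ φ.1.source) :
    ContMDiffAt (𝓡 n) ((𝓡 n).prod 𝓘(ℝ, E n)) ∞
      (fun x ↦ (⟨x, coordField φ i x⟩ : Bundle.TotalSpace (E n) (TangentSpace (𝓡 n) : M → Type _)))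
      x := by
  refine ContMDiffAt.mpullback_vectorField_preimage (n := ∞) (m := ∞)
    (V := fun _ ↦ EuclideanSpace.single i (1 : ℝ)) ?_ (φ.contMDiffAt hx)
    (φ.isInvertible_mfderiv hx) (by simp)
  exact contMDiffAt_vectorSpace_iff_contDiffAt.2 contDiffAt_const

theorem contMDiffAt_mvfderiv {f : M → ℝ} {x : M} (hf : ContMDiffAt (𝓡 n) 𝓘(ℝ, ℝ) ∞ f x) :
    ContMDiffAt (𝓡 n) ((𝓡 n).prod 𝓘(ℝ, E n →L[ℝ] ℝ)) ∞
      (fun x ↦ (⟨x, mvfderiv (𝓡 n) f x⟩ : Bundle.TotalSpace (E n →L[ℝ] ℝ) (Cotangent n M))) x := by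
  rw [contMDiffAt_hom_bundle]
  refine ⟨contMDiffAt_id, ?_⟩
  refine (hf.mfderiv_const (m := ∞) (by simp)).congr_of_eventuallyEq (Filter.Eventually.of_forall fun z ↦ ?_)
  simp [inTangentCoordinates, ContinuousLinearMap.inCoordinates]
  rfl

theorem contMDiffAt_coordForm (φ : Chart n M) (k : Fin n) {x : M} (hx : x ∈ φ.1.source) :
    ContMDiffAt (𝓡 n) ((𝓡 n).prod 𝓘(ℝ, E n →L[ℝ] ℝ)) ∞
      (fun x ↦ (⟨x, coordForm φ k x⟩ : Bundle.TotalSpace (E n →L[ℝ] ℝ) (Cotangent n M))) x :=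
  contMDiffAt_mvfderiv (φ.contMDiffAt_coord k hx)

end Coordinates

/-! ### Smooth sections and vector fields -/

section Sections

variable {n : ℕ} {M : Type*} [TopologicalSpace M] [ChartedSpace (E n) M]

theorem mvfderiv_sum {ι : Type*} (S : Finset ι) {f : ι → M → ℝ} {x : M}
    (hf : ∀ i ∈ S, MDifferentiableAt (𝓡 n) 𝓘(ℝ, ℝ) (f i) x) :
    MDifferentiableAt (𝓡 n) 𝓘(ℝ, ℝ) (fun z ↦ ∑ i ∈ S, f i z) x ∧
      mvfderiv (𝓡 n) (fun z ↦ ∑ i ∈ S, f i z) x = ∑ i ∈ S, mvfderiv (𝓡 n) (f i) x := by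
  classical
  induction S using Finset.induction_on with
  | empty => exact ⟨by simpa using! mdifferentiableAt_const, by simpa using! mvfderiv_const (0 : ℝ)⟩
  | insert a S ha ih =>
    obtain ⟨h1, h2⟩ := ih fun i hi ↦ hf i (Finset.mem_insert_of_mem hi)
    have h3 := hf a (Finset.mem_insert_self a S)
    simp only [Finset.sum_insert ha]
    refine ⟨h3.add h1, ?_⟩
    rw [← h2]
    exact mvfderiv_add h3 h1

theorem mvfderiv_mul_apply {f g : M → ℝ} {x : M} (hf : MDifferentiableAt (𝓡 n) 𝓘(ℝ, ℝ) f x)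
    (hg : MDifferentiableAt (𝓡 n) 𝓘(ℝ, ℝ) g x) (v : TangentSpace (𝓡 n) x) :
    mvfderiv (𝓡 n) (fun z ↦ f z * g z) x v
      = mvfderiv (𝓡 n) f x v * g x + f x * mvfderiv (𝓡 n) g x v := by
  have h := DFunLike.congr_fun (mvfderiv_mul hf hg) v
  refine h.trans ?_
  simp
  ring

theorem mvfderiv_congr {f g : M → ℝ} {x : M} (h : f =ᶠ[nhds x] g) :
    mvfderiv (𝓡 n) f x = mvfderiv (𝓡 n) g x := by
  unfold mvfderiv
  rw [h.mfderiv_eq, h.eq_of_nhds]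

/-- The pairing of a covector field with a vector field is a smooth function. -/
theorem contMDiffAt_apply [IsManifold (𝓡 n) ∞ M] {s : ∀ x : M, Cotangent n M x}
    {X : ∀ x : M, TangentSpace (𝓡 n) x} {x : M}
    (hs : ContMDiffAt (𝓡 n) ((𝓡 n).prod 𝓘(ℝ, E n →L[ℝ] ℝ)) ∞
      (fun x ↦ (⟨x, s x⟩ : Bundle.TotalSpace (E n →L[ℝ] ℝ) (Cotangent n M))) x)
    (hX : ContMDiffAt (𝓡 n) ((𝓡 n).prod 𝓘(ℝ, E n)) ∞
      (fun x ↦ (⟨x, X x⟩ : Bundle.TotalSpace (E n) (TangentSpace (𝓡 n) : M → Type _))) x) :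
    ContMDiffAt (𝓡 n) 𝓘(ℝ, ℝ) ∞ (fun z ↦ (s z (X z) : ℝ)) x := by
  have h := ContMDiffAt.clm_bundle_apply (b := fun z : M ↦ z) hs hX
  exact (Bundle.contMDiffAt_section (F := ℝ) (E := Bundle.Trivial M ℝ) _).1 h

/-- In trivializations `α ⊗ s` is the tensor product of the local expressions, a smooth operation on
pairs. The flat chart connections are sums of such terms. -/
theorem contMDiffAt_smulRight [IsManifold (𝓡 n) ∞ M] {α s : ∀ x : M, Cotangent n M x} {x : M}
    (hα : ContMDiffAt (𝓡 n) ((𝓡 n).prod 𝓘(ℝ, E n →L[ℝ] ℝ)) ∞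
      (fun x ↦ (⟨x, α x⟩ : Bundle.TotalSpace (E n →L[ℝ] ℝ) (Cotangent n M))) x)
    (hs : ContMDiffAt (𝓡 n) ((𝓡 n).prod 𝓘(ℝ, E n →L[ℝ] ℝ)) ∞
      (fun x ↦ (⟨x, s x⟩ : Bundle.TotalSpace (E n →L[ℝ] ℝ) (Cotangent n M))) x) :
    ContMDiffAt (𝓡 n) ((𝓡 n).prod 𝓘(ℝ, E n →L[ℝ] E n →L[ℝ] ℝ)) ∞
      (fun x ↦ (⟨x, ContinuousLinearMap.smulRight (α x) (s x)⟩ :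
        Bundle.TotalSpace (E n →L[ℝ] E n →L[ℝ] ℝ)
          (fun x : M ↦ TangentSpace (𝓡 n) x →L[ℝ] Cotangent n M x))) x := by
  rw [contMDiffAt_hom_bundle] at hα ⊢
  refine ⟨contMDiffAt_id, ?_⟩
  have h1 := hα.2
  have h2 := (Bundle.contMDiffAt_totalSpace.1 hs).2
  have h3 := (contDiff_fst.smulRight (n := ∞) (contDiff_snd (𝕜 := ℝ) (E := E n →L[ℝ] ℝ)
    (F := E n →L[ℝ] ℝ))).contMDiff.contMDiffAt.comp x (h1.prodMk_space h2)
  refine h3.congr_of_eventuallyEq ?_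
  filter_upwards [(trivializationAt (E n →L[ℝ] ℝ) (Cotangent n M) x).open_baseSet.mem_nhds
    (FiberBundle.mem_baseSet_trivializationAt' x)] with z hz
  ext v
  simp [ContinuousLinearMap.inCoordinates,
    Bundle.Trivialization.coe_linearMapAt_of_mem _ hz]

variable [IsManifold (𝓡 n) ∞ M]

/-- Multiplication by a bump function. The curvature equation and the smoothness of a connection
speak of global sections, while coordinate frames are only local; this passes between them. -/
theorem exists_contMDiff_section [T2Space M] {V : M → Type*} {G : Type*} [NormedAddCommGroup G] [NormedSpace ℝ G]
    [TopologicalSpace (Bundle.TotalSpace G V)] [∀ x, AddCommGroup (V x)] [∀ x, Module ℝ (V x)]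
    [∀ x, TopologicalSpace (V x)] [FiberBundle G V] [VectorBundle ℝ G V]
    {U : Set M} (hU : IsOpen U) {s : ∀ x : M, V x}
    (hs : ∀ x ∈ U, ContMDiffAt (𝓡 n) ((𝓡 n).prod 𝓘(ℝ, G)) ∞
      (fun x ↦ (⟨x, s x⟩ : Bundle.TotalSpace G V)) x) {x : M} (hx : x ∈ U) :
    ∃ t : ∀ x : M, V x, ContMDiff (𝓡 n) ((𝓡 n).prod 𝓘(ℝ, G)) ∞
      (fun x ↦ (⟨x, t x⟩ : Bundle.TotalSpace G V)) ∧ ∀ᶠ z in nhds x, t z = s z := by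
  obtain ⟨f, hf⟩ : ∃ f : SmoothBumpFunction (𝓡 n) x, tsupport f ⊆ U := by
    obtain ⟨f, -, hf⟩ := (SmoothBumpFunction.nhds_basis_tsupport (I := 𝓡 n) x).mem_iff.1
      (hU.mem_nhds hx)
    exact ⟨f, hf⟩
  refine ⟨(f : M → ℝ) • s, f.contMDiff.contMDiffOn.smul_section_of_tsupport hU hf
    fun z hz ↦ (hs z hz).contMDiffWithinAt, ?_⟩
  filter_upwards [f.eventuallyEq_one] with z hz
  simp [hz]

end Sections

/-! ### The Lie bracket as a commutator, through a chart -/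

section Bracket

variable {n : ℕ} {M : Type*} [TopologicalSpace M] [ChartedSpace (E n) M]

/-- The vector field `X` in the coordinates of the chart `φ`. -/
def localField (φ : Chart n M) (X : ∀ x : M, TangentSpace (𝓡 n) x) (z : E n) : E n :=
  VectorField.mpullback (𝓡 n) (𝓡 n) φ.1.symm X z

theorem mfderiv_localField (φ : Chart n M) (X : ∀ x : M, TangentSpace (𝓡 n) x) {z : E n}
    (hz : z ∈ φ.1.target) :
    mfderiv (𝓡 n) (𝓡 n) φ.1.symm z (localField φ X z) = X (φ.1.symm z) :=
  (show (mfderiv (𝓡 n) (𝓡 n) φ.1.symm z).IsInvertible from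
    ⟨φ.mdifferentiable.symm.mfderiv hz, rfl⟩).self_apply_inverse _

theorem mvfderiv_symm_apply (φ : Chart n M) {f : M → ℝ} {z : E n} (hz : z ∈ φ.1.target)
    (hf : MDifferentiableAt (𝓡 n) 𝓘(ℝ, ℝ) f (φ.1.symm z)) (X : ∀ x : M, TangentSpace (𝓡 n) x) :
    mvfderiv (𝓡 n) f (φ.1.symm z) (X (φ.1.symm z))
      = fderiv ℝ (fun z ↦ f (φ.1.symm z)) z (localField φ X z) := by
  have h := mfderiv_comp z hf (φ.mdifferentiable.mdifferentiableAt_symm hz)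
  rw [mfderiv_eq_fderiv] at h
  rw [← mfderiv_localField φ X hz, show (fun z ↦ f (φ.1.symm z)) = f ∘ φ.1.symm from rfl]
  exact (DFunLike.congr_fun h (localField φ X z)).symm

theorem contDiffAt_comp_symm (φ : Chart n M) {f : M → ℝ} {z : E n} (hz : z ∈ φ.1.target)
    (hf : ContMDiffAt (𝓡 n) 𝓘(ℝ, ℝ) ∞ f (φ.1.symm z)) :
    ContDiffAt ℝ ∞ (fun z ↦ f (φ.1.symm z)) z :=
  contMDiffAt_iff_contDiffAt.1 (hf.comp z (φ.contMDiffAt_symm hz))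

variable [IsManifold (𝓡 n) ∞ M]

theorem contDiffAt_localField (φ : Chart n M) {X : ∀ x : M, TangentSpace (𝓡 n) x} {z : E n}
    (hz : z ∈ φ.1.target)
    (hX : ContMDiffAt (𝓡 n) ((𝓡 n).prod 𝓘(ℝ, E n)) ∞
      (fun x ↦ (⟨x, X x⟩ : Bundle.TotalSpace (E n) (TangentSpace (𝓡 n) : M → Type _)))
      (φ.1.symm z)) :
    ContDiffAt ℝ ∞ (localField φ X) z := by
  refine contMDiffAt_vectorSpace_iff_contDiffAt.1
    (ContMDiffAt.mpullback_vectorField_preimage (n := ∞) (m := ∞) hX (φ.contMDiffAt_symm hz)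
    ⟨φ.mdifferentiable.symm.mfderiv hz, rfl⟩ (by simp))

theorem two_le_infty : (2 : WithTop ℕ∞) ≤ ∞ :=
  WithTop.coe_le_coe.2 le_top

/-- The Lie bracket as commutator of directional derivatives. -/
theorem mvfderiv_mlieBracket (φ : Chart n M) {h : M → ℝ} {X Y : ∀ x : M, TangentSpace (𝓡 n) x}
    (hh : ∀ x ∈ φ.1.source, ContMDiffAt (𝓡 n) 𝓘(ℝ, ℝ) ∞ h x)
    (hX : ∀ x ∈ φ.1.source, ContMDiffAt (𝓡 n) ((𝓡 n).prod 𝓘(ℝ, E n)) ∞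
      (fun x ↦ (⟨x, X x⟩ : Bundle.TotalSpace (E n) (TangentSpace (𝓡 n) : M → Type _))) x)
    (hY : ∀ x ∈ φ.1.source, ContMDiffAt (𝓡 n) ((𝓡 n).prod 𝓘(ℝ, E n)) ∞
      (fun x ↦ (⟨x, Y x⟩ : Bundle.TotalSpace (E n) (TangentSpace (𝓡 n) : M → Type _))) x)
    {x : M} (hx : x ∈ φ.1.source) :
    mvfderiv (𝓡 n) h x (VectorField.mlieBracket (𝓡 n) X Y x)
      = mvfderiv (𝓡 n) (fun z ↦ mvfderiv (𝓡 n) h z (Y z)) x (X x)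
        - mvfderiv (𝓡 n) (fun z ↦ mvfderiv (𝓡 n) h z (X z)) x (Y x) := by
  obtain ⟨y, hy, rfl⟩ : ∃ y ∈ φ.1.target, φ.1.symm y = x :=
    ⟨φ.1 x, φ.1.map_source hx, φ.1.left_inv hx⟩
  have hd := fun z (hz : z ∈ φ.1.target) ↦
    (hh _ (φ.1.map_target hz)).mdifferentiableAt (by simp)
  have hD := contDiffAt_comp_symm φ hy (hh _ hx)
  -- An iterated derivative is `D²h(X, Y) + Dh(DY(X))`; the first summand is symmetric and
  -- disappears in the commutator.
  have second : ∀ X Y : ∀ x : M, TangentSpace (𝓡 n) x,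
      (∀ x ∈ φ.1.source, ContMDiffAt (𝓡 n) ((𝓡 n).prod 𝓘(ℝ, E n)) ∞
        (fun x ↦ (⟨x, Y x⟩ : Bundle.TotalSpace (E n) (TangentSpace (𝓡 n) : M → Type _))) x) →
      mvfderiv (𝓡 n) (fun z ↦ mvfderiv (𝓡 n) h z (Y z)) (φ.1.symm y) (X (φ.1.symm y))
        = fderiv ℝ (fderiv ℝ (fun z ↦ h (φ.1.symm z))) y (localField φ X y) (localField φ Y y)
          + fderiv ℝ (fun z ↦ h (φ.1.symm z)) y
            (fderiv ℝ (localField φ Y) y (localField φ X y)) := by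
    intro X Y hY
    rw [mvfderiv_symm_apply φ hy ((contMDiffAt_apply (contMDiffAt_mvfderiv (hh _ hx))
      (hY _ hx)).mdifferentiableAt (by simp)) X]
    have he : (fun z ↦ mvfderiv (𝓡 n) h (φ.1.symm z) (Y (φ.1.symm z))) =ᶠ[nhds y]
        fun z ↦ fderiv ℝ (fun z ↦ h (φ.1.symm z)) z (localField φ Y z) := by
      filter_upwards [φ.1.open_target.mem_nhds hy] with z hz
      exact mvfderiv_symm_apply φ hz (hd z hz) Y
    rw [he.fderiv_eq, fderiv_clm_apply
      ((hD.fderiv_right (m := ∞) (by simp)).differentiableAt (by simp))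
      ((contDiffAt_localField φ hy (hY _ hx)).differentiableAt (by simp))]
    simp [add_comm]
  -- The bracket is natural under pullback, so it may be computed by the formula in `ℝⁿ`.
  have hb : localField φ (VectorField.mlieBracket (𝓡 n) X Y) y
      = fderiv ℝ (localField φ Y) y (localField φ X y)
        - fderiv ℝ (localField φ X) y (localField φ Y y) := by
    have : IsManifold (𝓡 n) (minSmoothness ℝ 2) M :=
      IsManifold.of_le (n := ∞) (by simpa using two_le_infty)
    have h1 := VectorField.mpullback_mlieBracket (n := ∞) (f := φ.1.symm) (x₀ := y)
      ((hX _ hx).mdifferentiableAt (by simp)) ((hY _ hx).mdifferentiableAt (by simp))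
      (φ.contMDiffAt_symm hy) (by simpa using two_le_infty)
    rw [← VectorField.mlieBracketWithin_univ (V := VectorField.mpullback _ _ _ X),
      VectorField.mlieBracketWithin_eq_lieBracketWithin] at h1
    exact h1.trans (congrFun (VectorField.lieBracketWithin_univ (V := localField φ X)
      (W := localField φ Y)) y)
  rw [second X Y hY, second Y X hX, mvfderiv_symm_apply φ hy (hd y hy), hb, map_sub,
    (hD.isSymmSndFDerivAt (by simpa using two_le_infty)).eq (localField φ X y) (localField φ Y y)]
  ring

end Bracket

/-! ### Connections on the cotangent bundle in coordinates -/

section Connection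

variable {n : ℕ} {M : Type*} [TopologicalSpace M] [ChartedSpace (E n) M]

/-- The components of the form `s` in the chart `φ`. -/
def component (φ : Chart n M) (s : ∀ x : M, Cotangent n M x) (k : Fin n) (x : M) : ℝ :=
  s x (coordField φ k x)

theorem eventually_eq_sum_coordForm (φ : Chart n M) (s : ∀ x : M, Cotangent n M x) {x : M}
    (hx : x ∈ φ.1.source) :
    ∀ᶠ z in nhds x, s z = (∑ k, component φ s k • coordForm φ k : ∀ x : M, Cotangent n M x) z := by
  filter_upwards [φ.1.open_source.mem_nhds hx] with z hz
  rw [eq_sum_coordForm φ hz (s z)]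
  exact (Finset.sum_apply z Finset.univ fun k ↦ component φ s k • coordForm φ k).symm

variable [IsManifold (𝓡 n) ∞ M]

/-- The vector field `X` is smooth at `x`. -/
abbrev SmoothFieldAt (X : ∀ x : M, TangentSpace (𝓡 n) x) (x : M) : Prop :=
  ContMDiffAt (𝓡 n) ((𝓡 n).prod 𝓘(ℝ, E n)) ∞
    (fun x ↦ (⟨x, X x⟩ : Bundle.TotalSpace (E n) (TangentSpace (𝓡 n) : M → Type _))) x

/-- The 1-form `s` is smooth at `x`. -/
abbrev SmoothFormAt (s : ∀ x : M, Cotangent n M x) (x : M) : Prop :=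
  ContMDiffAt (𝓡 n) ((𝓡 n).prod 𝓘(ℝ, E n →L[ℝ] ℝ)) ∞
    (fun x ↦ (⟨x, s x⟩ : Bundle.TotalSpace (E n →L[ℝ] ℝ) (Cotangent n M))) x

/-- The components `⟨∇_{∂_i} dqᵏ, ∂_j⟩` of a connection. -/
def christoffel (D : CovariantDerivative (𝓡 n) (E n →L[ℝ] ℝ) (Cotangent n M)) (φ : Chart n M)
    (i k j : Fin n) (x : M) : ℝ :=
  D (coordForm φ k) x (coordField φ i x) (coordField φ j x)

theorem contMDiffAt_component (φ : Chart n M) {s : ∀ x : M, Cotangent n M x} {x : M}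
    (hs : SmoothFormAt s x) (hx : x ∈ φ.1.source) (k : Fin n) :
    ContMDiffAt (𝓡 n) 𝓘(ℝ, ℝ) ∞ (component φ s k) x :=
  contMDiffAt_apply hs (contMDiffAt_coordField φ k hx)

variable {D : CovariantDerivative (𝓡 n) (E n →L[ℝ] ℝ) (Cotangent n M)}

theorem covariantDerivative_sum {ι : Type*} (S : Finset ι) {f : ι → M → ℝ}
    {s : ι → ∀ x : M, Cotangent n M x} {x : M}
    (hf : ∀ i ∈ S, ContMDiffAt (𝓡 n) 𝓘(ℝ, ℝ) ∞ (f i) x) (hs : ∀ i ∈ S, SmoothFormAt (s i) x) :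
    D (∑ i ∈ S, f i • s i) x = ∑ i ∈ S, (f i x • D (s i) x
      + ContinuousLinearMap.smulRight (mvfderiv (𝓡 n) (f i) x) (s i x)) := by
  classical
  induction S using Finset.induction_on with
  | empty => simp
  | insert a S ha ih =>
    have h1 := ih (fun i hi ↦ hf i (Finset.mem_insert_of_mem hi))
      fun i hi ↦ hs i (Finset.mem_insert_of_mem hi)
    have h2 := hf a (Finset.mem_insert_self a S)
    have h3 := hs a (Finset.mem_insert_self a S)
    have h4 : SmoothFormAt (∑ i ∈ S, f i • s i) x := by
      have h := ContMDiffAt.sum_section (n := ∞) (s := S) (t := fun i ↦ f i • s i) (x₀ := x)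
        (V := Cotangent n M) (F := E n →L[ℝ] ℝ) (I := 𝓡 n) fun i hi ↦
        (hf i (Finset.mem_insert_of_mem hi)).smul_section (hs i (Finset.mem_insert_of_mem hi))
      have e : (∑ i ∈ S, f i • s i) = fun x ↦ ∑ i ∈ S, (f i • s i) x := by
        ext1 x; exact Finset.sum_apply _ _ _
      rw [SmoothFormAt, e]
      exact h
    rw [Finset.sum_insert ha, Finset.sum_insert ha, ← h1,
      ← D.isCovariantDerivativeOnUniv.leibniz (h3.mdifferentiableAt (by simp))
        (h2.mdifferentiableAt (by simp))]
    exact D.isCovariantDerivativeOnUniv.add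
      ((h2.smul_section h3).mdifferentiableAt (by simp)) (h4.mdifferentiableAt (by simp))

/-- Connections are local, so a form may be replaced near `x` by its expansion in a coordinate frame
or by a global extension. -/
theorem covariantDerivative_congr {s t : ∀ x : M, Cotangent n M x} {x : M} (hs : SmoothFormAt s x)
    (h : ∀ᶠ z in nhds x, s z = t z) : D s x = D t x := by
  have ht : SmoothFormAt t x := hs.congr_of_eventuallyEq (by
    filter_upwards [h] with z hz
    rw [hz])
  exact D.isCovariantDerivativeOnUniv.congr_of_eventuallyEq (hs.mdifferentiableAt (by simp))
    (ht.mdifferentiableAt (by simp)) Filter.univ_mem h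

/-- Near `x` the form is `∑ s_k dqᵏ`; the Leibniz rule differentiates the components and leaves `∇
dqᵏ` to the Christoffel symbols. -/
theorem component_covariantDerivative (φ : Chart n M) {s : ∀ x : M, Cotangent n M x} {x : M}
    (hs : SmoothFormAt s x) (hx : x ∈ φ.1.source) (v : TangentSpace (𝓡 n) x) (j : Fin n) :
    D s x v (coordField φ j x) = mvfderiv (𝓡 n) (component φ s j) x v
      + ∑ k, ∑ l, component φ s k x * coordForm φ l x v * christoffel D φ l k j x := by
  rw [covariantDerivative_congr hs (eventually_eq_sum_coordForm φ s hx),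
    covariantDerivative_sum _ (fun k _ ↦ contMDiffAt_component φ hs hx k)
      fun k _ ↦ contMDiffAt_coordForm φ k hx, Finset.sum_add_distrib, add_comm]
  simp only [add_apply, sum_apply,
    ContinuousLinearMap.smulRight_apply, smul_apply,
    coordForm_coordField φ hx]
  congr 1
  · simp
  · refine Finset.sum_congr rfl fun k _ ↦ ?_
    conv_lhs => rw [eq_sum_coordField φ hx v]
    simp [christoffel, Finset.mul_sum, mul_assoc]

variable [T2Space M]

/-- Smoothness of `D` concerns global sections; a local one is first extended from a neighbourhood
of the point. -/
theorem contMDiffAt_covariantDerivative (hD : D.ContMDiffCovariantDerivative ∞) {U : Set M}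
    (hU : IsOpen U) {s : ∀ x : M, Cotangent n M x} (hs : ∀ x ∈ U, SmoothFormAt s x) {x : M}
    (hx : x ∈ U) :
    ContMDiffAt (𝓡 n) ((𝓡 n).prod 𝓘(ℝ, E n →L[ℝ] E n →L[ℝ] ℝ)) ∞
      (fun x ↦ (⟨x, D s x⟩ : Bundle.TotalSpace (E n →L[ℝ] E n →L[ℝ] ℝ)
          (fun x : M ↦ TangentSpace (𝓡 n) x →L[ℝ] Cotangent n M x))) x := by
  obtain ⟨t, ht, hts⟩ := exists_contMDiff_section hU hs hx
  have h := (hD.contMDiff.contMDiff (σ := t) (by simpa using ht.contMDiffOn)).contMDiffAt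
    (Filter.univ_mem (f := nhds x))
  refine h.congr_of_eventuallyEq ?_
  filter_upwards [hts.eventually_nhds, hU.mem_nhds hx] with z hz hzU
  rw [covariantDerivative_congr (hs z hzU) (hz.mono fun _ h ↦ h.symm)]

theorem smoothFormAt_covariantDerivative_apply (hD : D.ContMDiffCovariantDerivative ∞) {U : Set M}
    (hU : IsOpen U) {s : ∀ x : M, Cotangent n M x} (hs : ∀ x ∈ U, SmoothFormAt s x)
    {X : ∀ x : M, TangentSpace (𝓡 n) x} {x : M} (hx : x ∈ U) (hX : SmoothFieldAt X x) :
    SmoothFormAt (fun z ↦ D s z (X z)) x :=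
  ContMDiffAt.clm_bundle_apply (b := fun z : M ↦ z) (contMDiffAt_covariantDerivative hD hU hs hx) hX

theorem contMDiffAt_christoffel (hD : D.ContMDiffCovariantDerivative ∞) (φ : Chart n M)
    (i k j : Fin n) {x : M} (hx : x ∈ φ.1.source) :
    ContMDiffAt (𝓡 n) 𝓘(ℝ, ℝ) ∞ (christoffel D φ i k j) x :=
  contMDiffAt_apply (smoothFormAt_covariantDerivative_apply hD φ.1.open_source
    (fun _ hz ↦ contMDiffAt_coordForm φ k hz) hx (contMDiffAt_coordField φ i hx))
    (contMDiffAt_coordField φ j hx)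

end Connection

/-! ### Curvature in coordinates -/

section Curvature

variable {n : ℕ} {M : Type*} [TopologicalSpace M] [ChartedSpace (E n) M]
variable [IsManifold (𝓡 n) ∞ M]

/-- The part of the curvature component `⟨R(∂_i, ∂_l) dqᵏ, ∂_j⟩` that comes from `∇_{∂_i} ∇_{∂_l}`;
antisymmetrization in `i` and `l` gives the curvature. -/
def halfCurvature (D : CovariantDerivative (𝓡 n) (E n →L[ℝ] ℝ) (Cotangent n M)) (φ : Chart n M)
    (i l k j : Fin n) (x : M) : ℝ :=
  mvfderiv (𝓡 n) (christoffel D φ l k j) x (coordField φ i x)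
    + ∑ m, christoffel D φ l k m x * christoffel D φ i m j x

variable [T2Space M] {D : CovariantDerivative (𝓡 n) (E n →L[ℝ] ℝ) (Cotangent n M)}

/-- The terms are grouped by their fate under antisymmetrization in `X` and `Y`. Iterated
derivatives of `s_j` and derivatives of the components of `Y` will form the bracket terms, products
of first derivatives of `s` with components of `X` and `Y` are symmetric, and the last sum is
tensorial. -/
theorem component_covariantDerivative_twice (hD : D.ContMDiffCovariantDerivative ∞) (φ : Chart n M)
    {X Y : ∀ x : M, TangentSpace (𝓡 n) x} {s : ∀ x : M, Cotangent n M x}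
    (hY : ∀ x ∈ φ.1.source, SmoothFieldAt Y x)
    (hs : ∀ x ∈ φ.1.source, SmoothFormAt s x) {x : M} (hx : x ∈ φ.1.source) (j : Fin n) :
    D (fun z ↦ D s z (Y z)) x (X x) (coordField φ j x)
      = mvfderiv (𝓡 n) (fun z ↦ mvfderiv (𝓡 n) (component φ s j) z (Y z)) x (X x)
        + ∑ k, ∑ l, (mvfderiv (𝓡 n) (component φ s k) x (X x) * coordForm φ l x (Y x)
            + mvfderiv (𝓡 n) (component φ s k) x (Y x) * coordForm φ l x (X x)
            + component φ s k x * mvfderiv (𝓡 n) (fun z ↦ coordForm φ l z (Y z)) x (X x))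
              * christoffel D φ l k j x
        + ∑ i, ∑ l, ∑ k, coordForm φ i x (X x) * coordForm φ l x (Y x) * component φ s k x
            * halfCurvature D φ i l k j x := by
  have hs' := fun z (hz : z ∈ φ.1.source) ↦
    smoothFormAt_covariantDerivative_apply hD φ.1.open_source hs hz (hY z hz)
  have hc : ∀ (k : Fin n) (z : M), z ∈ φ.1.source → component φ (fun z ↦ D s z (Y z)) k z
      = mvfderiv (𝓡 n) (component φ s k) z (Y z)
        + ∑ m, ∑ r, component φ s m z * coordForm φ r z (Y z) * christoffel D φ r m k z :=
    fun k z hz ↦ component_covariantDerivative φ (hs z hz) hz (Y z) k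
  have d1 : ∀ k, MDifferentiableAt (𝓡 n) 𝓘(ℝ, ℝ) (component φ s k) x := fun k ↦
    (contMDiffAt_component φ (hs x hx) hx k).mdifferentiableAt (by simp)
  have d2 : ∀ l, MDifferentiableAt (𝓡 n) 𝓘(ℝ, ℝ) (fun z ↦ coordForm φ l z (Y z)) x := fun l ↦
    (contMDiffAt_apply (contMDiffAt_coordForm φ l hx) (hY x hx)).mdifferentiableAt (by simp)
  have d3 : ∀ i k j, MDifferentiableAt (𝓡 n) 𝓘(ℝ, ℝ) (christoffel D φ i k j) x := fun i k j ↦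
    (contMDiffAt_christoffel hD φ i k j hx).mdifferentiableAt (by simp)
  have d4 : MDifferentiableAt (𝓡 n) 𝓘(ℝ, ℝ)
      (fun z ↦ mvfderiv (𝓡 n) (component φ s j) z (Y z)) x :=
    (contMDiffAt_apply (contMDiffAt_mvfderiv (contMDiffAt_component φ (hs x hx) hx j))
      (hY x hx)).mdifferentiableAt (by simp)
  have d12 := fun k l ↦ (d1 k).mul (d2 l)
  have d123 := fun k l ↦ (d12 k l).mul (d3 l k j)
  have s1 := fun k ↦ mvfderiv_sum Finset.univ (fun l _ ↦ d123 k l)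
  have s2 := mvfderiv_sum Finset.univ (fun k _ ↦ (s1 k).1)
  have hX : ∀ l k, mvfderiv (𝓡 n) (christoffel D φ l k j) x (X x)
      = ∑ i, coordForm φ i x (X x) * mvfderiv (𝓡 n) (christoffel D φ l k j) x (coordField φ i x) :=
    fun l k ↦ by
      conv_lhs => rw [eq_sum_coordField φ hx (X x)]
      simp
  have e1 : mvfderiv (𝓡 n) (component φ (fun z ↦ D s z (Y z)) j) x (X x)
      = mvfderiv (𝓡 n) (fun z ↦ mvfderiv (𝓡 n) (component φ s j) z (Y z)) x (X x)
        + ∑ k, ∑ l, ((mvfderiv (𝓡 n) (component φ s k) x (X x) * coordForm φ l x (Y x)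
            + component φ s k x * mvfderiv (𝓡 n) (fun z ↦ coordForm φ l z (Y z)) x (X x))
              * christoffel D φ l k j x
            + component φ s k x * coordForm φ l x (Y x)
              * mvfderiv (𝓡 n) (christoffel D φ l k j) x (X x)) := by
    rw [mvfderiv_congr (Filter.eventuallyEq_of_mem (φ.1.open_source.mem_nhds hx) (hc j))]
    refine (DFunLike.congr_fun (mvfderiv_add d4 s2.1) (X x)).trans ?_
    rw [add_apply]
    congr 1
    refine (DFunLike.congr_fun s2.2 (X x)).trans ?_
    rw [sum_apply]
    refine Finset.sum_congr rfl fun k _ ↦ ?_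
    refine (DFunLike.congr_fun (s1 k).2 (X x)).trans ?_
    rw [sum_apply]
    refine Finset.sum_congr rfl fun l _ ↦ ?_
    refine (mvfderiv_mul_apply (d12 k l) (d3 l k j) (X x)).trans ?_
    congr 2
    exact mvfderiv_mul_apply (d1 k) (d2 l) (X x)
  rw [component_covariantDerivative φ (hs' x hx) hx (X x) j, e1]
  simp only [hc _ x hx, hX, halfCurvature]
  rw [add_assoc, add_assoc]
  congr 1
  simp only [mul_add, add_mul, Finset.sum_add_distrib, Finset.mul_sum, Finset.sum_mul]
  have r1 : ∑ k, ∑ l, ∑ i, component φ s k x * coordForm φ l x (Y x) * (coordForm φ i x (X x)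
        * mvfderiv (𝓡 n) (christoffel D φ l k j) x (coordField φ i x))
      = ∑ i, ∑ l, ∑ k, coordForm φ i x (X x) * coordForm φ l x (Y x) * component φ s k x
        * mvfderiv (𝓡 n) (christoffel D φ l k j) x (coordField φ i x) := by
    rw [Finset.sum_congr rfl fun k _ ↦ Finset.sum_comm, Finset.sum_comm]
    refine Finset.sum_congr rfl fun i _ ↦ ?_
    rw [Finset.sum_comm]
    refine Finset.sum_congr rfl fun l _ ↦ Finset.sum_congr rfl fun k _ ↦ ?_
    ring
  have r2 : ∑ m, ∑ i, ∑ k, ∑ l, component φ s k x * coordForm φ l x (Y x)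
        * christoffel D φ l k m x * coordForm φ i x (X x) * christoffel D φ i m j x
      = ∑ i, ∑ l, ∑ k, ∑ m, coordForm φ i x (X x) * coordForm φ l x (Y x) * component φ s k x
        * (christoffel D φ l k m x * christoffel D φ i m j x) := by
    rw [Finset.sum_comm]
    refine Finset.sum_congr rfl fun i _ ↦ ?_
    rw [Finset.sum_congr rfl fun m _ ↦ Finset.sum_comm, Finset.sum_comm]
    refine Finset.sum_congr rfl fun l _ ↦ ?_
    rw [Finset.sum_comm]
    refine Finset.sum_congr rfl fun k _ ↦ Finset.sum_congr rfl fun m _ ↦ ?_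
    ring
  rw [r1, r2]
  ring

/-- All derivatives of `X`, `Y` and `s` cancel against the bracket term, so only their values at `x`
remain. This is tensoriality of the curvature together with its coordinate formula. -/
theorem component_curvature (hD : D.ContMDiffCovariantDerivative ∞) (φ : Chart n M)
    {X Y : ∀ x : M, TangentSpace (𝓡 n) x} {s : ∀ x : M, Cotangent n M x}
    (hX : ∀ x ∈ φ.1.source, SmoothFieldAt X x) (hY : ∀ x ∈ φ.1.source, SmoothFieldAt Y x)
    (hs : ∀ x ∈ φ.1.source, SmoothFormAt s x) {x : M} (hx : x ∈ φ.1.source) (j : Fin n) :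
    (D (fun z ↦ D s z (Y z)) x (X x) - D (fun z ↦ D s z (X z)) x (Y x)
        - D s x (VectorField.mlieBracket (𝓡 n) X Y x)) (coordField φ j x)
      = ∑ i, ∑ l, ∑ k, coordForm φ i x (X x) * coordForm φ l x (Y x) * component φ s k x
        * (halfCurvature D φ i l k j x - halfCurvature D φ l i k j x) := by
  have b1 := mvfderiv_mlieBracket φ (fun z hz ↦ contMDiffAt_component φ (hs z hz) hz j) hX hY hx
  have b2 : ∀ l, coordForm φ l x (VectorField.mlieBracket (𝓡 n) X Y x)
      = mvfderiv (𝓡 n) (fun z ↦ coordForm φ l z (Y z)) x (X x)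
        - mvfderiv (𝓡 n) (fun z ↦ coordForm φ l z (X z)) x (Y x) := fun l ↦
    mvfderiv_mlieBracket φ (fun z hz ↦ φ.contMDiffAt_coord l hz) hX hY hx
  rw [sub_apply, sub_apply, component_covariantDerivative_twice hD φ hY hs hx,
    component_covariantDerivative_twice hD φ hX hs hx, component_covariantDerivative φ (hs x hx) hx,
    b1]
  simp only [b2, mul_sub]
  have r : ∑ i, ∑ l, ∑ k, coordForm φ i x (Y x) * coordForm φ l x (X x) * component φ s k x
        * halfCurvature D φ i l k j x
      = ∑ i, ∑ l, ∑ k, coordForm φ i x (X x) * coordForm φ l x (Y x) * component φ s k x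
        * halfCurvature D φ l i k j x := by
    rw [Finset.sum_comm]
    simp only [mul_comm (coordForm φ _ x (Y x))]
  rw [r]
  simp only [add_mul, sub_mul, Finset.sum_add_distrib, Finset.sum_sub_distrib]
  ring

end Curvature

/-! ### Coordinate expressions of `ω` and the transformation law of the Christoffel symbols -/

section Transformation

variable {n : ℕ} {M : Type*} [TopologicalSpace M] [ChartedSpace (E n) M]
variable [IsManifold (𝓡 n) ∞ M]

theorem connectionCoeff_eq (R : CoadjointRep n M) (φ : Chart n M) {y : E n} (hy : y ∈ φ.1.target)
    (i k j : Fin n) : connectionCoeff R φ y i k j = christoffel R.nabla φ i k j (φ.1.symm y) := by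
  rw [connectionCoeff, christoffel, coordField_symm φ hy, coordField_symm φ hy]

/-- `ω` is prescribed only through global fields, so the coordinate frame is extended from a
neighbourhood of the point. The value is insensitive to the extension because the curvature is
tensorial. -/
theorem omegaCoeff_eq [T2Space M] (R : CoadjointRep n M) (φ : Chart n M) {y : E n}
    (hy : y ∈ φ.1.target) (i l k j : Fin n) :
    omegaCoeff R φ y i l k j = halfCurvature R.nabla φ i l k j (φ.1.symm y)
      - halfCurvature R.nabla φ l i k j (φ.1.symm y) := by
  have hx := φ.1.map_target hy
  obtain ⟨X, hX, hX'⟩ := exists_contMDiff_section φ.1.open_source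
    (fun z hz ↦ contMDiffAt_coordField φ i hz) hx
  obtain ⟨Y, hY, hY'⟩ := exists_contMDiff_section φ.1.open_source
    (fun z hz ↦ contMDiffAt_coordField φ l hz) hx
  obtain ⟨s, hs, hs'⟩ := exists_contMDiff_section φ.1.open_source
    (fun z hz ↦ contMDiffAt_coordForm φ k hz) hx
  have h := DFunLike.congr_fun (R.curvature X Y s hX hY hs (φ.1.symm y))
    (coordField φ j (φ.1.symm y))
  rw [component_curvature R.smooth φ (fun z _ ↦ hX z) (fun z _ ↦ hY z) (fun z _ ↦ hs z) hx,
    hX'.self_of_nhds, hY'.self_of_nhds, hs'.self_of_nhds] at h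
  rw [omegaCoeff, ← coordField_symm φ hy, ← coordField_symm φ hy, ← coordField_symm φ hy, ← h]
  simp only [component, hs'.self_of_nhds, coordForm_coordField φ hx]
  simp

/-- Compute `⟨∇_{∂_l} dqᵏ, ∂'_a⟩` twice: by expanding `∂'_a` in the frame of `φ`, and by the
component formula in `ψ` for the form `dqᵏ`. The components of `dqᵏ` in `ψ` are Jacobian entries,
whose derivatives are the Hessian. -/
theorem sum_jacobian_mul_christoffel (D : CovariantDerivative (𝓡 n) (E n →L[ℝ] ℝ) (Cotangent n M))
    (φ ψ : Chart n M) {y : E n} (hy : y ∈ overlap φ ψ) (a l k : Fin n) :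
    ∑ i, jacobian ψ φ (coordChange φ ψ y) i a * christoffel D φ l k i (φ.1.symm y)
      = ∑ b, jacobian φ ψ y b l * (hessian ψ φ (coordChange φ ψ y) b a k
        + ∑ m, jacobian ψ φ (coordChange φ ψ y) k m * christoffel D ψ b m a (φ.1.symm y)) := by
  have hz := mapsTo_coordChange φ ψ hy
  have hx := φ.1.map_target hy.1
  have hsymm := symm_coordChange hy
  have hJ := fun b l ↦ coordForm_coordField_of_overlap φ ψ hy b l
  have hK := fun w (hw : w ∈ overlap ψ φ) b l ↦ coordForm_coordField_of_overlap ψ φ hw b l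
  have hKz := hK _ hz
  rw [hsymm] at hKz
  have h := component_covariantDerivative (D := D) ψ (contMDiffAt_coordForm φ k hx) hy.2
    (coordField φ l (φ.1.symm y)) a
  conv_lhs at h => rw [eq_sum_coordField φ hx (coordField ψ a (φ.1.symm y))]
  simp only [map_sum, map_smul, hKz, smul_eq_mul] at h
  refine h.trans ?_
  -- The inhomogeneous term: on the whole overlap the component equals a Jacobian entry, so its
  -- derivative is a second derivative of the coordinate change.
  have h2 : mvfderiv (𝓡 n) (component ψ (coordForm φ k) a) (φ.1.symm y)
      (coordField φ l (φ.1.symm y))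
      = ∑ b, jacobian φ ψ y b l * hessian ψ φ (coordChange φ ψ y) b a k := by
    rw [eq_sum_coordField ψ hy.2 (coordField φ l (φ.1.symm y)), map_sum]
    refine Finset.sum_congr rfl fun b _ ↦ ?_
    rw [map_smul, hJ, smul_eq_mul]
    congr 1
    have hd := (contMDiffAt_component ψ (contMDiffAt_coordForm φ k hx) hy.2 a).mdifferentiableAt
      (by simp)
    rw [← hsymm] at hd ⊢
    rw [mvfderiv_coordField ψ hz.1 hd]
    refine congrArg (fun L : E n →L[ℝ] ℝ ↦ L (EuclideanSpace.single b 1))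
      (Filter.EventuallyEq.fderiv_eq ?_)
    filter_upwards [(isOpen_overlap ψ φ).mem_nhds hz] with w hw
    exact hK w hw k a
  rw [h2]
  simp only [mul_add, Finset.sum_add_distrib, hJ, component, hKz, Finset.mul_sum]
  congr 1
  rw [Finset.sum_comm]
  refine Finset.sum_congr rfl fun b _ ↦ Finset.sum_congr rfl fun m _ ↦ ?_
  ring

end Transformation

/-! ### Existence of connections and of representations up to homotopy -/

section Existence

variable {n : ℕ} {M : Type*} [TopologicalSpace M] [ChartedSpace (E n) M]

/-- The flat connection on the domain of a chart. -/
def flatConnection (φ : Chart n M) (s : ∀ x : M, Cotangent n M x) (x : M) :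
    TangentSpace (𝓡 n) x →L[ℝ] Cotangent n M x :=
  ∑ j, ContinuousLinearMap.smulRight (mvfderiv (𝓡 n) (component φ s j) x) (coordForm φ j x)

variable [IsManifold (𝓡 n) ∞ M]

theorem isCovariantDerivativeOn_flatConnection (φ : Chart n M) :
    IsCovariantDerivativeOn (I := 𝓡 n) (E n →L[ℝ] ℝ) (V := Cotangent n M) (flatConnection φ)
      φ.1.source := by
  have hd : ∀ (s : ∀ x : M, Cotangent n M x) (j : Fin n) (x : M), x ∈ φ.1.source →
      MDifferentiableAt (𝓡 n) ((𝓡 n).prod 𝓘(ℝ, E n →L[ℝ] ℝ))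
        (fun x ↦ (⟨x, s x⟩ : Bundle.TotalSpace (E n →L[ℝ] ℝ) (Cotangent n M))) x →
      MDifferentiableAt (𝓡 n) 𝓘(ℝ, ℝ) (component φ s j) x := fun s j x hx hs ↦ by
    have h := MDifferentiableAt.clm_bundle_apply (b := fun z : M ↦ z) hs
      ((contMDiffAt_coordField φ j hx).mdifferentiableAt (by simp))
    exact (mdifferentiableAt_section (𝓡 n) (F := ℝ) (E := Bundle.Trivial M ℝ) _).1 h
  refine ⟨fun {s t x} hs ht hx ↦ ?_, fun {s g x} hs hg hx ↦ ?_⟩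
  · rw [flatConnection, flatConnection, flatConnection, ← Finset.sum_add_distrib]
    refine Finset.sum_congr rfl fun j _ ↦ ?_
    have h := mvfderiv_add (hd s j x hx hs) (hd t j x hx ht)
    have e : component φ (s + t) j = component φ s j + component φ t j := rfl
    rw [e, h]
    ext
    simp [add_mul]
  · have e : ∀ j, component φ (g • s) j = g * component φ s j := fun j ↦ rfl
    have h := fun j ↦ mvfderiv_mul hg (hd s j x hx hs)
    rw [flatConnection, flatConnection]
    simp only [e, h]
    conv_rhs => rw [eq_sum_coordForm φ hx (s x)]
    ext v w
    simp [component, add_mul, Finset.sum_add_distrib, Finset.mul_sum]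
    congr 1 <;> exact Finset.sum_congr rfl fun j _ ↦ by ring

theorem contMDiffAt_flatConnection (φ : Chart n M) {s : ∀ x : M, Cotangent n M x} {x : M}
    (hx : x ∈ φ.1.source) (hs : SmoothFormAt s x) :
    ContMDiffAt (𝓡 n) ((𝓡 n).prod 𝓘(ℝ, E n →L[ℝ] E n →L[ℝ] ℝ)) ∞
      (fun x ↦ (⟨x, flatConnection φ s x⟩ : Bundle.TotalSpace (E n →L[ℝ] E n →L[ℝ] ℝ)
          (fun x : M ↦ TangentSpace (𝓡 n) x →L[ℝ] Cotangent n M x))) x := by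
  exact ContMDiffAt.sum_section fun j _ ↦ contMDiffAt_smulRight
    (contMDiffAt_mvfderiv (contMDiffAt_component φ hs hx j)) (contMDiffAt_coordForm φ j hx)

/-- Connections are closed under convex combinations, so the flat connections of charts are averaged
with a partition of unity. -/
theorem exists_covariantDerivative [T2Space M] [SigmaCompactSpace M] :
    ∃ D : CovariantDerivative (𝓡 n) (E n →L[ℝ] ℝ) (Cotangent n M),
      D.ContMDiffCovariantDerivative ∞ := by
  obtain ⟨ρ, hρ⟩ := SmoothPartitionOfUnity.exists_isSubordinate_chartAt_source (𝓡 n) M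
  let φ : M → Chart n M := fun i ↦ ⟨chartAt (E n) i, IsManifold.chart_mem_maximalAtlas i⟩
  let D : (∀ x : M, Cotangent n M x) → ∀ x : M, TangentSpace (𝓡 n) x →L[ℝ] Cotangent n M x :=
    fun s x ↦ ∑ᶠ i, ρ i x • flatConnection (φ i) s x
  have hsum : ∀ s x, D s x = ∑ i ∈ ρ.finsupport x, ρ i x • flatConnection (φ i) s x := fun s x ↦
    (ρ.sum_finsupport_smul_eq_finsum (x₀ := x) fun i _ ↦ flatConnection (φ i) s x).symm
  have hval : ∀ s x v w, D s x v w = ∑ i ∈ ρ.finsupport x, ρ i x * flatConnection (φ i) s x v w :=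
    fun s x v w ↦ by
      rw [hsum, sum_apply, sum_apply]
      rfl
  -- `flatConnection` is meaningful only on the chart domain; elsewhere its weight vanishes.
  have hmem : ∀ x, ∀ i ∈ ρ.finsupport x, x ∈ (φ i).1.source := fun x i hi ↦
    hρ i (subset_tsupport _ ((ρ.mem_finsupport x).1 hi))
  have hD : IsCovariantDerivativeOn (I := 𝓡 n) (E n →L[ℝ] ℝ) (V := Cotangent n M) D := by
    refine ⟨fun {s t x} hs ht _ ↦ ?_, fun {s g x} hs hg _ ↦ ?_⟩
    · ext v w
      rw [add_apply, add_apply, hval, hval, hval, ← Finset.sum_add_distrib]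
      refine Finset.sum_congr rfl fun i hi ↦ ?_
      rw [(isCovariantDerivativeOn_flatConnection (φ i)).add hs ht (hmem x i hi), add_apply,
        add_apply, mul_add]
    · ext v w
      -- The weights must add up to 1 for the differential of `g` to appear exactly once in the
      -- Leibniz rule.
      have h1 : ∑ i ∈ ρ.finsupport x, ρ i x = 1 := ρ.sum_finsupport x (Set.mem_univ x)
      have h2 : (g x • D s x + ContinuousLinearMap.smulRight (mvfderiv (𝓡 n) g x) (s x)) v w
          = g x * D s x v w + (∑ i ∈ ρ.finsupport x, ρ i x) * (mvfderiv (𝓡 n) g x v * s x w) := by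
        rw [h1, one_mul]
        rfl
      rw [h2, hval, hval, Finset.mul_sum, Finset.sum_mul, ← Finset.sum_add_distrib]
      refine Finset.sum_congr rfl fun i hi ↦ ?_
      rw [(isCovariantDerivativeOn_flatConnection (φ i)).leibniz hs hg (hmem x i hi)]
      refine (mul_add (ρ i x) (g x * flatConnection (φ i) s x v w)
        (mvfderiv (𝓡 n) g x v * s x w)).trans ?_
      ring
  refine ⟨⟨D, hD⟩, ⟨⟨fun {s} hs ↦ ?_⟩⟩⟩
  have hs' : ∀ x, SmoothFormAt s x := fun x ↦ by
    simpa using hs.contMDiffAt (Filter.univ_mem (f := nhds x))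
  have h1 : ∀ i, ContMDiff (𝓡 n) ((𝓡 n).prod 𝓘(ℝ, E n →L[ℝ] E n →L[ℝ] ℝ)) ∞
      (fun x ↦ (⟨x, ρ i x • flatConnection (φ i) s x⟩ :
        Bundle.TotalSpace (E n →L[ℝ] E n →L[ℝ] ℝ)
          (fun x : M ↦ TangentSpace (𝓡 n) x →L[ℝ] Cotangent n M x))) := fun i ↦
    ContMDiffOn.smul_section_of_tsupport
      (V := fun x : M ↦ TangentSpace (𝓡 n) x →L[ℝ] Cotangent n M x)
      (F := E n →L[ℝ] E n →L[ℝ] ℝ) (s := flatConnection (φ i) s)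
      (ρ i).contMDiff.contMDiffOn (φ i).1.open_source (hρ i)
      fun x hx ↦ (contMDiffAt_flatConnection (φ i) hx (hs' x)).contMDiffWithinAt
  refine (ContMDiff.finsum_section_of_locallyFinite
    (V := fun x : M ↦ TangentSpace (𝓡 n) x →L[ℝ] Cotangent n M x)
    (F := E n →L[ℝ] E n →L[ℝ] ℝ) ?_ h1).contMDiffOn
  refine ρ.locallyFinite.subset fun i x hx h0 ↦ hx ?_
  ext v w
  exact (congrArg (· * flatConnection (φ i) s x v w) h0).trans (zero_mul _)

/-- `ω` is pure pointwise data, so at each `x` the curvature is written in the preferred chart at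
`x`. No comparison of charts is needed, since the curvature formula holds in every chart. -/
theorem nonempty_coadjointRep [T2Space M] [SigmaCompactSpace M] : Nonempty (CoadjointRep n M) := by
  obtain ⟨D, hD⟩ := exists_covariantDerivative (n := n) (M := M)
  let φ : M → Chart n M := fun i ↦ ⟨chartAt (E n) i, IsManifold.chart_mem_maximalAtlas i⟩
  let d : ∀ (x : M) (i : Fin n), TangentSpace (𝓡 n) x →ₗ[ℝ] ℝ := fun x i ↦
    (coordForm (φ x) i x).toLinearMap
  let e : ∀ (x : M) (k : Fin n), Cotangent n M x →ₗ[ℝ] ℝ := fun x k ↦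
    { toFun := fun α ↦ α (coordField (φ x) k x)
      map_add' := fun _ _ ↦ rfl
      map_smul' := fun _ _ ↦ rfl }
  refine ⟨⟨D, hD, fun x ↦ ∑ i, ∑ l, ∑ k, ∑ j, (d x i).smulRight ((d x l).smulRight
    ((e x k).smulRight ((halfCurvature D (φ x) i l k j x - halfCurvature D (φ x) l i k j x) •
      coordForm (φ x) j x))), fun X Y s hX hY hs x ↦ ?_⟩⟩
  have hx : x ∈ (φ x).1.source := mem_chart_source (E n) x
  rw [eq_sum_coordForm (φ x) hx (_ - _)]
  simp only [component_curvature hD (φ x) (fun z _ ↦ hX z) (fun z _ ↦ hY z) (fun z _ ↦ hs z) hx]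
  simp only [LinearMap.sum_apply, LinearMap.smulRight_apply, Finset.sum_smul, LinearMap.smul_apply]
  rw [Finset.sum_comm]
  refine Finset.sum_congr rfl fun i _ ↦ ?_
  rw [Finset.sum_comm]
  refine Finset.sum_congr rfl fun l _ ↦ ?_
  rw [Finset.sum_comm]
  refine Finset.sum_congr rfl fun k _ ↦ Finset.sum_congr rfl fun j _ ↦ ?_
  rw [smul_smul, smul_smul, smul_smul]
  simp only [mul_assoc]
  rfl

end Existence

/-! ### The local vector field of the semidirect product -/

section LocalSemidirect

variable {n : ℕ} {U : Set (E n)}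

theorem F.neg_smul (r : ℝ) (w : F n) : (-r) • w = -(r • w) := _root_.neg_smul r w

theorem F.sub_smul (r s : ℝ) (w : F n) : (r - s) • w = r • w - s • w := _root_.sub_smul r s w

theorem F.add_smul (r s : ℝ) (w : F n) : (r + s) • w = r • w + s • w := _root_.add_smul r s w

/-- The substitution `p a ↦ p a + ∑ b i, G b i a • ξ b * θ i` that fixes `ξ` and `θ`. -/
def shift (G : Fin n → Fin n → Fin n → ℝ) : F n →ₐ[ℝ] F n := glue 1 1 fun a b i ↦ G b i a

@[simp] theorem shift_xi (G : Fin n → Fin n → Fin n → ℝ) (a : Fin n) : shift G (xi a) = xi a := by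
  simp [shift, glue_xi, xiOf_eq_sum, Matrix.one_apply, ite_smul]

@[simp] theorem shift_theta (G : Fin n → Fin n → Fin n → ℝ) (a : Fin n) :
    shift G (theta a) = theta a := by
  simp [shift, glue_theta, thetaOf_eq_sum, Matrix.one_apply, ite_smul]

theorem shift_p (G : Fin n → Fin n → Fin n → ℝ) (a : Fin n) :
    shift G (p a) = p a + ∑ b, ∑ i, G b i a • (xi b * theta i) := by
  simp [shift, glue_p, glueP_eq_sum, Matrix.one_apply, ite_smul]

theorem shift_scale (G : Fin n → Fin n → Fin n → ℝ) (t : ℝ) (w : F n) :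
    shift G (scale t w) = scale t (shift G w) :=
  glue_scale _ _ _ _ _

/-- The correction terms `ξ θ` are fixed by every shift, so opposite shifts cancel. The isomorphism
of the theorem uses the shift by `-Γ`. -/
theorem shift_neg_comp_shift (G : Fin n → Fin n → Fin n → ℝ) :
    (shift (-G)).comp (shift G) = AlgHom.id ℝ (F n) := by
  refine algHom_eq_of_generators (by simp) (by simp) fun a ↦ ?_
  simp [shift_p, F.neg_smul, Finset.sum_neg_distrib]

/-- The substitution `shift` as an automorphism. -/
def shiftEquiv (G : Fin n → Fin n → Fin n → ℝ) : F n ≃ₐ[ℝ] F n :=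
  AlgEquiv.ofAlgHom (shift (-G)) (shift G) (shift_neg_comp_shift G)
    (by rw [← shift_neg_comp_shift (-G), neg_neg])

theorem isSmooth_shift {G : E n → Fin n → Fin n → Fin n → ℝ}
    (hG : ∀ i k j, ContDiffOn ℝ ∞ (fun y ↦ G y i k j) U) {f : U → F n} (hf : IsSmooth f) :
    IsSmooth fun y ↦ shift (G y) (f y) := by
  let P : (U → F n) → Prop := fun f ↦ IsSmooth fun y ↦ shift (G y) (f y)
  refine IsSmooth.induction (P := P) (fun c hc ↦ ?_) (fun i ↦ ?_) (fun i ↦ ?_) (fun i ↦ ?_)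
    (fun f g _ _ hf hg ↦ ?_) (fun f g _ _ hf hg ↦ ?_) hf
  · have e : (fun y : U ↦ shift (G y) (c y • 1)) = fun y : U ↦ c y • (1 : F n) := by simp
    exact (congrArg IsSmooth e).mpr (isSmooth_coef hc 1)
  · simpa only [P, shift_xi] using isSmooth_const (xi i)
  · simpa only [P, shift_theta] using isSmooth_const (theta i)
  · simp only [P, shift_p]
    exact (isSmooth_const (p i)).add (IsSmooth.sum _ fun b _ ↦ IsSmooth.sum _ fun k _ ↦
      isSmooth_coef (hG b k i) _)
  · have e : (fun y : U ↦ shift (G y) ((f + g) y))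
        = (fun y : U ↦ shift (G y) (f y)) + fun y : U ↦ shift (G y) (g y) := by
      ext1 y
      exact map_add _ _ _
    exact (congrArg IsSmooth e).mpr (IsSmooth.add hf hg)
  · have e : (fun y : U ↦ shift (G y) ((f * g) y))
        = (fun y : U ↦ shift (G y) (f y)) * fun y : U ↦ shift (G y) (g y) := by
      ext1 y
      exact map_mul _ _ _
    exact (congrArg IsSmooth e).mpr (IsSmooth.mul hf hg)

/-- The vector field of the semidirect product on a coordinate domain. -/
def semidirectField (G : E n → Fin n → Fin n → Fin n → ℝ)
    (W : E n → Fin n → Fin n → Fin n → Fin n → ℝ) : (U → F n) → U → F n :=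
  vectorField (fun y j ↦ p j - ∑ i, ∑ k, G y i k j • (xi i * theta k)) fun y j ↦
    -(∑ i, ∑ k, G y i k j • (xi i * p k))
      + (1 / 2 : ℝ) • ∑ i, ∑ l, ∑ k, W y i l k j • (xi i * xi l * theta k)

theorem theta_mul (i : Fin n) (w : F n) : theta i * w = scale (-1) w * theta i := by
  induction w using F.induction with
  | one => simp
  | xi j => simp [xi_mul_theta, F.neg_one_smul]
  | theta j =>
    have h : theta i * theta j = -(theta j * theta i) := by
      simp only [theta, thetaOf, Algebra.TensorProduct.tmul_mul_tmul, ← TensorProduct.neg_tmul]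
      rw [ι_mul_ι_swap]
    simp [h, F.neg_one_smul]
  | p j => simp [p_mul_comm]
  | smul r u h => simp [h]
  | mul u v hu hv => rw [← mul_assoc, hu, mul_assoc, hv, map_mul, mul_assoc]
  | add u v hu hv => rw [mul_add, hu, hv, map_add, add_mul]

variable {G : E n → Fin n → Fin n → Fin n → ℝ} {W : E n → Fin n → Fin n → Fin n → Fin n → ℝ}

/-- Parity of the coefficients: `p` and `ξ θ` are even, hence central, while `ξ p` and `ξ ξ θ` are
odd. -/
theorem isOddDerivation_semidirectField (hU : IsOpen U) :
    IsOddDerivation (semidirectField G W : (U → F n) → U → F n) := by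
  have h1 : ∀ (i k : Fin n) (w : F n), xi i * p k * w = scale (-1) w * (xi i * p k) :=
    fun i k w ↦ by rw [mul_assoc, p_mul_comm, ← mul_assoc, xi_mul, mul_assoc]
  have h2 : ∀ (i k : Fin n) (w : F n), xi i * theta k * w = w * (xi i * theta k) := fun i k w ↦ by
    rw [mul_assoc, theta_mul, ← mul_assoc, xi_mul, scale_neg_one_scale_neg_one, mul_assoc]
  have h3 : ∀ (i l k : Fin n) (w : F n),
      xi i * xi l * theta k * w = scale (-1) w * (xi i * xi l * theta k) := fun i l k w ↦ by
    rw [mul_assoc (xi i), mul_assoc (xi i), h2, ← mul_assoc, xi_mul, mul_assoc]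
  refine isOddDerivation_vectorField hU (fun y j w ↦ ?_) fun y j w ↦ ?_
  · simp only [sub_mul, mul_sub, Finset.sum_mul, Finset.mul_sum, F.smul_mul, F.mul_smul, h2,
      p_mul_comm]
  · simp only [add_mul, mul_add, F.neg_mul, F.mul_neg, Finset.sum_mul, Finset.mul_sum, F.smul_mul,
      F.mul_smul, h1, h3]

/-- The substitution `shift` turns the Courant vector field into that of the semidirect product. -/
theorem semidirectField_shift (hU : IsOpen U)
    (hG : ∀ i k j, ContDiffOn ℝ ∞ (fun y ↦ G y i k j) U) {K : E n → Fin n → Fin n → Fin n → Fin n → ℝ}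
    (hK : ∀ y ∈ U, ∀ i l k j, K y i l k j
      = fderiv ℝ (fun y ↦ G y l k j) y (EuclideanSpace.single i 1) + ∑ m, G y l k m * G y i m j)
    (hW : ∀ y ∈ U, ∀ i l k j, W y i l k j = K y i l k j - K y l i k j) {f : U → F n}
    (hf : IsSmooth f) (y : U) :
    semidirectField G W (fun y ↦ shift (-G y) (f y)) y = shift (-G y) (courantField f y) := by
  have hX : IsOddDerivation (semidirectField G W : (U → F n) → U → F n) :=
    isOddDerivation_semidirectField hU
  have hG' : ∀ i k j, ContDiffOn ℝ ∞ (fun y ↦ (-G y) i k j) U := fun i k j ↦ (hG i k j).neg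
  refine (hX.intertwine (isOddDerivation_courantField hU) id (fun y : U ↦ shift (-G y))
    (fun y w ↦ shift_scale _ _ _) (fun c hc ↦ ⟨isSmooth_coef hc 1, fun y ↦ ?_⟩)
    (fun j ↦ ⟨isSmooth_shift hG' (isSmooth_const _), fun y ↦ ?_⟩)
    (fun j ↦ ⟨isSmooth_shift hG' (isSmooth_const _), fun y ↦ ?_⟩)
    (fun j ↦ ⟨isSmooth_shift hG' (isSmooth_const _), fun y ↦ ?_⟩) hf).2 y
  · refine (vectorField_coef _ _ y hU hc).trans ?_
    rw [courantField, vectorField_coef _ _ _ hU hc]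
    simp
  · simp only [shift_xi]
    rw [courantField, vectorField_xi _ _ _ _ hU, map_zero]
    exact vectorField_xi _ _ _ _ hU
  -- Both sides equal `p_j - ∑ G ξ θ`: on the left as the prescribed value on `θ_j`, on the right as
  -- the shifted `p_j`.
  · simp only [shift_theta]
    rw [courantField, vectorField_theta _ _ _ _ hU, shift_p]
    refine (vectorField_theta _ _ _ _ hU).trans ?_
    simp [sub_eq_add_neg, F.neg_smul, Finset.sum_neg_distrib]
  -- Here the curvature enters. The Courant field kills `p_j`, so the semidirect field must kill
  -- `p_j - ∑ G ξ θ`.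
  · rw [courantField, vectorField_p _ _ _ _ hU, map_zero]
    have e : (fun y : U ↦ shift (-G y) (p j)) = (fun _ : U ↦ p j)
        + fun y : U ↦ ∑ a : Fin n × Fin n, -G y a.1 a.2 j • (xi a.1 * theta a.2) := by
      ext1 y
      simp [shift_p, Fintype.sum_prod_type]
    have ht : ∀ a : Fin n × Fin n, semidirectField G W (fun _ : U ↦ xi a.1 * theta a.2) y
        = -(xi a.1 * (p a.2 - ∑ i, ∑ k, G y i k a.2 • (xi i * theta k))) := fun a ↦ by
      refine (hX.mul (fun _ ↦ xi a.1) (fun _ ↦ theta a.2) (isSmooth_const _) (isSmooth_const _)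
        y).trans ?_
      have e1 : semidirectField G W (fun _ : U ↦ xi a.1) y = 0 := vectorField_xi _ _ _ _ hU
      have e2 : semidirectField G W (fun _ : U ↦ theta a.2) y = _ := vectorField_theta _ _ _ _ hU
      rw [e1, e2]
      simp [F.neg_one_smul]
    rw [e, hX.add _ _ (isSmooth_const _) (IsSmooth.sum _ fun a _ ↦
      isSmooth_coef (c := fun y ↦ -G y a.1 a.2 j) (hG a.1 a.2 j).neg _), Pi.add_apply]
    have e2 := vectorField_sum_coef hU hX (c := fun (a : Fin n × Fin n) y ↦ -G y a.1 a.2 j)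
      (fun a ↦ (hG a.1 a.2 j).neg) (fun a ↦ xi a.1 * theta a.2) y
    have e3 : semidirectField G W (fun _ : U ↦ p j) y = _ := vectorField_p _ _ _ _ hU
    -- Against the antisymmetric `ξ ξ`, both halves of `W` contribute equally; this accounts for the
    -- factor `1/2`.
    have half : (1 / 2 : ℝ) • ∑ i, ∑ l, ∑ k, W y i l k j • (xi i * xi l * theta k)
        = ∑ i, ∑ l, ∑ k, K y i l k j • (xi i * xi l * theta k) := by
      have e4 : ∑ i, ∑ l, ∑ k, K y l i k j • (xi i * xi l * theta k)
          = -∑ i, ∑ l, ∑ k, K y i l k j • (xi i * xi l * theta k) := by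
        rw [Finset.sum_comm]
        simp only [← Finset.sum_neg_distrib]
        refine Finset.sum_congr rfl fun i _ ↦ Finset.sum_congr rfl fun l _ ↦
          Finset.sum_congr rfl fun k _ ↦ ?_
        rw [xi_mul_xi l i, F.neg_mul, smul_neg]
      simp only [hW y y.2, F.sub_smul, Finset.sum_sub_distrib, e4]
      module
    have dneg : ∀ (a : Fin n × Fin n) (i : Fin n),
        fderiv ℝ (fun y ↦ -G y a.1 a.2 j) (y : E n) (EuclideanSpace.single i 1)
          = -fderiv ℝ (fun y ↦ G y a.1 a.2 j) (y : E n) (EuclideanSpace.single i 1) :=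
      fun a i ↦ by rw [fderiv_fun_neg]; rfl
    -- Differentiating the coefficient `G` gives the derivative part of `K`, and the value on `θ`
    -- gives its quadratic part along with the `ξ p` terms. The latter cancel those in the value on
    -- `p_j`.
    have e5 : semidirectField G W
        (fun y : U ↦ ∑ a : Fin n × Fin n, -G y a.1 a.2 j • (xi a.1 * theta a.2)) y
          = ∑ i, ∑ k, G y i k j • (xi i * p k)
            - ∑ i, ∑ l, ∑ k, K y i l k j • (xi i * xi l * theta k) := by
      refine e2.trans ?_
      simp only [semidirectField] at ht
      simp only [ht, dneg, hK y y.2, F.add_smul, Finset.sum_add_distrib, Fintype.sum_prod_type,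
        F.neg_smul, Finset.sum_neg_distrib, smul_neg, mul_sub, smul_sub,
        Finset.sum_sub_distrib]
      have r1 : ∑ b, ∑ k, ∑ i, fderiv ℝ (fun y ↦ G y b k j) (y : E n) (EuclideanSpace.single i 1)
            • (xi i * (xi b * theta k))
          = ∑ i, ∑ l, ∑ k, fderiv ℝ (fun y ↦ G y l k j) (y : E n) (EuclideanSpace.single i 1)
            • (xi i * xi l * theta k) := by
        rw [Finset.sum_congr rfl fun b _ ↦ Finset.sum_comm, Finset.sum_comm]
        simp only [mul_assoc]
      have r2 : ∑ i, ∑ m, G y i m j • (xi i * ∑ l, ∑ k, G y l k m • (xi l * theta k))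
          = ∑ i, ∑ l, ∑ k, (∑ m, G y l k m * G y i m j) • (xi i * xi l * theta k) := by
        simp only [Finset.mul_sum, Finset.smul_sum, F.mul_smul, smul_smul, Finset.sum_smul,
          mul_assoc]
        refine Finset.sum_congr rfl fun i _ ↦ ?_
        rw [Finset.sum_comm]
        refine Finset.sum_congr rfl fun l _ ↦ ?_
        rw [Finset.sum_comm]
        refine Finset.sum_congr rfl fun k _ ↦ Finset.sum_congr rfl fun m _ ↦ ?_
        rw [mul_comm (G y i m j)]
      rw [r1, r2]
      abel
    rw [e3, e5, half]
    abel

end LocalSemidirect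

/-! ### The two NQ manifolds -/

section Global

variable {n : ℕ} {M : Type*} [TopologicalSpace M] [ChartedSpace (E n) M]

/-- `f` is a smooth function, of mixed degree, on the graded manifold given by `T`. -/
structure IsCompatible (T : Transition n M) (f : Family n M) : Prop where
  smooth : ∀ φ, IsSmooth (f φ)
  transition : ∀ (φ ψ : Chart n M) (y : φ.1.target) (z : ψ.1.target),
    φ.1.symm y = ψ.1.symm z → f φ y = T φ ψ y z (f ψ z)

theorem mem_functions_iff {T : Transition n M} {k : ℕ} {f : Family n M} :
    f ∈ functions T k ↔ (∀ φ y, f φ y ∈ degree n k) ∧ IsCompatible T f :=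
  ⟨fun h ↦ ⟨h.1, h.2.1, h.2.2⟩, fun h ↦ ⟨h.1, h.2.1, h.2.2⟩⟩

theorem mem_functionRing_iff {T : Transition n M} {f : Family n M} :
    f ∈ functionRing T ↔ f ∈ ⨆ k, functions T k := Iff.rfl

theorem mem_functionRing_of_mem_functions {T : Transition n M} {k : ℕ} {f : Family n M}
    (hf : f ∈ functions T k) : f ∈ functionRing T :=
  Submodule.mem_iSup_of_mem k hf

theorem isCompatible_of_mem_functionRing {T : Transition n M} {f : Family n M}
    (hf : f ∈ functionRing T) : IsCompatible T f := by
  rw [mem_functionRing_iff] at hf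
  induction hf using Submodule.iSup_induction' with
  | mem k f hf => exact (mem_functions_iff.1 hf).2
  | zero => exact (mem_functions_iff.1 (zero_mem (functions T 0))).2
  | add f g _ _ hf hg =>
    exact ⟨fun φ ↦ (hf.smooth φ).add (hg.smooth φ), fun φ ψ y z h ↦ by
      simp [hf.transition φ ψ y z h, hg.transition φ ψ y z h]⟩

/-- Local odd derivations that are homogeneous of degree 1, have square zero and are compatible
with the changes of coordinates form a homological vector field. -/
theorem isHomologicalVectorField_of_local {T : Transition n M}
    {X : ∀ φ : Chart n M, (φ.1.target → F n) → φ.1.target → F n}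
    (hX : ∀ φ, IsOddDerivation (X φ))
    (hsmul : ∀ φ (r : ℝ) f, IsSmooth f → X φ (r • f) = r • X φ f)
    (hsmooth : ∀ φ f, IsSmooth f → IsSmooth (X φ f))
    (hscale : ∀ φ f, IsSmooth f → ∀ y, scale 2 (X φ f y) = (2 : ℝ) • X φ (fun y ↦ scale 2 (f y)) y)
    (hsq : ∀ φ f, IsSmooth f → X φ (X φ f) = 0)
    (htrans : ∀ f, IsCompatible T f → ∀ (φ ψ : Chart n M) (y : φ.1.target) (z : ψ.1.target),
      φ.1.symm y = ψ.1.symm z → X φ (f φ) y = T φ ψ y z (X ψ (f ψ) z)) :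
    IsHomologicalVectorField T fun f φ y ↦ X φ (f φ) y where
  map_mem k f hf := by
    obtain ⟨hd, hc⟩ := mem_functions_iff.1 hf
    refine ⟨fun φ y ↦ ?_, fun φ ↦ hsmooth φ _ (hc.smooth φ), htrans f hc⟩
    -- In the eigenvalue description of degrees, `f` contributes `2 ^ k` and the field one further
    -- factor 2.
    have e : (fun y ↦ scale 2 (f φ y)) = (2 : ℝ) ^ k • f φ := by
      ext1 y
      exact scale_of_mem_degree 2 (hd φ y)
    rw [mem_degree_iff, hscale φ _ (hc.smooth φ), e, hsmul φ _ _ (hc.smooth φ), Pi.smul_apply,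
      smul_smul, pow_succ']
  map_add f hf g hg := by
    ext φ y
    exact congrFun ((hX φ).add _ _ ((isCompatible_of_mem_functionRing hf).smooth φ)
      ((isCompatible_of_mem_functionRing hg).smooth φ)) y
  map_smul r f hf := by
    ext φ y
    exact congrFun (hsmul φ r _ ((isCompatible_of_mem_functionRing hf).smooth φ)) y
  leibniz k f hf g hg := by
    obtain ⟨hd, hc⟩ := mem_functions_iff.1 hf
    ext φ y
    refine ((hX φ).mul _ _ (hc.smooth φ)
      ((isCompatible_of_mem_functionRing hg).smooth φ) y).trans ?_
    -- On an element of degree `k` the parity involution is the sign `(-1) ^ k`.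
    rw [scale_of_mem_degree (-1) (hd φ y), F.smul_mul]
    rfl
  sq_eq_zero f hf := by
    ext φ y
    exact congrFun (hsq φ _ ((isCompatible_of_mem_functionRing hf).smooth φ)) y

theorem courantQ_eq (f : Family n M) (φ : Chart n M) (y : φ.1.target) :
    courantQ f φ y = courantField (f φ) y := by
  simp [courantQ, courantField, vectorField]

theorem mem_overlap {φ ψ : Chart n M} {y : E n} {z : E n} (hy : y ∈ φ.1.target)
    (hz : z ∈ ψ.1.target) (h : φ.1.symm y = ψ.1.symm z) : y ∈ overlap φ ψ :=
  ⟨hy, by simpa [h] using ψ.1.map_target hz⟩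

theorem coordChange_eq {φ ψ : Chart n M} {y : E n} {z : E n}
    (hz : z ∈ ψ.1.target) (h : φ.1.symm y = ψ.1.symm z) : coordChange φ ψ y = z := by
  rw [coordChange, h, ψ.1.right_inv hz]

/-- Restricted to the overlap, the gluing condition says that `f φ` is the pullback of `f ψ` along
the coordinate change, so covariance of the local field applies. -/
theorem courantField_transition {f : Family n M} (hf : IsCompatible courantTransition f)
    (φ ψ : Chart n M) (y : φ.1.target) (z : ψ.1.target) (h : φ.1.symm y = ψ.1.symm z) :
    courantField (f φ) y = courantTransition φ ψ y z (courantField (f ψ) z) := by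
  have hW := isOpen_overlap φ ψ
  have hy := mem_overlap y.2 z.2 h
  have hsub : overlap φ ψ ⊆ φ.1.target := Set.inter_subset_left
  have hmaps : Set.MapsTo (coordChange φ ψ) (overlap φ ψ) ψ.1.target := fun w hw ↦
    (mapsTo_coordChange φ ψ hw).1
  let g : overlap φ ψ → F n := fun w ↦ f φ ⟨w, hsub w.2⟩
  have hg : g = fun w : overlap φ ψ ↦ glue (jac (coordChange φ ψ) w)
      (jac (coordChange ψ φ) (coordChange φ ψ w)).transpose
      (hess (coordChange ψ φ) (coordChange φ ψ w)) (f ψ ⟨coordChange φ ψ w, hmaps w.2⟩) := by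
    ext1 w
    exact hf.transition φ ψ ⟨w, hsub w.2⟩ ⟨coordChange φ ψ w, hmaps w.2⟩
      (symm_coordChange w.2).symm
  -- The field only involves derivatives at a point, so restriction to the overlap does not change
  -- its value.
  have h1 : courantField g ⟨y, hy⟩ = courantField (f φ) y := by
    have hq := fun i ↦ dq_restrict φ.1.open_target hW hsub (hf.smooth φ) (h := g) (fun _ ↦ rfl) i
      ⟨y, hy⟩
    simp only [courantField, vectorField, hq]
    rfl
  have hz : (⟨coordChange φ ψ y, hmaps hy⟩ : ψ.1.target) = z :=
    Subtype.ext (coordChange_eq z.2 h)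
  rw [← h1, hg, courantField_glue hW ψ.1.open_target (isOpen_overlap ψ φ)
    (contDiffOn_coordChange φ ψ) (contDiffOn_coordChange ψ φ) hmaps (mapsTo_coordChange φ ψ)
    (hf.smooth ψ) ⟨y, hy⟩]
  simp only [coordChange_eq z.2 h]
  rfl

theorem vectorField_smul {U : Set (E n)} (hU : IsOpen U) (A B : U → Fin n → F n) (r : ℝ)
    {f : U → F n} (hf : IsSmooth f) : vectorField A B (r • f) = r • vectorField A B f := by
  ext1 y
  have e : ∀ i, dq i (r • f) y = r • dq i f y := fun i ↦ dq_map hU hf (r • LinearMap.id) i y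
  simp only [vectorField, e, Pi.smul_apply, map_smul, F.mul_smul, ← Finset.smul_sum, smul_add]

theorem isHomologicalVectorField_courantQ :
    IsHomologicalVectorField (courantTransition (n := n) (M := M)) courantQ := by
  have e : (courantQ : Family n M → Family n M) = fun f φ y ↦ courantField (f φ) y := by
    ext f φ y
    exact courantQ_eq f φ y
  rw [e]
  exact isHomologicalVectorField_of_local (X := fun φ ↦ courantField)
    (fun φ ↦ isOddDerivation_courantField φ.1.open_target)
    (fun φ r f hf ↦ vectorField_smul φ.1.open_target _ _ r hf)
    (fun φ f hf ↦ isSmooth_courantField φ.1.open_target hf)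
    (fun φ f hf y ↦ scale_courantField φ.1.open_target 2 hf y)
    (fun φ f hf ↦ courantField_courantField φ.1.open_target hf)
    fun f hf ↦ courantField_transition hf

/-! ### The isomorphism defined by a connection -/

variable [IsManifold (𝓡 n) ∞ M] (R : CoadjointRep n M)

theorem semidirectQ_eq (f : Family n M) (φ : Chart n M) (y : φ.1.target) :
    semidirectQ R f φ y
      = semidirectField (connectionCoeff R φ) (omegaCoeff R φ) (f φ) y := rfl

/-- The shift removes the inhomogeneous part of the gluing. The two transition rules agree on `ξ`
and `θ`; on `p` the Hessian cancels against the inhomogeneous term in the law of the Christoffel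
symbols. -/
theorem shift_courantTransition (φ ψ : Chart n M) (y : φ.1.target) (z : ψ.1.target)
    (h : φ.1.symm y = ψ.1.symm z) (w : F n) :
    shift (-connectionCoeff R φ y) (courantTransition φ ψ y z w)
      = splitTransition φ ψ y z (shift (-connectionCoeff R ψ z) w) := by
  suffices e : (shift (-connectionCoeff R φ y)).comp (courantTransition φ ψ y z)
      = (splitTransition φ ψ y z).comp (shift (-connectionCoeff R ψ z)) from
    DFunLike.congr_fun e w
  refine algHom_eq_of_generators (fun a ↦ ?_) (fun a ↦ ?_) fun a ↦ ?_
  · simp [courantTransition, splitTransition, glue_xi, xiOf_eq_sum]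
  · simp [courantTransition, splitTransition, glue_theta, thetaOf_eq_sum]
  · have hy := mem_overlap y.2 z.2 h
    -- The comparison of the coefficients of `ξˡ θ_k`; symmetry of the Hessian reconciles the index
    -- orders of the two laws.
    have key : ∀ l k, ∑ b, hessian ψ φ z a b k * jacobian φ ψ y b l
          - ∑ i, jacobian ψ φ z i a * connectionCoeff R φ y l k i
        = -∑ b, ∑ m, connectionCoeff R ψ z b m a * (jacobian φ ψ y b l * jacobian ψ φ z k m) := by
      intro l k
      have hk := sum_jacobian_mul_christoffel R.nabla φ ψ hy a l k
      have hs : ∀ b, hessian ψ φ z b a k = hessian ψ φ z a b k := fun b ↦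
        hess_symm (isOpen_overlap ψ φ) (contDiffOn_coordChange ψ φ)
          (mem_overlap z.2 y.2 h.symm) b a k
      rw [coordChange_eq z.2 h, h] at hk
      simp only [connectionCoeff_eq R φ y.2, connectionCoeff_eq R ψ z.2, h]
      rw [hk]
      simp only [hs, mul_add, Finset.sum_add_distrib, Finset.mul_sum]
      rw [← sub_sub, ← Finset.sum_sub_distrib]
      simp only [mul_comm (jacobian φ ψ y _ l) (hessian _ _ _ _ _ _), sub_self,
        Finset.sum_const_zero, zero_sub]
      exact congrArg _ (Finset.sum_congr rfl fun b _ ↦ Finset.sum_congr rfl fun m _ ↦ by ring)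
    have e1 : shift (-connectionCoeff R φ y) (courantTransition φ ψ y z (p a))
        = ∑ i, jacobian ψ φ z i a • p i + ∑ l, ∑ k, (∑ b, hessian ψ φ z a b k * jacobian φ ψ y b l
          - ∑ i, jacobian ψ φ z i a * connectionCoeff R φ y l k i) • (xi l * theta k) := by
      simp only [courantTransition, glue_p, glueP_eq_sum, map_add, map_sum, map_smul, map_mul,
        shift_xi, shift_theta, shift_p, smul_add, Finset.sum_add_distrib, Matrix.transpose_apply,
        add_assoc]
      congr 1
      simp only [F.sub_smul, Finset.sum_sub_distrib, Finset.sum_smul, Finset.smul_sum, smul_smul,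
        Pi.neg_apply, F.neg_smul, Finset.sum_neg_distrib, smul_neg]
      rw [neg_add_eq_sub]
      congr 1
      rw [Finset.sum_comm]
      refine Finset.sum_congr rfl fun l _ ↦ ?_
      rw [Finset.sum_comm]
    have e2 : splitTransition φ ψ y z (shift (-connectionCoeff R ψ z) (p a))
        = ∑ i, jacobian ψ φ z i a • p i + ∑ l, ∑ k, (-∑ b, ∑ m, connectionCoeff R ψ z b m a
          * (jacobian φ ψ y b l * jacobian ψ φ z k m)) • (xi l * theta k) := by
      simp only [splitTransition, shift_p, map_add, map_sum, map_smul, map_mul, glue_p,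
        glueP_eq_sum, glue_xi, glue_theta, xiOf_eq_sum, thetaOf_eq_sum, Matrix.transpose_apply,
        Pi.zero_apply, zero_mul, Finset.sum_const_zero, zero_smul, add_zero]
      congr 1
      simp only [Finset.sum_mul, Finset.mul_sum, Finset.smul_sum, F.smul_mul, F.mul_smul,
        smul_smul, Pi.neg_apply, F.neg_smul, neg_mul, Finset.sum_smul, Finset.sum_neg_distrib]
      refine congrArg _ ?_
      calc _ = ∑ b, ∑ m, ∑ l, ∑ k, (connectionCoeff R ψ z b m a
            * (jacobian φ ψ y b l * jacobian ψ φ z k m)) • (xi l * theta k) := by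
            refine Finset.sum_congr rfl fun b _ ↦ Finset.sum_congr rfl fun m _ ↦ ?_
            rw [Finset.sum_comm]
            simp only [mul_comm (jacobian ψ φ z _ m)]
        _ = ∑ l, ∑ b, ∑ m, ∑ k, (connectionCoeff R ψ z b m a
            * (jacobian φ ψ y b l * jacobian ψ φ z k m)) • (xi l * theta k) := by
            conv_rhs => rw [Finset.sum_comm]
            refine Finset.sum_congr rfl fun b _ ↦ ?_
            rw [Finset.sum_comm]
        _ = _ := by
            refine Finset.sum_congr rfl fun l _ ↦ ?_
            conv_rhs => rw [Finset.sum_comm]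
            refine Finset.sum_congr rfl fun b _ ↦ ?_
            rw [Finset.sum_comm]
    rw [AlgHom.comp_apply, AlgHom.comp_apply, e1, e2]
    simp only [key]

/-- The isomorphism, given by the connection, of families of local functions. -/
def familyEquiv : Family n M ≃ₐ[ℝ] Family n M :=
  AlgEquiv.piCongrRight fun φ ↦ AlgEquiv.piCongrRight fun y ↦ shiftEquiv (connectionCoeff R φ y)

theorem familyEquiv_apply (f : Family n M) (φ : Chart n M) (y : φ.1.target) :
    familyEquiv R f φ y = shift (-connectionCoeff R φ y) (f φ y) := rfl

theorem familyEquiv_symm_apply (f : Family n M) (φ : Chart n M) (y : φ.1.target) :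
    (familyEquiv R).symm f φ y = shift (connectionCoeff R φ y) (f φ y) := rfl

variable [T2Space M]

theorem contDiffOn_connectionCoeff (φ : Chart n M) (i k j : Fin n) :
    ContDiffOn ℝ ∞ (fun y ↦ connectionCoeff R φ y i k j) φ.1.target := by
  refine ContDiffOn.congr (f := fun y ↦ christoffel R.nabla φ i k j (φ.1.symm y))
    (fun y hy ↦ ?_) fun y hy ↦ connectionCoeff_eq R φ hy i k j
  exact (contDiffAt_comp_symm φ hy
    (contMDiffAt_christoffel R.smooth φ i k j (φ.1.map_target hy))).contDiffWithinAt

theorem halfCurvature_eq (φ : Chart n M) {y : E n} (hy : y ∈ φ.1.target) (i l k j : Fin n) :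
    halfCurvature R.nabla φ i l k j (φ.1.symm y)
      = fderiv ℝ (fun y ↦ connectionCoeff R φ y l k j) y (EuclideanSpace.single i 1)
        + ∑ m, connectionCoeff R φ y l k m * connectionCoeff R φ y i m j := by
  have e : (fun y ↦ connectionCoeff R φ y l k j)
      =ᶠ[nhds y] fun y ↦ christoffel R.nabla φ l k j (φ.1.symm y) :=
    Filter.eventuallyEq_of_mem (φ.1.open_target.mem_nhds hy)
      fun z hz ↦ connectionCoeff_eq R φ hz l k j
  rw [halfCurvature, e.fderiv_eq, mvfderiv_coordField φ hy
    ((contMDiffAt_christoffel R.smooth φ l k j (φ.1.map_target hy)).mdifferentiableAt (by simp))]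
  simp only [connectionCoeff_eq R φ hy]

theorem semidirectField_shift_connectionCoeff (φ : Chart n M) {f : φ.1.target → F n}
    (hf : IsSmooth f) (y : φ.1.target) :
    semidirectField (connectionCoeff R φ) (omegaCoeff R φ)
        (fun y ↦ shift (-connectionCoeff R φ y) (f y)) y
      = shift (-connectionCoeff R φ y) (courantField f y) :=
  semidirectField_shift φ.1.open_target (contDiffOn_connectionCoeff R φ)
    (K := fun y i l k j ↦ halfCurvature R.nabla φ i l k j (φ.1.symm y))
    (fun _ hy ↦ halfCurvature_eq R φ hy) (fun _ hy ↦ omegaCoeff_eq R φ hy) hf y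

theorem isCompatible_familyEquiv {f : Family n M} :
    IsCompatible splitTransition (familyEquiv R f) ↔ IsCompatible courantTransition f := by
  have hG := contDiffOn_connectionCoeff R
  refine ⟨fun hf ↦ ⟨fun φ ↦ ?_, fun φ ψ y z h ↦ ?_⟩, fun hf ↦ ⟨fun φ ↦ ?_, fun φ ψ y z h ↦ ?_⟩⟩
  · have h := isSmooth_shift (hG φ) (hf.smooth φ)
    have e : (fun y : φ.1.target ↦ shift (connectionCoeff R φ y) (familyEquiv R f φ y)) = f φ :=
      congrFun ((familyEquiv R).symm_apply_apply f) φ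
    rwa [e] at h
  -- After an injective shift over `φ`, the Courant gluing condition becomes the split one.
  · refine (shiftEquiv (connectionCoeff R φ y)).injective ?_
    exact (hf.transition φ ψ y z h).trans (shift_courantTransition R φ ψ y z h _).symm
  · exact isSmooth_shift (fun i k j ↦ (hG φ i k j).neg) (hf.smooth φ)
  · rw [familyEquiv_apply, familyEquiv_apply, hf.transition φ ψ y z h,
      shift_courantTransition R φ ψ y z h]

theorem familyEquiv_mem_functions {f : Family n M} {k : ℕ} :
    familyEquiv R f ∈ functions splitTransition k ↔ f ∈ functions courantTransition k := by
  rw [mem_functions_iff, mem_functions_iff, isCompatible_familyEquiv]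
  refine and_congr_left fun _ ↦ ⟨fun h φ y ↦ ?_, fun h φ y ↦ glue_mem_degree (h φ y)⟩
  have e := congrFun (congrFun ((familyEquiv R).symm_apply_apply f) φ) y
  rw [familyEquiv_symm_apply] at e
  exact e ▸ glue_mem_degree (h φ y)

theorem semidirectQ_familyEquiv {f : Family n M} (hf : IsCompatible courantTransition f) :
    semidirectQ R (familyEquiv R f) = familyEquiv R (courantQ f) := by
  ext φ y
  rw [semidirectQ_eq, familyEquiv_apply, courantQ_eq]
  exact semidirectField_shift_connectionCoeff R φ (hf.smooth φ) y

theorem map_functionRing :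
    (functionRing courantTransition).map (familyEquiv R).toAlgHom
      = functionRing (splitTransition (n := n) (M := M)) := by
  have h : ∀ k, (functions courantTransition k).map (familyEquiv R).toLinearMap
      = functions (splitTransition (n := n) (M := M)) k := fun k ↦ by
    ext f
    refine ⟨?_, fun hf ↦ ⟨(familyEquiv R).symm f, ?_, (familyEquiv R).apply_symm_apply f⟩⟩
    · rintro ⟨g, hg, rfl⟩
      exact (familyEquiv_mem_functions R).2 hg
    · rw [SetLike.mem_coe, ← familyEquiv_mem_functions R, (familyEquiv R).apply_symm_apply]
      exact hf
  have h2 := Submodule.map_iSup (familyEquiv R).toLinearMap fun k ↦ functions courantTransition k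
  simp only [h] at h2
  ext f
  exact SetLike.ext_iff.1 h2 f

/-- On functions, `D̃` is conjugate to `Q` by an algebra isomorphism that matches the graded pieces,
so every property is inherited from `Q`. In particular `D̃² = 0` is not computed directly. -/
theorem isHomologicalVectorField_semidirectQ :
    IsHomologicalVectorField (splitTransition (n := n) (M := M)) (semidirectQ R) := by
  have e : ∀ f ∈ functionRing (splitTransition (n := n) (M := M)),
      ∃ g ∈ functionRing (courantTransition (n := n) (M := M)), familyEquiv R g = f := fun f hf ↦ by
    rw [← map_functionRing R] at hf
    exact hf
  have hQ := isHomologicalVectorField_courantQ (n := n) (M := M)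
  have hc : ∀ g ∈ functionRing (courantTransition (n := n) (M := M)),
      semidirectQ R (familyEquiv R g) = familyEquiv R (courantQ g) := fun g hg ↦
    semidirectQ_familyEquiv R (isCompatible_of_mem_functionRing hg)
  -- The conjugation identity holds only on the function ring, and for `D̃²` it must be applied
  -- again to `Q g`.
  have hmem : ∀ g ∈ functionRing (courantTransition (n := n) (M := M)),
      courantQ g ∈ functionRing (courantTransition (n := n) (M := M)) := fun g hg ↦ by
    rw [mem_functionRing_iff] at hg
    induction hg using Submodule.iSup_induction' with
    | mem k g hg => exact mem_functionRing_of_mem_functions (hQ.map_mem k g hg)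
    | zero => exact mem_functionRing_of_mem_functions (hQ.map_mem 0 0 (zero_mem _))
    | add f g hf hg hf' hg' =>
      rw [hQ.map_add f (mem_functionRing_iff.2 hf) g (mem_functionRing_iff.2 hg)]
      exact add_mem hf' hg'
  have hk : ∀ k, ∀ f ∈ functions (splitTransition (n := n) (M := M)) k,
      ∃ g ∈ functions (courantTransition (n := n) (M := M)) k, familyEquiv R g = f := fun k f hf ↦
    ⟨(familyEquiv R).symm f, by
      rwa [← familyEquiv_mem_functions R, (familyEquiv R).apply_symm_apply],
      (familyEquiv R).apply_symm_apply f⟩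
  refine ⟨fun k f hf ↦ ?_, fun f hf g hg ↦ ?_, fun r f hf ↦ ?_, fun k f hf g hg ↦ ?_, fun f hf ↦ ?_⟩
  · obtain ⟨f', hf', rfl⟩ := hk k f hf
    rw [hc f' (mem_functionRing_of_mem_functions hf'), familyEquiv_mem_functions]
    exact hQ.map_mem k f' hf'
  · obtain ⟨f', hf', rfl⟩ := e f hf
    obtain ⟨g', hg', rfl⟩ := e g hg
    rw [← map_add, hc _ (add_mem hf' hg'), hc f' hf', hc g' hg', hQ.map_add f' hf' g' hg', map_add]
  · obtain ⟨f', hf', rfl⟩ := e f hf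
    rw [← map_smul, hc _ (Subalgebra.smul_mem _ hf' r), hc f' hf', hQ.map_smul r f' hf', map_smul]
  · obtain ⟨f', hf', rfl⟩ := hk k f hf
    obtain ⟨g', hg', rfl⟩ := e g hg
    have hf'' := mem_functionRing_of_mem_functions hf'
    rw [← map_mul, hc _ (mul_mem hf'' hg'), hc f' hf'', hc g' hg', hQ.leibniz k f' hf' g' hg',
      map_add, map_smul, map_mul, map_mul]
  · obtain ⟨f', hf', rfl⟩ := e f hf
    rw [hc f' hf', hc _ (hmem f' hf'), hQ.sq_eq_zero f' hf', map_zero]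

/-- The isomorphism of the standard Courant algebroid with the semidirect product. -/
def functionRingEquiv : functionRing (courantTransition (n := n) (M := M)) ≃ₐ[ℝ]
    functionRing (splitTransition (n := n) (M := M)) :=
  ((familyEquiv R).subalgebraMap _).trans (Subalgebra.equivOfEq _ _ (map_functionRing R))

theorem coe_functionRingEquiv (f : functionRing (courantTransition (n := n) (M := M))) :
    (functionRingEquiv R f : Family n M) = familyEquiv R f := rfl

theorem isNQIso_functionRingEquiv :
    IsNQIso courantQ (semidirectQ R) (functionRingEquiv R) where
  degree k f := (familyEquiv_mem_functions R).symm
  base f hf := by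
    ext φ y
    -- A function of degree 0 has scalar values, and shifts fix scalars.
    obtain ⟨r, hr⟩ := mem_degree_zero_iff.1 ((mem_functions_iff.1 hf).1 φ y)
    rw [coe_functionRingEquiv, familyEquiv_apply, hr, map_smul, map_one]
  intertwine f g h := by
    rw [coe_functionRingEquiv, h, coe_functionRingEquiv,
      semidirectQ_familyEquiv R (isCompatible_of_mem_functionRing f.2)]

end Global

end CourantNQ

end

theorem mainTheorem6 (n : ℕ) (M : Type*) [TopologicalSpace M] [T2Space M] [SigmaCompactSpace M]
    [ChartedSpace (EuclideanSpace ℝ (Fin n)) M] [IsManifold (𝓡 n) ∞ M] :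
    CourantNQ.IsHomologicalVectorField
      (CourantNQ.courantTransition (n := n) (M := M)) CourantNQ.courantQ ∧
    Nonempty (CourantNQ.CoadjointRep n M) ∧
    ∀ R : CourantNQ.CoadjointRep n M,
      CourantNQ.IsHomologicalVectorField
        (CourantNQ.splitTransition (n := n) (M := M)) (CourantNQ.semidirectQ R) ∧
      ∃ Φ : CourantNQ.functionRing (CourantNQ.courantTransition (n := n) (M := M)) ≃ₐ[ℝ]
          CourantNQ.functionRing (CourantNQ.splitTransition (n := n) (M := M)),
        CourantNQ.IsNQIso CourantNQ.courantQ (CourantNQ.semidirectQ R) Φ := by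
  exact ⟨CourantNQ.isHomologicalVectorField_courantQ, CourantNQ.nonempty_coadjointRep, fun R ↦
    ⟨CourantNQ.isHomologicalVectorField_semidirectQ R, CourantNQ.functionRingEquiv R,
      CourantNQ.isNQIso_functionRingEquiv R⟩⟩
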